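/- \textbf{Setting.} Let $t,h\ge 0$ be integers, let $\mathcal V_i\subseteq[1:h]$ for $i\in[1:t]$ be arbitrary, let $\mathcal X_1,\dots,\mathcal X_t$ be finite alphabets and let $q$ be a p.m.f. on $\mathcal X_1\times\cdots\times\mathcal X_t$. Let $R,R_1,\dots,R_h\ge 0$. A coordinator sends a message $W$, uniform on $[1:\lfloor 2^{nR}\rfloor]$, to $t$ processors; independently of $W$ there are mutually independent shared random variables $W_1,\dots,W_h$, with $W_j$ uniform on $[1:\lfloor 2^{nR_j}\rfloor]$, none of which the coordinator sees. Processor $i$ observes $W$ and $W_{\mathcal V_i}=(W_j)_{j\in\mathcal V_i}$. A simulation code of blocklength $n$ is a family of conditional p.m.f.s $p(x_i^n\mid w,w_{\mathcal V_i})$, $i\in[1:t]$; it induces on $(\mathcal X_1)^n\times\cdots\times(\mathcal X_t)^n$ the p.m.f. $$p^{\mathrm{(induced)}}(x_1^n,\dots,x_t^n)=\frac{1}{\lfloor 2^{nR}\rfloor\prod_{j=1}^h\lfloor 2^{nR_j}\rfloor}\sum_{w,w_1,\dots,w_h}\prod_{i=1}^t p(x_i^n\mid w,w_{\mathcal V_i}).$$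 The tuple $(R,R_1,\dots,R_h)$ is achievable for $q$ if there is a sequence of such codes, one for each $n$, with $\lim_{n\to\infty}\lVert p^{\mathrm{(induced)}}-q^{(n)}\rVert_1=0$, where $q^{(n)}(x_1^n,\dots,x_t^n)=\prod_{k=1}^n q(x_{1k},\dots,x_{tk})$. The simulation rate region is the closure of the set of achievable tuples. Mutual information is in bits, and $R_{\mathcal S}:=\sum_{j\in\mathcal S}R_j$. \textbf{Theorem.} The simulation rate region is the set of all non-negative tuples $(R,R_1,\dots,R_h)$ such that $$R+R_{\mathcal S}\ \ge\ I(X_{[1:t]};U,U_{\mathcal S})\qquad\text{for every }\mathcal S\subseteq[1:h],$$ for some random variables $U,U_1,\dots,U_h$ with finite alphabets and some joint p.m.f. of $(U,U_{[1:h]},X_{[1:t]})$ whose $X_{[1:t]}$-marginal is $q$ and which factorizes as $$p(u,u_{[1:h]},x_{[1:t]})=p(u)\Bigl(\prod_{j=1}^h p(u_j)\Bigr)\Bigl(\prod_{i=1}^t p(x_i\mid u,u_{\mathcal V_i})\Bigr).$$ The joint p.m.f. may depend on the rate tuple, but is the same for all $\mathcal S$. In particular, in the absence of shared randomness ($\mathcal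 V_i=\emptyset$ for all $i$, for instance $h=0$), the region is the set of all $(R,R_1,\dots,R_h)$ with $R_1,\dots,R_h\ge0$ and $R\ge C(q)$, where $C(q)=\inf I(X_{[1:t]};U)$ is the multi-user Wyner common information: the infimum is over all $U$ with finite alphabet and all joint p.m.f.s $p(u)\prod_{i=1}^t p(x_i\mid u)$ whose $X_{[1:t]}$-marginal is $q$. -/

import Mathlib

open Filter Topology

noncomputable section

namespace ObliviousCoordinator

/-! ### Finite probability: p.m.f.s are elements of `stdSimplex ℝ α` -/

/-- The law of the random variable `f` on the finite probability space with p.m.f. `P`. -/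
def law {Ω A : Type*} [Fintype Ω] [DecidableEq A] (P : Ω → ℝ) (f : Ω → A) (a : A) : ℝ :=
  ∑ ω, if f ω = a then P ω else 0

/-- The mutual information `I(f; g)` in bits of two random variables on the finite probability
space with p.m.f. `P`. A summand with `P(f = a, g = b) = 0` is zero, as usual. -/
def mutualInfo {Ω A B : Type*} [Fintype Ω] [Fintype A] [Fintype B] [DecidableEq A]
    [DecidableEq B] (P : Ω → ℝ) (f : Ω → A) (g : Ω → B) : ℝ :=
  ∑ a, ∑ b, law P (fun ω => (f ω, g ω)) (a, b) *
    Real.logb 2 (law P (fun ω => (f ω, g ω)) (a, b) / (law P f a * law P g b))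

/-! ### Simulation codes and the simulation rate region -/

/-- The number of values `⌊2 ^ (n r)⌋` of a uniform random variable of rate `r` at
blocklength `n`. -/
def size (n : ℕ) (r : ℝ) : ℕ := ⌊(2 : ℝ) ^ ((n : ℝ) * r)⌋₊

/-- A simulation code of blocklength `n` for the oblivious coordinator: processor `i` sees the
coordinator's message `m` and the shared random variables `w_j`, `j ∈ V i`, and outputs a
sequence in `(X i) ^ n` according to the random map `dec i m w`. -/
structure Code {t h : ℕ} (V : Fin t → Finset (Fin h)) (X : Fin t → Type*)
    [∀ i, Fintype (X i)] (n : ℕ) (R : ℝ) (Rs : Fin h → ℝ) where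
  dec : ∀ i, Fin (size n R) → (∀ j : V i, Fin (size n (Rs j))) → (Fin n → X i) → ℝ
  dec_mem : ∀ i m w, dec i m w ∈ stdSimplex ℝ (Fin n → X i)

/-- The p.m.f. of the outputs `(X_1^n, …, X_t^n)` that a code induces, when the message and the
shared random variables are mutually independent and uniform. -/
def Code.induced {t h : ℕ} {V : Fin t → Finset (Fin h)} {X : Fin t → Type*}
    [∀ i, Fintype (X i)] {n : ℕ} {R : ℝ} {Rs : Fin h → ℝ} (c : Code V X n R Rs)
    (x : ∀ i, Fin n → X i) : ℝ :=
  ∑ m : Fin (size n R), ∑ w : (∀ j, Fin (size n (Rs j))),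
    (∏ i, c.dec i m ((V i).restrict w) (x i)) / ((size n R : ℝ) * ∏ j, (size n (Rs j) : ℝ))

/-- The p.m.f. of `n` i.i.d. copies of `(X_1, …, X_t) ∼ q`. -/
def iidPmf {t : ℕ} {X : Fin t → Type*} (q : (∀ i, X i) → ℝ) (n : ℕ)
    (x : ∀ i, Fin n → X i) : ℝ :=
  ∏ k : Fin n, q (fun i => x i k)

/-- The rate tuple `(R, R_1, …, R_h)` is achievable for `q`. -/
def Achievable {t h : ℕ} (V : Fin t → Finset (Fin h)) {X : Fin t → Type*}
    [∀ i, Fintype (X i)] (q : (∀ i, X i) → ℝ) (R : ℝ) (Rs : Fin h → ℝ) : Prop :=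
  0 ≤ R ∧ (∀ j, 0 ≤ Rs j) ∧
    ∃ c : ∀ n, Code V X n R Rs,
      Tendsto (fun n => ∑ x, |(c n).induced x - iidPmf q n x|) atTop (𝓝 0)

/-- The simulation rate region: the closure of the set of achievable rate tuples. -/
def rateRegion {t h : ℕ} (V : Fin t → Finset (Fin h)) {X : Fin t → Type*}
    [∀ i, Fintype (X i)] (q : (∀ i, X i) → ℝ) : Set (ℝ × (Fin h → ℝ)) :=
  closure {r | Achievable V q r.1 r.2}

/-! ### Auxiliary random variables -/

/-- `P` is a joint p.m.f. of `(U, U_{[1:h]}, X_{[1:t]})` of the form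
`p(u) ∏_j p(u_j) ∏_i p(x_i | u, u_{V_i})` under which `X_{[1:t]}` has p.m.f. `q`. -/
def IsAuxiliary {t h : ℕ} (V : Fin t → Finset (Fin h)) {X : Fin t → Type*}
    [∀ i, Fintype (X i)] [∀ i, DecidableEq (X i)] (q : (∀ i, X i) → ℝ)
    {a : ℕ} {b : Fin h → ℕ} (P : Fin a × (∀ j, Fin (b j)) × (∀ i, X i) → ℝ) : Prop :=
  P ∈ stdSimplex ℝ (Fin a × (∀ j, Fin (b j)) × (∀ i, X i)) ∧
  law P (fun ω => ω.2.2) = q ∧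
  ∃ (pU : Fin a → ℝ) (pUs : ∀ j, Fin (b j) → ℝ)
    (K : ∀ i, Fin a → (∀ j : V i, Fin (b j)) → X i → ℝ),
    pU ∈ stdSimplex ℝ (Fin a) ∧
    (∀ j, pUs j ∈ stdSimplex ℝ (Fin (b j))) ∧
    (∀ i u v, K i u v ∈ stdSimplex ℝ (X i)) ∧
    ∀ u us x, P (u, us, x) =
      pU u * (∏ j, pUs j (us j)) * ∏ i, K i u ((V i).restrict us) (x i)

/-- The single-letter region: all non-negative `(R, R_1, …, R_h)` with
`R + ∑_{j ∈ S} R_j ≥ I(X_{[1:t]}; U, U_S)` for all `S ⊆ [1:h]`, for some admissible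
auxiliary random variables with finite alphabets. -/
def singleLetterRegion {t h : ℕ} (V : Fin t → Finset (Fin h)) {X : Fin t → Type*}
    [∀ i, Fintype (X i)] [∀ i, DecidableEq (X i)] (q : (∀ i, X i) → ℝ) :
    Set (ℝ × (Fin h → ℝ)) :=
  {r | 0 ≤ r.1 ∧ (∀ j, 0 ≤ r.2 j) ∧
    ∃ (a : ℕ) (b : Fin h → ℕ) (P : Fin a × (∀ j, Fin (b j)) × (∀ i, X i) → ℝ),
      IsAuxiliary V q P ∧
      ∀ S : Finset (Fin h),
        mutualInfo P (fun ω => ω.2.2) (fun ω => (ω.1, S.restrict ω.2.1)) ≤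
          r.1 + ∑ j ∈ S, r.2 j}

/-- The multi-user Wyner common information of `q`: the infimum of `I(X_{[1:t]}; U)` over all
finite-alphabet `U` given which `X_1, …, X_t` are conditionally independent. -/
def wynerCommonInfo {t : ℕ} {X : Fin t → Type*} [∀ i, Fintype (X i)]
    [∀ i, DecidableEq (X i)] (q : (∀ i, X i) → ℝ) : ℝ :=
  sInf {c | ∃ (a : ℕ) (P : Fin a × (∀ i, X i) → ℝ) (pU : Fin a → ℝ)
      (K : ∀ i, Fin a → X i → ℝ),
    P ∈ stdSimplex ℝ (Fin a × (∀ i, X i)) ∧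
    law P (fun ω => ω.2) = q ∧
    pU ∈ stdSimplex ℝ (Fin a) ∧
    (∀ i u, K i u ∈ stdSimplex ℝ (X i)) ∧
    (∀ u x, P (u, x) = pU u * ∏ i, K i u (x i)) ∧
    c = mutualInfo P (fun ω => ω.2) (fun ω => ω.1)}

end ObliviousCoordinator

end

noncomputable section

namespace ObliviousCoordinator

open Finset
open scoped Pointwise

set_option linter.unusedSectionVars false

/-! Achievability is a soft-covering argument. For every message `m` one draws a cloud centre from
`U`, and for every pair of `m` and a value of `w_j` a codeword from `U_j`; processor `i` passes the
codewords it can compute through its kernel, letter by letter. In the second moment of the output,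
different messages are independent, and two index tuples with the same message that agree exactly on
`S` share exactly the codewords of `U` and `U_S`. After truncation to typical triples this gives one
term for each `S`, of exponent `I(X; U, U_S) - R - R_S`. The atypical mass is killed by a Chernoff
bound (`exists_codebook`, `exists_code`, `achievable_add`).

For the converse, `U` is the message together with a time index and `U_j` is `w_j`. The inequality
`H(X^n) ≤ H(W, W_S) + H(X^n | W, W_S)` and the continuity of the entropy show that every code meets
the single-letter bounds, up to a vanishing loss, for its averaged letter distribution
(`Code.mem_modelRegion`). The alphabets grow with `n`, so the limit requires the region to be
closed.

Closedness (`isClosed_modelRegion`) is the main difficulty: keeping all `2^h` informations while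
shrinking the alphabet of one `U_j` is not a linear problem in `p(u_j)`. Two observations circumvent
it. First, for independent inputs `I(X; U, U_S)` is supermodular in `S`, so the rate tuples allowed
by a fixed model are those dominating a convex combination of greedy vertices, and a vertex involves
only a chain of sets. Second, for one chain the inputs can be reduced in the order of the chain:
sets that contain the current input have conditional entropies linear in its law, and sets that do
not contain it are controlled by the output law at the finitely many values of the inputs already
reduced. Carathéodory's theorem then bounds the alphabets uniformly (`exists_bound_numAtoms`).
Vertices thus form a compact set, and time sharing through `U` makes the region the sum of the
compact convex hull of these vertices and an orthant. To make time sharing linear, the output law is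
carried as a coordinate and the entropy `H(q)` is moved into the first rate.

Without shared randomness only `S = ∅` matters: constant `U_j` suffice, and closedness of the rate
region absorbs an infimum that might not be attained. -/

/-! ### Expectations under product p.m.f.s -/

section ProdExp

variable {J : Type*} [Fintype J] [DecidableEq J] {A : J → Type*} [∀ j, Fintype (A j)]

/-- The expectation of `G` when the coordinates are independent and the `j`-th has p.m.f. `p j`. -/
def prodExp (p : ∀ j, A j → ℝ) (G : (∀ j, A j) → ℝ) : ℝ := ∑ u, (∏ j, p j (u j)) * G u

/-- The conditional expectation of `G` given the coordinates in `S`. -/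
def resample (p : ∀ j, A j → ℝ) (S : Finset J) (G : (∀ j, A j) → ℝ) (u : ∀ j, A j) : ℝ :=
  prodExp p (fun v => G (S.piecewise u v))

theorem prodExp_prod (p : ∀ j, A j → ℝ) (g : ∀ j, A j → ℝ) :
    prodExp p (fun u => ∏ j, g j (u j)) = ∏ j, ∑ a, p j a * g j a := by
  simp only [prodExp, ← Finset.prod_mul_distrib]
  rw [Finset.prod_univ_sum]
  simp

theorem prodExp_add (p : ∀ j, A j → ℝ) (G G' : (∀ j, A j) → ℝ) :
    prodExp p (fun u => G u + G' u) = prodExp p G + prodExp p G' := by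
  simp only [prodExp, mul_add, Finset.sum_add_distrib]

theorem prodExp_sub (p : ∀ j, A j → ℝ) (G G' : (∀ j, A j) → ℝ) :
    prodExp p (fun u => G u - G' u) = prodExp p G - prodExp p G' := by
  simp only [prodExp, mul_sub, Finset.sum_sub_distrib]

theorem prodExp_const_mul (p : ∀ j, A j → ℝ) (c : ℝ) (G : (∀ j, A j) → ℝ) :
    prodExp p (fun u => c * G u) = c * prodExp p G := by
  simp only [prodExp, Finset.mul_sum]
  exact Finset.sum_congr rfl fun u _ => by ring

theorem prodExp_mul_const (p : ∀ j, A j → ℝ) (c : ℝ) (G : (∀ j, A j) → ℝ) :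
    prodExp p (fun u => G u * c) = prodExp p G * c := by
  simp only [prodExp, Finset.sum_mul, mul_assoc]

theorem prodExp_sum (p : ∀ j, A j → ℝ) {I : Type*} (s : Finset I) (G : I → (∀ j, A j) → ℝ) :
    prodExp p (fun u => ∑ i ∈ s, G i u) = ∑ i ∈ s, prodExp p (G i) := by
  simp only [prodExp, Finset.mul_sum]
  rw [Finset.sum_comm]

theorem prodExp_const {p : ∀ j, A j → ℝ} (hp : ∀ j, p j ∈ stdSimplex ℝ (A j)) (c : ℝ) :
    prodExp p (fun _ => c) = c := by
  have h := prodExp_prod p (fun _ _ => (1 : ℝ))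
  simp only [Finset.prod_const_one, mul_one, (hp _).2] at h
  have h2 := prodExp_mul_const p c (fun _ => (1 : ℝ))
  simpa [h] using h2

theorem prodExp_weight_nonneg {p : ∀ j, A j → ℝ} (hp : ∀ j, p j ∈ stdSimplex ℝ (A j))
    (u : ∀ j, A j) : 0 ≤ ∏ j, p j (u j) := Finset.prod_nonneg fun j _ => (hp j).1 _

theorem prodExp_mono {p : ∀ j, A j → ℝ} (hp : ∀ j, p j ∈ stdSimplex ℝ (A j))
    {G G' : (∀ j, A j) → ℝ} (h : ∀ u, G u ≤ G' u) : prodExp p G ≤ prodExp p G' :=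
  Finset.sum_le_sum fun u _ => mul_le_mul_of_nonneg_left (h u) (prodExp_weight_nonneg hp u)

theorem prodExp_nonneg {p : ∀ j, A j → ℝ} (hp : ∀ j, p j ∈ stdSimplex ℝ (A j))
    {G : (∀ j, A j) → ℝ} (h : ∀ u, 0 ≤ G u) : 0 ≤ prodExp p G :=
  Finset.sum_nonneg fun u _ => mul_nonneg (prodExp_weight_nonneg hp u) (h u)

theorem resample_nonneg {p : ∀ j, A j → ℝ} (hp : ∀ j, p j ∈ stdSimplex ℝ (A j)) (S : Finset J)
    {G : (∀ j, A j) → ℝ} (h : ∀ u, 0 ≤ G u) (u : ∀ j, A j) : 0 ≤ resample p S G u :=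
  prodExp_nonneg hp fun _ => h _

theorem resample_congr (p : ∀ j, A j → ℝ) (S : Finset J) (G : (∀ j, A j) → ℝ)
    {u u' : ∀ j, A j} (h : ∀ j ∈ S, u j = u' j) : resample p S G u = resample p S G u' := by
  have : ∀ v, S.piecewise u v = S.piecewise u' v := fun v => by
    funext j
    by_cases hj : j ∈ S <;> simp [hj, h]
  simp only [resample, this]

theorem resample_piecewise (p : ∀ j, A j → ℝ) (S : Finset J) (G : (∀ j, A j) → ℝ)
    (u v : ∀ j, A j) : resample p S G (S.piecewise u v) = resample p S G u :=
  resample_congr p S G fun j hj => by simp [hj]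

theorem resample_piecewise_of_subset (p : ∀ j, A j → ℝ) {S T : Finset J} (hST : S ⊆ T)
    (G : (∀ j, A j) → ℝ) (u v : ∀ j, A j) :
    resample p S G (T.piecewise u v) = resample p S G u :=
  resample_congr p S G fun j hj => by simp [hST hj]

/-- Exchanging the coordinates outside `S` of two independent copies. -/
def swapOutside (S : Finset J) : ((∀ j, A j) × (∀ j, A j)) ≃ ((∀ j, A j) × (∀ j, A j)) where
  toFun z := (S.piecewise z.1 z.2, S.piecewise z.2 z.1)
  invFun z := (S.piecewise z.1 z.2, S.piecewise z.2 z.1)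
  left_inv z := by
    ext j <;> by_cases hj : j ∈ S <;> simp [hj]
  right_inv z := by
    ext j <;> by_cases hj : j ∈ S <;> simp [hj]

theorem prod_swapOutside (p : ∀ j, A j → ℝ) (S : Finset J) (u v : ∀ j, A j) :
    (∏ j, p j (S.piecewise u v j)) * ∏ j, p j (S.piecewise v u j)
      = (∏ j, p j (u j)) * ∏ j, p j (v j) := by
  rw [← Finset.prod_mul_distrib, ← Finset.prod_mul_distrib]
  refine Finset.prod_congr rfl fun j _ => ?_
  by_cases hj : j ∈ S <;> simp [hj, mul_comm]

/-- The pull-out property of conditional expectation. Written over two independent copies,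
exchanging the coordinates outside `S` preserves the weight, turns the mixed tuple into the first
copy, and is invisible to `Φ`. -/
theorem prodExp_resample_mul {p : ∀ j, A j → ℝ} (hp : ∀ j, p j ∈ stdSimplex ℝ (A j))
    (S : Finset J) (G Φ : (∀ j, A j) → ℝ) (hΦ : ∀ u v, Φ (S.piecewise u v) = Φ u) :
    prodExp p (fun u => resample p S G u * Φ u) = prodExp p (fun u => G u * Φ u) := by
  have h1 : prodExp p (fun u => resample p S G u * Φ u) =
      ∑ z : (∀ j, A j) × (∀ j, A j), ((∏ j, p j (z.1 j)) * ∏ j, p j (z.2 j)) *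
        (G (S.piecewise z.1 z.2) * Φ (S.piecewise z.1 z.2)) := by
    rw [Fintype.sum_prod_type]
    simp only [prodExp, resample, hΦ, Finset.sum_mul, Finset.mul_sum]
    exact Finset.sum_congr rfl fun u _ => Finset.sum_congr rfl fun v _ => by ring
  rw [h1]
  have h2 := (swapOutside (A := A) S).sum_comp (fun z => ((∏ j, p j (z.1 j)) * ∏ j, p j (z.2 j)) *
        (G z.1 * Φ z.1))
  simp only [swapOutside, Equiv.coe_fn_mk, prod_swapOutside] at h2
  rw [h2, Fintype.sum_prod_type]
  have h3 := prodExp_const hp (1 : ℝ)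
  simp only [prodExp, mul_one] at h3 ⊢
  refine Finset.sum_congr rfl fun u _ => ?_
  rw [← Finset.sum_mul, ← Finset.mul_sum, h3, mul_one]

theorem prodExp_resample {p : ∀ j, A j → ℝ} (hp : ∀ j, p j ∈ stdSimplex ℝ (A j))
    (S : Finset J) (G : (∀ j, A j) → ℝ) : prodExp p (resample p S G) = prodExp p G := by
  simpa using prodExp_resample_mul hp S G (fun _ => 1) (fun _ _ => rfl)

/-- Independence is what makes the intersection appear; without it the tower property would need
nested sets. -/
theorem resample_resample {p : ∀ j, A j → ℝ} (hp : ∀ j, p j ∈ stdSimplex ℝ (A j))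
    (S T : Finset J) (G : (∀ j, A j) → ℝ) (u : ∀ j, A j) :
    resample p S (resample p T G) u = resample p (S ∩ T) G u := by
  have h := prodExp_resample hp T (fun w => G ((S ∩ T).piecewise u w))
  rw [resample, resample, ← h]
  congr 1
  funext v
  simp only [resample]
  congr 1
  funext w
  congr 1
  funext j
  by_cases hS : j ∈ S <;> by_cases hT : j ∈ T <;> simp [hS, hT]

theorem resample_resample_of_subset {p : ∀ j, A j → ℝ} (hp : ∀ j, p j ∈ stdSimplex ℝ (A j))
    {S T : Finset J} (hST : S ⊆ T) (G : (∀ j, A j) → ℝ) (u : ∀ j, A j) :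
    resample p S (resample p T G) u = resample p S G u := by
  rw [resample_resample hp, Finset.inter_eq_left.2 hST]

theorem weight_mul_le_resample {p : ∀ j, A j → ℝ} (hp : ∀ j, p j ∈ stdSimplex ℝ (A j))
    (S : Finset J) {G : (∀ j, A j) → ℝ} (hG : ∀ u, 0 ≤ G u) (u : ∀ j, A j) :
    (∏ j, p j (u j)) * G u ≤ resample p S G u := by
  have := Finset.single_le_sum (f := fun v => (∏ j, p j (v j)) * G (S.piecewise u v))
    (fun v _ => mul_nonneg (prodExp_weight_nonneg hp v) (hG _)) (Finset.mem_univ u)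
  rwa [show S.piecewise u u = u by funext j; by_cases hj : j ∈ S <;> simp [hj]] at this

/-- The indicator depends on the coordinates in `S` only, so `G` may be replaced by its conditional
expectation, which is constant where the indicator is nonzero; the probability of the event
factorizes. -/
theorem prodExp_agree [∀ j, DecidableEq (A j)] {p : ∀ j, A j → ℝ}
    (hp : ∀ j, p j ∈ stdSimplex ℝ (A j)) (S : Finset J) (G : (∀ j, A j) → ℝ) (u : ∀ j, A j) :
    prodExp p (fun v => G v * if ∀ j ∈ S, v j = u j then 1 else 0) =
      (∏ j ∈ S, p j (u j)) * resample p S G u := by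
  have h1 : prodExp p (fun v => (∏ j, if j ∈ S then (if v j = u j then (1 : ℝ) else 0) else 1)
      * resample p S G u) = (∏ j ∈ S, p j (u j)) * resample p S G u := by
    rw [prodExp_mul_const,
      prodExp_prod p (fun j a => if j ∈ S then (if a = u j then (1 : ℝ) else 0) else 1)]
    congr 1
    rw [← Finset.prod_subset (Finset.subset_univ S)]
    · refine Finset.prod_congr rfl fun j hj => ?_
      simp [hj]
    · intro j _ hj
      simp [hj, (hp j).2]
  rw [← h1, ← prodExp_resample_mul hp S G (fun v => if ∀ j ∈ S, v j = u j then 1 else 0)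
    (fun v w => by
      congr 1
      exact propext (forall₂_congr fun j hj => by simp [hj]))]
  congr 1
  funext v
  by_cases h : ∀ j ∈ S, v j = u j
  · rw [if_pos h, resample_congr p S G h, Finset.prod_eq_one, one_mul, mul_one]
    intro j _
    by_cases hj : j ∈ S <;> simp [hj, h]
  · rw [if_neg h]
    push Not at h
    obtain ⟨j, hj, hv⟩ := h
    rw [Finset.prod_eq_zero (Finset.mem_univ j) (by simp [hj, hv]), zero_mul, mul_zero]

theorem prod_mul_resample_le {p : ∀ j, A j → ℝ} (hp : ∀ j, p j ∈ stdSimplex ℝ (A j))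
    (S : Finset J) {G : (∀ j, A j) → ℝ} (hG : ∀ u, 0 ≤ G u) (u : ∀ j, A j) :
    (∏ j ∈ S, p j (u j)) * resample p S G u ≤ prodExp p G := by
  classical
  rw [← prodExp_agree hp]
  refine prodExp_mono hp fun v => mul_le_of_le_one_right (hG v) ?_
  split_ifs
  exacts [le_rfl, zero_le_one]

theorem prodExp_map {B : J → Type*} [∀ j, Fintype (B j)] [∀ j, DecidableEq (A j)]
    (p : ∀ j, A j → ℝ) (p' : ∀ j, B j → ℝ) (φ : ∀ j, B j → A j)
    (h : ∀ j a, law (p' j) (φ j) a = p j a) (G : (∀ j, A j) → ℝ) :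
    prodExp p' (fun v => G (fun j => φ j (v j))) = prodExp p G := by
  simp only [prodExp, ← h, law]
  simp only [Finset.prod_univ_sum, Fintype.piFinset_univ, Finset.sum_mul]
  rw [Finset.sum_comm]
  refine Finset.sum_congr rfl fun v _ => ?_
  rw [Finset.sum_eq_single (fun j => φ j (v j))]
  · simp
  · intro u _ hu
    obtain ⟨j, hj⟩ := Function.ne_iff.1 hu
    rw [Finset.prod_eq_zero (Finset.mem_univ j) (by simp [Ne.symm hj]), zero_mul]
  · simp

theorem resample_map {B : J → Type*} [∀ j, Fintype (B j)] [∀ j, DecidableEq (A j)]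
    (p : ∀ j, A j → ℝ) (p' : ∀ j, B j → ℝ) (φ : ∀ j, B j → A j)
    (h : ∀ j a, law (p' j) (φ j) a = p j a) (S : Finset J) (G : (∀ j, A j) → ℝ)
    (u : ∀ j, B j) :
    resample p' S (fun v => G (fun j => φ j (v j))) u =
      resample p S G (fun j => φ j (u j)) := by
  rw [resample, resample, ← prodExp_map p p' φ h]
  congr 1
  funext v
  congr 1
  funext j
  by_cases hj : j ∈ S <;> simp [hj]

/-- Linearity in the `j`-th law, expressed through point masses. This is what turns the alphabet
reduction into a Carathéodory problem. -/
theorem prodExp_update (p : ∀ j, A j → ℝ) (j : J) [DecidableEq (A j)] (r : A j → ℝ)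
    (G : (∀ j, A j) → ℝ) :
    prodExp (Function.update p j r) G =
      ∑ a, r a * prodExp (Function.update p j (Pi.single a 1)) G := by
  simp only [prodExp, Finset.mul_sum]
  rw [Finset.sum_comm]
  refine Finset.sum_congr rfl fun u _ => ?_
  have h : ∀ s : A j → ℝ, ∏ i, Function.update p j s i (u i) =
      s (u j) * ∏ i ∈ univ.erase j, p i (u i) := fun s => by
    rw [← Finset.mul_prod_erase _ _ (Finset.mem_univ j)]
    congr 1
    · simp
    · exact Finset.prod_congr rfl fun i hi => by
        rw [Function.update_of_ne (Finset.ne_of_mem_erase hi)]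
  simp only [h]
  rw [Finset.sum_eq_single (u j)]
  · simp [mul_assoc]
  · intro b _ hb
    simp [hb.symm]
  · simp

theorem prodExp_coord {p : ∀ j, A j → ℝ} (hp : ∀ j, p j ∈ stdSimplex ℝ (A j)) (j : J)
    (f : A j → ℝ) : prodExp p (fun u => f (u j)) = ∑ a, p j a * f a := by
  have h := prodExp_prod p (Function.update (fun _ _ => (1 : ℝ)) j f)
  have h1 : ∀ u : ∀ j, A j, ∏ i, Function.update (fun _ _ => (1 : ℝ)) j f i (u i) = f (u j) :=
    fun u => by
      rw [Fintype.prod_eq_single j fun i hi => by rw [Function.update_of_ne hi]]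
      simp
  simp only [h1] at h
  rw [h, Fintype.prod_eq_single j fun i hi => by
    rw [Function.update_of_ne hi]; simp [(hp i).2]]
  simp

theorem prodExp_congr_support {p : ∀ j, A j → ℝ} {G G' : (∀ j, A j) → ℝ}
    (h : ∀ u, (∀ j, p j (u j) ≠ 0) → G u = G' u) : prodExp p G = prodExp p G' := by
  refine Finset.sum_congr rfl fun u _ => ?_
  by_cases hu : ∀ j, p j (u j) ≠ 0
  · rw [h u hu]
  · push Not at hu
    obtain ⟨j, hj⟩ := hu
    rw [Finset.prod_eq_zero (Finset.mem_univ j) hj, zero_mul, zero_mul]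

end ProdExp

/-! ### Conditional entropies (in nats) given independent random variables -/

section CondEnt

variable {J : Type*} [Fintype J] [DecidableEq J] {A : J → Type*} [∀ j, Fintype (A j)]
  {Y : Type*} [Fintype Y]

/-- The conditional entropy in nats of the output of the channel `W` given the inputs in `S`,
when the inputs are independent with p.m.f.s `p j`. -/
def condEnt (p : ∀ j, A j → ℝ) (W : (∀ j, A j) → Y → ℝ) (S : Finset J) : ℝ :=
  prodExp p (fun u => ∑ x, Real.negMulLog (resample p S (fun v => W v x) u))

/-- Jensen's inequality for `negMulLog`, since the output law given `S` is an average of the output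
laws given `T`. -/
theorem condEnt_anti {p : ∀ j, A j → ℝ} (hp : ∀ j, p j ∈ stdSimplex ℝ (A j))
    {W : (∀ j, A j) → Y → ℝ} (hW : ∀ u x, 0 ≤ W u x) {S T : Finset J} (hST : S ⊆ T) :
    condEnt p W T ≤ condEnt p W S := by
  simp only [condEnt, prodExp_sum]
  refine Finset.sum_le_sum fun x _ => ?_
  rw [← prodExp_resample hp S]
  refine prodExp_mono hp fun u => ?_
  rw [← resample_resample_of_subset hp hST (fun v => W v x) u]
  have := Real.concaveOn_negMulLog.le_map_sum (t := Finset.univ)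
    (w := fun v : ∀ j, A j => ∏ j, p j (v j))
    (p := fun v => resample p T (fun v => W v x) (S.piecewise u v))
    (fun v _ => prodExp_weight_nonneg hp v) (by simpa [prodExp] using prodExp_const hp 1)
    (fun v _ => resample_nonneg hp T (fun _ => hW _ x) _)
  exact this

theorem prodExp_negMulLog_resample {p : ∀ j, A j → ℝ} (hp : ∀ j, p j ∈ stdSimplex ℝ (A j))
    (S : Finset J) (G : (∀ j, A j) → ℝ) :
    prodExp p (fun u => Real.negMulLog (resample p S G u)) =
      prodExp p (fun u => G u * -Real.log (resample p S G u)) := by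
  rw [← prodExp_resample_mul hp S G (fun u => -Real.log (resample p S G u))
    (fun u v => by rw [resample_piecewise])]
  simp only [Real.negMulLog, neg_mul, mul_neg]

/-- For independent inputs, conditioning on further inputs can only increase the information that
`U_j` carries about the output. The difference is a relative-entropy type quantity, bounded below by
`log z ≤ z - 1`. -/
theorem condEnt_submodular {p : ∀ j, A j → ℝ} (hp : ∀ j, p j ∈ stdSimplex ℝ (A j))
    {W : (∀ j, A j) → Y → ℝ} (hW : ∀ u x, 0 ≤ W u x) {S T : Finset J} (hST : S ⊆ T) {j : J}
    (hj : j ∉ T) :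
    condEnt p W S - condEnt p W (insert j S) ≤ condEnt p W T - condEnt p W (insert j T) := by
  simp only [condEnt, prodExp_sum, ← Finset.sum_sub_distrib]
  refine Finset.sum_le_sum fun x _ => ?_
  set G : (∀ j, A j) → ℝ := fun v => W v x with hGdef
  have hG : ∀ u, 0 ≤ G u := fun u => hW u x
  set a := resample p (insert j T) G with ha
  set b := resample p T G with hb
  set a' := resample p (insert j S) G with ha'
  set b' := resample p S G with hb'
  have hsub : insert j S ⊆ insert j T := Finset.insert_subset_insert j hST
  have a0 : ∀ u, 0 ≤ a u := resample_nonneg hp _ hG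
  have b0 : ∀ u, 0 ≤ b u := resample_nonneg hp _ hG
  have a0' : ∀ u, 0 ≤ a' u := resample_nonneg hp _ hG
  have b0' : ∀ u, 0 ≤ b' u := resample_nonneg hp _ hG
  have eb : resample p T a = b := by
    funext u; exact resample_resample_of_subset hp (Finset.subset_insert _ _) G u
  have ea' : resample p (insert j S) a = a' := by
    funext u; exact resample_resample_of_subset hp hsub G u
  have eb' : resample p S a = b' := by
    funext u; exact resample_resample_of_subset hp (hST.trans (Finset.subset_insert _ _)) G u
  have eb'' : resample p (insert j S) b = b' := by
    funext u
    rw [hb, resample_resample hp, Finset.insert_inter_of_notMem hj, Finset.inter_eq_left.2 hST]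
  have e1 : prodExp p (fun u => Real.negMulLog (a u)) = prodExp p (fun u => a u * -Real.log (a u)) := by
    simp only [Real.negMulLog, neg_mul, mul_neg]
  have e2 := prodExp_negMulLog_resample hp T a
  have e3 := prodExp_negMulLog_resample hp (insert j S) a
  have e4 := prodExp_negMulLog_resample hp S a
  rw [eb] at e2
  rw [ea'] at e3
  rw [eb'] at e4
  rw [e1, e2, e3, e4]
  -- The ratio depends on the coordinates in `insert j S` only, and conditioning `b` on these gives
  -- `b'` because `j ∉ T`.
  have e5 : prodExp p (fun u => b u * (a' u / b' u)) = prodExp p (fun u => b' u * (a' u / b' u)) := by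
    rw [← prodExp_resample_mul hp (insert j S) b (fun u => a' u / b' u)
      (fun u v => by
        simp only [ha', hb']
        rw [resample_piecewise, resample_piecewise_of_subset p (Finset.subset_insert j S)]), eb'']
  have e6 : prodExp p (fun u => b' u * (a' u / b' u)) ≤ prodExp p a := by
    rw [← prodExp_resample hp (insert j S) a, ea']
    refine prodExp_mono hp fun u => ?_
    rcases (b0' u).eq_or_lt with h | h
    · rw [← h, zero_mul]; exact a0' u
    · rw [mul_div_cancel₀ _ h.ne']
  -- Pointwise this is `a * log z ≤ a * (z - 1)` with `z = b * a' / (b' * a)`; by `e5` and `e6` the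
  -- left-hand side is nonnegative.
  have key : prodExp p (fun u => a u - b u * (a' u / b' u)) ≤
      prodExp p (fun u => (a u * -Real.log (b u) - a u * -Real.log (a u)) -
        (a u * -Real.log (b' u) - a u * -Real.log (a' u))) := by
    refine Finset.sum_le_sum fun u _ => ?_
    have hw := prodExp_weight_nonneg hp u
    rcases hw.eq_or_lt with h | h
    · rw [← h, zero_mul, zero_mul]
    refine mul_le_mul_of_nonneg_left ?_ hw
    beta_reduce
    rcases (a0 u).eq_or_lt with h1 | h1
    · rw [← h1]
      simp only [zero_mul, sub_self, zero_sub, neg_nonpos]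
      exact mul_nonneg (b0 u) (div_nonneg (a0' u) (b0' u))
    have pos : ∀ S : Finset J, 0 < resample p S a u := fun S =>
      lt_of_lt_of_le (mul_pos h h1) (weight_mul_le_resample hp S a0 u)
    have hbu : 0 < b u := eb ▸ pos T
    have hau' : 0 < a' u := ea' ▸ pos (insert j S)
    have hbu' : 0 < b' u := eb' ▸ pos S
    have hl := Real.log_le_sub_one_of_pos (show 0 < b u * (a' u / b' u) / a u by positivity)
    rw [Real.log_div (by positivity) h1.ne', Real.log_mul hbu.ne' (by positivity),
      Real.log_div hau'.ne' hbu'.ne'] at hl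
    have := mul_le_mul_of_nonneg_left hl h1.le
    rw [mul_sub, mul_sub (a u) _ 1, mul_one, mul_div_cancel₀ _ h1.ne'] at this
    nlinarith
  rw [prodExp_sub, prodExp_sub, prodExp_sub, prodExp_sub, e5] at key
  linarith

theorem condEnt_map {B : J → Type*} [∀ j, Fintype (B j)] [∀ j, DecidableEq (A j)]
    (p : ∀ j, A j → ℝ) (p' : ∀ j, B j → ℝ) (φ : ∀ j, B j → A j)
    (h : ∀ j a, law (p' j) (φ j) a = p j a) (W : (∀ j, A j) → Y → ℝ) (S : Finset J) :
    condEnt p' (fun v => W (fun j => φ j (v j))) S = condEnt p W S := by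
  rw [condEnt, condEnt, ← prodExp_map p p' φ h]
  congr 1
  funext v
  refine Finset.sum_congr rfl fun x _ => ?_
  rw [resample_map p p' φ h S (fun u => W u x)]

end CondEnt

/-! ### Contra-polymatroids and their greedy vertices -/

section Greedy

variable {m : ℕ}

/-- The set of the first `k` elements in the order given by `π`. -/
def initSeg (π : Equiv.Perm (Fin m)) (k : ℕ) : Finset (Fin m) :=
  Finset.univ.filter fun j => (π j : ℕ) < k

/-- The increments of `G` along the order given by `π`. -/
def greedy (G : Finset (Fin m) → ℝ) (π : Equiv.Perm (Fin m)) (j : Fin m) : ℝ :=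
  G (initSeg π (π j + 1)) - G (initSeg π (π j))

theorem mem_initSeg {π : Equiv.Perm (Fin m)} {k : ℕ} {j : Fin m} :
    j ∈ initSeg π k ↔ (π j : ℕ) < k := by simp [initSeg]

theorem initSeg_zero (π : Equiv.Perm (Fin m)) : initSeg π 0 = ∅ := by
  ext; simp [mem_initSeg]

theorem initSeg_self (π : Equiv.Perm (Fin m)) : initSeg π m = Finset.univ := by
  ext; simp [mem_initSeg]

theorem notMem_initSeg (π : Equiv.Perm (Fin m)) (j : Fin m) : j ∉ initSeg π (π j) := by
  simp [mem_initSeg]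

theorem initSeg_succ (π : Equiv.Perm (Fin m)) (j : Fin m) :
    initSeg π (π j + 1) = insert j (initSeg π (π j)) := by
  ext i
  simp only [mem_initSeg, Finset.mem_insert, Nat.lt_succ_iff_lt_or_eq, Fin.val_inj,
    π.injective.eq_iff]
  tauto

theorem initSeg_mono (π : Equiv.Perm (Fin m)) {k l : ℕ} (h : k ≤ l) :
    initSeg π k ⊆ initSeg π l := fun j hj => by
  rw [mem_initSeg] at hj ⊢
  omega

/-- Build up `T` in the order `π`: by supermodularity each increment inside `T` is at most the
increment over the full initial segment. -/
theorem le_sum_greedy {G : Finset (Fin m) → ℝ} (h0 : G ∅ = 0)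
    (hG : ∀ S T : Finset (Fin m), S ⊆ T → ∀ j ∉ T, G (insert j S) - G S ≤ G (insert j T) - G T)
    (π : Equiv.Perm (Fin m)) (T : Finset (Fin m)) : G T ≤ ∑ j ∈ T, greedy G π j := by
  have key : ∀ k ≤ m, G (T ∩ initSeg π k) ≤ ∑ j ∈ T ∩ initSeg π k, greedy G π j := by
    intro k
    induction k with
    | zero => intro _; simp [initSeg_zero, h0]
    | succ k ih =>
      intro hk
      have ih := ih (by omega)
      obtain ⟨j, hj⟩ : ∃ j, (π j : ℕ) = k := ⟨π.symm ⟨k, hk⟩, by simp⟩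
      subst hj
      rw [initSeg_succ]
      have hn := notMem_initSeg π j
      by_cases hjT : j ∈ T
      · rw [Finset.inter_insert_of_mem hjT, Finset.sum_insert (by simp [hn])]
        have := hG (T ∩ initSeg π (π j)) (initSeg π (π j)) Finset.inter_subset_right j hn
        rw [greedy, initSeg_succ]
        linarith
      · rwa [Finset.inter_insert_of_notMem hjT]
  simpa [initSeg_self] using key m le_rfl

theorem sum_mul_sub_nonneg {c d : ℕ → ℝ} (hc : Antitone c) (hc0 : ∀ i, 0 ≤ c i) (hd : ∀ i, 0 ≤ d i)
    (hd0 : d 0 = 0) (n : ℕ) : 0 ≤ ∑ i ∈ Finset.range n, c i * (d (i + 1) - d i) := by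
  have key : c n * d n ≤ ∑ i ∈ Finset.range n, c i * (d (i + 1) - d i) := by
    induction n with
    | zero => simp [hd0]
    | succ n ih =>
      rw [Finset.sum_range_succ]
      have := mul_le_mul_of_nonneg_right (hc (Nat.le_succ n)) (hd (n + 1))
      simp only [Nat.succ_eq_add_one] at this
      linarith
  exact (mul_nonneg (hc0 n) (hd n)).trans key

/-- Edmonds' greedy algorithm: take the elements in order of decreasing cost and sum by parts, using
that the slacks of `r` on the initial segments are nonnegative. Supermodularity is not needed in
this direction. -/
theorem exists_greedy_le {G : Finset (Fin m) → ℝ} (h0 : G ∅ = 0) {r c : Fin m → ℝ}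
    (hr : ∀ T, G T ≤ ∑ j ∈ T, r j) (hc : ∀ j, 0 ≤ c j) :
    ∃ π, ∑ j, c j * greedy G π j ≤ ∑ j, c j * r j := by
  set σ := Tuple.sort (fun j => - c j) with hσ
  have hmono : Monotone ((fun j => - c j) ∘ σ) := Tuple.monotone_sort _
  refine ⟨σ.symm, ?_⟩
  set d : ℕ → ℝ := fun k => ∑ j ∈ initSeg σ.symm k, r j - G (initSeg σ.symm k) with hd
  -- Padding the sorted costs with zeros keeps the sequence antitone and nonnegative on all of `ℕ`.
  set c' : ℕ → ℝ := fun i => if h : i < m then c (σ ⟨i, h⟩) else 0 with hc'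
  have h1 := sum_mul_sub_nonneg (c := c') (d := d) (fun i k hik => by
      simp only [hc']
      by_cases hk : k < m
      · have hi : i < m := by omega
        have := hmono (show (⟨i, hi⟩ : Fin m) ≤ ⟨k, hk⟩ from hik)
        simp only [Function.comp_apply, neg_le_neg_iff] at this
        simpa [hk, hi] using this
      · by_cases hi : i < m <;> simp [hk, hi, hc])
    (fun i => by simp only [hc']; split_ifs; exacts [hc _, le_rfl])
    (fun i => sub_nonneg.2 (hr _)) (by simp [hd, initSeg_zero, h0]) m
  rw [← Fin.sum_univ_eq_sum_range (fun i => c' i * (d (i + 1) - d i)),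
    ← Equiv.sum_comp σ.symm] at h1
  have h2 : ∀ j, c' (σ.symm j) * (d (σ.symm j + 1) - d (σ.symm j)) =
      c j * r j - c j * greedy G σ.symm j := fun j => by
    have e1 : c' (σ.symm j) = c j := by simp [hc']
    simp only [e1, hd, greedy]
    rw [initSeg_succ, Finset.sum_insert (notMem_initSeg _ _)]
    ring
  simp only [h2, Finset.sum_sub_distrib] at h1
  linarith

/-- Otherwise a hyperplane separates `r` from the hull plus the orthant. Its normal vector is
nonnegative, so it is a cost vector for which `r` beats every greedy vector, against
`exists_greedy_le`. -/
theorem mem_convexHull_greedy_add {G : Finset (Fin m) → ℝ} (h0 : G ∅ = 0) {r : Fin m → ℝ}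
    (hr : ∀ T, G T ≤ ∑ j ∈ T, r j) :
    ∃ v ∈ convexHull ℝ (Set.range (greedy G)), v ≤ r := by
  by_contra! hcon
  have hcl : IsClosed (convexHull ℝ (Set.range (greedy G)) + Set.Ici (0 : Fin m → ℝ)) :=
    isClosed_Ici.add_left_of_isCompact ((Set.finite_range _).isCompact_convexHull ℝ)
  have hcv : Convex ℝ (convexHull ℝ (Set.range (greedy G)) + Set.Ici (0 : Fin m → ℝ)) :=
    (convex_convexHull ℝ _).add (convex_Ici 0)
  have hnot : r ∉ convexHull ℝ (Set.range (greedy G)) + Set.Ici (0 : Fin m → ℝ) := by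
    rintro ⟨v, hv, w, hw, rfl⟩
    exact hcon v hv (le_add_of_nonneg_right hw)
  obtain ⟨f, s, hs, hf⟩ := geometric_hahn_banach_point_closed hcv hcl hnot
  have hfs : ∀ x, f x = ∑ j, f (Pi.single j 1) * x j := fun x => by
    conv_lhs => rw [pi_eq_sum_univ' x]
    rw [map_sum]
    refine Finset.sum_congr rfl fun j _ => ?_
    rw [map_smul, smul_eq_mul, mul_comm]
  have hg : ∀ π, greedy G π ∈ convexHull ℝ (Set.range (greedy G)) := fun π =>
    subset_convexHull ℝ _ ⟨π, rfl⟩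
  -- Along a coordinate with negative coefficient the functional would drop below `s` without
  -- leaving the sum.
  have hc : ∀ j, 0 ≤ f (Pi.single j 1) := by
    intro j
    by_contra! hneg
    obtain ⟨n, hn⟩ := exists_nat_gt ((f (greedy G 1) - s) / - f (Pi.single j 1))
    have h1 := hf (greedy G 1 + (n : ℝ) • Pi.single j 1) ⟨_, hg 1, _, by
      rw [Set.mem_Ici]
      exact smul_nonneg (Nat.cast_nonneg n) (Pi.single_nonneg.2 zero_le_one), rfl⟩
    rw [div_lt_iff₀ (by linarith)] at hn
    rw [map_add, map_smul, smul_eq_mul] at h1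
    linarith
  obtain ⟨π, hπ⟩ := exists_greedy_le h0 hr hc
  have h1 := hf (greedy G π) ⟨_, hg π, 0, by simp, add_zero _⟩
  rw [hfs] at h1 hs
  linarith

end Greedy

/-! ### Carathéodory's theorem with a fixed number of points -/

/-- Carathéodory's theorem, padded with zero weights so that the number of points no longer depends
on `x`. -/
theorem exists_stdSimplex_fin_of_mem_convexHull {E : Type*} [AddCommGroup E] [Module ℝ E]
    [FiniteDimensional ℝ E] {s : Set E} {x : E} (hx : x ∈ convexHull ℝ s) :
    ∃ w ∈ stdSimplex ℝ (Fin (Module.finrank ℝ E + 1)),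
      ∃ z : Fin (Module.finrank ℝ E + 1) → E, (∀ i, z i ∈ s) ∧ ∑ i, w i • z i = x := by
  obtain ⟨ι, _, z, w, hz, hind, hw, hw1, hwx⟩ := eq_pos_convex_span_of_mem_convexHull hx
  obtain ⟨z₀, hz₀⟩ : s.Nonempty := (convexHull_nonempty_iff (𝕜 := ℝ)).1 ⟨x, hx⟩
  have hcard : Fintype.card ι ≤ Fintype.card (Fin (Module.finrank ℝ E + 1)) := by
    rw [Fintype.card_fin]
    exact hind.card_le_finrank_succ.trans (Nat.succ_le_succ (Submodule.finrank_le _))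
  obtain ⟨e⟩ := Function.Embedding.nonempty_of_card_le hcard
  refine ⟨Function.extend e w 0, ⟨fun i => ?_, ?_⟩, Function.extend e z (fun _ => z₀), fun i => ?_, ?_⟩
  · by_cases h : ∃ j, e j = i
    · obtain ⟨j, rfl⟩ := h
      rw [e.injective.extend_apply]
      exact (hw j).le
    · rw [Function.extend_apply' _ _ _ h]; simp
  · rw [← hw1]
    refine (Fintype.sum_of_injective e e.injective _ _ (fun i hi => ?_) fun j => ?_).symm
    · rw [Function.extend_apply' _ _ _ hi]; simp
    · rw [e.injective.extend_apply]
  · by_cases h : ∃ j, e j = i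
    · obtain ⟨j, rfl⟩ := h
      rw [e.injective.extend_apply]
      exact hz ⟨j, rfl⟩
    · rwa [Function.extend_apply' _ _ _ h]
  · rw [← hwx]
    refine (Fintype.sum_of_injective e e.injective _ _ (fun i hi => ?_) fun j => ?_).symm
    · rw [Function.extend_apply' _ _ _ hi]; simp
    · rw [e.injective.extend_apply, e.injective.extend_apply]

theorem isCompact_convexHull_of_finiteDimensional {E : Type*} [NormedAddCommGroup E]
    [NormedSpace ℝ E] [FiniteDimensional ℝ E] {s : Set E} (hs : IsCompact s) :
    IsCompact (convexHull ℝ s) := by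
  set d := Module.finrank ℝ E + 1 with hd
  have h : convexHull ℝ s = (fun y : (Fin d → ℝ) × (Fin d → E) => ∑ i, y.1 i • y.2 i) ''
      (stdSimplex ℝ (Fin d) ×ˢ Set.univ.pi fun _ => s) := by
    apply Set.Subset.antisymm
    · intro x hx
      obtain ⟨w, hw, z, hz, rfl⟩ := exists_stdSimplex_fin_of_mem_convexHull hx
      exact ⟨(w, z), ⟨hw, fun i _ => hz i⟩, rfl⟩
    · rintro _ ⟨⟨w, z⟩, ⟨hw, hz⟩, rfl⟩
      exact (convex_convexHull ℝ s).sum_mem (fun i _ => hw.1 i) hw.2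
        fun i _ => subset_convexHull ℝ s (hz i trivial)
  rw [h]
  refine ((isCompact_stdSimplex ℝ (Fin d)).prod (isCompact_univ_pi fun _ => hs)).image ?_
  fun_prop

/-- The number of atoms of a p.m.f. -/
def numAtoms {α : Type*} [Fintype α] (p : α → ℝ) : ℕ := (Finset.univ.filter fun a => p a ≠ 0).card

theorem sum_law_mul {Ω A : Type*} [Fintype Ω] [Fintype A] [DecidableEq A] (P : Ω → ℝ) (f : Ω → A)
    (g : A → ℝ) : ∑ a, law P f a * g a = ∑ ω, P ω * g (f ω) := by
  simp only [law, Finset.sum_mul]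
  rw [Finset.sum_comm]
  refine Finset.sum_congr rfl fun ω _ => ?_
  simp

theorem law_mem_stdSimplex {Ω A : Type*} [Fintype Ω] [Fintype A] [DecidableEq A] {P : Ω → ℝ}
    (hP : P ∈ stdSimplex ℝ Ω) (f : Ω → A) : law P f ∈ stdSimplex ℝ A := by
  refine ⟨fun a => Finset.sum_nonneg fun ω _ => ?_, ?_⟩
  · split_ifs
    exacts [hP.1 ω, le_rfl]
  · have := sum_law_mul P f fun _ => 1
    simpa [hP.2] using this

/-- Carathéodory in `D → ℝ` for the barycentre of `φ`: prescribing `|D|` linear functionals costs at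
most `|D| + 1` atoms. -/
theorem exists_numAtoms_le {α D : Type*} [Fintype α] [Fintype D] {p : α → ℝ}
    (hp : p ∈ stdSimplex ℝ α) (φ : α → D → ℝ) :
    ∃ r ∈ stdSimplex ℝ α, numAtoms r ≤ Fintype.card D + 1 ∧
      ∀ d, ∑ a, r a * φ a d = ∑ a, p a * φ a d := by
  classical
  have hx : ∑ a, p a • φ a ∈ convexHull ℝ (Set.range φ) :=
    (convex_convexHull ℝ _).sum_mem (fun a _ => hp.1 a) hp.2
      fun a _ => subset_convexHull ℝ _ ⟨a, rfl⟩
  have hmem := exists_stdSimplex_fin_of_mem_convexHull hx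
  rw [Module.finrank_fintype_fun_eq_card] at hmem
  obtain ⟨w, hw, z, hz, hwz⟩ := hmem
  choose s hs using hz
  refine ⟨law w s, law_mem_stdSimplex hw s, ?_, fun d => ?_⟩
  · have hsub : (Finset.univ.filter fun a => law w s a ≠ 0) ⊆ Finset.univ.image s := by
      intro a ha
      by_contra hn
      refine (Finset.mem_filter.1 ha).2 (Finset.sum_eq_zero fun i _ => if_neg fun h => hn ?_)
      exact Finset.mem_image.2 ⟨i, Finset.mem_univ i, h⟩
    exact (Finset.card_le_card hsub).trans (Finset.card_image_le.trans (by simp))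
  · rw [sum_law_mul]
    have h := congrFun hwz d
    simp only [Finset.sum_apply, Pi.smul_apply, smul_eq_mul] at h
    rw [← h]
    exact Finset.sum_congr rfl fun i _ => by rw [hs]

theorem exists_fin_law_eq {α : Type*} [Fintype α] [DecidableEq α] {p : α → ℝ}
    (hp : p ∈ stdSimplex ℝ α) {N : ℕ} (hN : numAtoms p ≤ N) :
    ∃ s : Fin N → α, (∀ a, p a ≠ 0 → ∃ i, s i = a) ∧
      ∃ w ∈ stdSimplex ℝ (Fin N), ∀ a, law w s a = p a := by
  obtain ⟨e⟩ : Nonempty ({a // p a ≠ 0} ↪ Fin N) := by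
    apply Function.Embedding.nonempty_of_card_le
    rwa [Fintype.card_subtype, Fintype.card_fin]
  obtain ⟨a₀, -⟩ : ∃ a, p a ≠ 0 := by
    by_contra! h
    have := hp.2
    simp [h] at this
  have hs : ∀ b, Function.extend e Subtype.val (fun _ => a₀) (e b) = b :=
    fun b => e.injective.extend_apply _ _ b
  have hw : ∀ f : α → ℝ, ∑ i, Function.extend e (fun b => p b) 0 i *
      f (Function.extend e Subtype.val (fun _ => a₀) i) = ∑ a, p a * f a := by
    intro f
    rw [← Fintype.sum_of_injective e e.injective (fun b => p b * f b) _ (fun i hi => ?_) fun b => ?_]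
    · refine Fintype.sum_of_injective _ Subtype.val_injective _ _ (fun a ha => ?_) fun _ => rfl
      have : p a = 0 := by
        by_contra h
        exact ha ⟨⟨a, h⟩, rfl⟩
      simp [this]
    · rw [Function.extend_apply' _ _ _ hi]; simp
    · rw [hs, e.injective.extend_apply]
  refine ⟨Function.extend e Subtype.val (fun _ => a₀), fun a ha => ⟨e ⟨a, ha⟩, hs _⟩,
    Function.extend e (fun b => p b) 0, ⟨fun i => ?_, ?_⟩, fun a => ?_⟩
  · by_cases h : ∃ j, e j = i
    · obtain ⟨j, rfl⟩ := h
      rw [e.injective.extend_apply]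
      exact hp.1 _
    · rw [Function.extend_apply' _ _ _ h]; simp
  · simpa [hp.2] using hw fun _ => 1
  · have := hw fun b => if b = a then 1 else 0
    simpa [law] using this

/-! ### Reducing the number of atoms of one input -/

section Reduce

variable {J : Type*} [Fintype J] [DecidableEq J] {A : J → Type*} [∀ j, Fintype (A j)]
  {Y : Type*} [Fintype Y]

/-- Adjoin an independent copy with the other law and exchange the coordinates outside `S`; the laws
agree on `S` and `F` does not see the rest. -/
theorem prodExp_congr_left {p p' : ∀ j, A j → ℝ} (hp : ∀ j, p j ∈ stdSimplex ℝ (A j))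
    (hp' : ∀ j, p' j ∈ stdSimplex ℝ (A j)) {S : Finset J} (h : ∀ j ∈ S, p j = p' j)
    {F : (∀ j, A j) → ℝ} (hF : ∀ u v, F (S.piecewise u v) = F u) :
    prodExp p F = prodExp p' F := by
  have h1 : ∀ p p' : ∀ j, A j → ℝ, (∀ j, p' j ∈ stdSimplex ℝ (A j)) → prodExp p F =
      ∑ z : (∀ j, A j) × (∀ j, A j), ((∏ j, p j (z.1 j)) * ∏ j, p' j (z.2 j)) * F z.1 := by
    intro p p' hp'
    have h3 := prodExp_const hp' (1 : ℝ)
    simp only [prodExp, mul_one] at h3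
    rw [Fintype.sum_prod_type, prodExp]
    refine Finset.sum_congr rfl fun u _ => ?_
    dsimp only
    rw [← Finset.sum_mul, ← Finset.mul_sum, h3, mul_one]
  rw [h1 p p' hp', h1 p' p hp, ← (swapOutside (A := A) S).sum_comp]
  refine Finset.sum_congr rfl fun z _ => ?_
  simp only [swapOutside, Equiv.coe_fn_mk, hF]
  congr 1
  rw [← Finset.prod_mul_distrib, ← Finset.prod_mul_distrib]
  refine Finset.prod_congr rfl fun j _ => ?_
  by_cases hj : j ∈ S <;> simp [hj, h, mul_comm]

theorem resample_congr_left {p p' : ∀ j, A j → ℝ} (hp : ∀ j, p j ∈ stdSimplex ℝ (A j))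
    (hp' : ∀ j, p' j ∈ stdSimplex ℝ (A j)) {S : Finset J} (h : ∀ j ∉ S, p j = p' j)
    (G : (∀ j, A j) → ℝ) (u : ∀ j, A j) : resample p S G u = resample p' S G u := by
  refine prodExp_congr_left hp hp' (S := Sᶜ) (fun j hj => h j (by simpa using hj)) fun v w => ?_
  congr 1
  funext j
  by_cases hj : j ∈ S <;> simp [hj]

/-- Three families of functionals, all linear in the law of input `j`, are kept: the output law
given each relevant value of the inputs in `T`, the output law itself, and the conditional entropies
given sets that contain `j`. The first family is finite of controlled size because the inputs in `T`
have at most `N` atoms, and it determines the conditional entropies given subsets of `T`. -/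
theorem exists_update_numAtoms_le {I : Type*} [Fintype I] {p : ∀ j, A j → ℝ}
    (hp : ∀ j, p j ∈ stdSimplex ℝ (A j)) (W : (∀ j, A j) → Y → ℝ)
    {T : Finset J} {j : J} (hj : j ∉ T) {N : ℕ} (hN0 : 0 < N)
    (hN : ∀ i ∈ T, numAtoms (p i) ≤ N)
    (S : I → Finset J) :
    ∃ r ∈ stdSimplex ℝ (A j),
      numAtoms r ≤ Fintype.card (((J → Fin N) × Y) ⊕ (Y ⊕ I)) + 1 ∧
      (∀ x, prodExp (Function.update p j r) (fun u => W u x) = prodExp p (fun u => W u x)) ∧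
      (∀ S ⊆ T, condEnt (Function.update p j r) W S = condEnt p W S) ∧
      ∀ l, j ∈ S l → condEnt (Function.update p j r) W (S l) = condEnt p W (S l) := by
  classical
  -- For `i ∈ T` the map `s i` lists all atoms of `p i`; elsewhere it is an irrelevant constant.
  have hs : ∀ i, ∃ s : Fin N → A i, i ∈ T → ∀ a, p i a ≠ 0 → ∃ k, s k = a := by
    intro i
    by_cases hi : i ∈ T
    · obtain ⟨s, hs, -⟩ := exists_fin_law_eq (hp i) (hN i hi)
      exact ⟨s, fun _ => hs⟩
    · obtain ⟨a, -⟩ : ∃ a, p i a ≠ 0 := by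
        by_contra! h
        have := (hp i).2
        simp [h] at this
      exact ⟨fun _ => a, fun h => absurd h hi⟩
  choose s hs using hs
  set φ : A j → ((J → Fin N) × Y) ⊕ (Y ⊕ I) → ℝ := fun a d =>
    prodExp (Function.update p j (Pi.single a 1)) (Sum.elim
      (fun d u => W (T.piecewise (fun i => s i (d.1 i)) u) d.2)
      (Sum.elim (fun x u => W u x)
        (fun l u => ∑ x, Real.negMulLog (resample p (S l) (fun v => W v x) u))) d) with hφ
  obtain ⟨r, hr, hcard, hrφ⟩ := exists_numAtoms_le (hp j) φ
  refine ⟨r, hr, hcard, ?_⟩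
  set p' := Function.update p j r with hp'def
  have hp' : ∀ i, p' i ∈ stdSimplex ℝ (A i) := fun i => by
    by_cases hi : i = j
    · subst hi; simpa [hp'def] using hr
    · simpa [hp'def, hi] using hp i
  have hpp' : ∀ i, i ≠ j → p i = p' i := fun i hi => by simp [hp'def, hi]
  have hlin : ∀ G d, (∀ a, φ a d = prodExp (Function.update p j (Pi.single a 1)) G) →
      prodExp p' G = prodExp p G := by
    intro G d h
    have h1 := hrφ d
    simp only [h] at h1
    rw [← prodExp_update, ← prodExp_update, Function.update_eq_self] at h1
    exact h1
  have hres : ∀ x u, (∀ i ∈ T, p i (u i) ≠ 0) →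
      resample p' T (fun v => W v x) u = resample p T (fun v => W v x) u := by
    intro x u hu
    have hv : ∀ i, ∃ k : Fin N, i ∈ T → s i k = u i := by
      intro i
      by_cases hi : i ∈ T
      · obtain ⟨k, hk⟩ := hs i hi (u i) (hu i hi)
        exact ⟨k, fun _ => hk⟩
      · exact ⟨⟨0, hN0⟩, fun h => absurd h hi⟩
    choose v hv using hv
    rw [resample_congr p' T _ (fun i hi => (hv i hi).symm),
      resample_congr p T _ (fun i hi => (hv i hi).symm)]
    exact hlin _ (Sum.inl (v, x)) fun a => rfl
  refine ⟨fun x => hlin _ (Sum.inr (Sum.inl x)) fun a => rfl, fun S hST => ?_, fun l hl => ?_⟩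
  · have hjS : j ∉ S := fun h => hj (hST h)
    have hne : ∀ i ∈ T, i ≠ j := fun i hi h => hj (h ▸ hi)
    have h1 : ∀ x u, (∀ i, p' i (u i) ≠ 0) →
        resample p' S (fun v => W v x) u = resample p S (fun v => W v x) u := by
      intro x u hu
      rw [← resample_resample_of_subset hp' hST, ← resample_resample_of_subset hp hST]
      calc resample p' S (resample p' T fun v => W v x) u
          = resample p' S (resample p T fun v => W v x) u := by
            refine prodExp_congr_support fun v hv => hres x _ fun i hi => ?_
            rw [hpp' i (hne i hi)]
            by_cases hiS : i ∈ S
            · simpa [hiS] using hu i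
            · simpa [hiS] using hv i
        _ = resample p S (resample p T fun v => W v x) u := by
            refine (prodExp_congr_left hp hp' (S := T) (fun i hi => hpp' i (hne i hi))
              fun v w => ?_).symm
            refine resample_congr p T _ fun i hi => ?_
            by_cases hiS : i ∈ S <;> simp [hiS, hi]
    rw [condEnt, prodExp_congr_support fun u hu => Finset.sum_congr rfl fun x _ => by rw [h1 x u hu]]
    refine (prodExp_congr_left hp hp' (S := S) (fun i hi => hpp' i (hne i (hST hi)))
      fun v w => ?_).symm
    simp only [resample_piecewise]
  -- Once input `j` is given, its law no longer enters the conditional output law, so the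
  -- conditional entropy is linear in that law.
  · have h1 : ∀ x u, resample p' (S l) (fun v => W v x) u = resample p (S l) (fun v => W v x) u :=
      fun x u => resample_congr_left hp' hp
        (fun i hi => (hpp' i (fun h => hi (h ▸ hl))).symm) _ u
    simp only [condEnt, h1]
    exact hlin _ (Sum.inr (Sum.inr l)) fun a => rfl

end Reduce

/-! ### Reducing the number of atoms of all inputs in a given order -/

/-- Induction along the order `π`: the `k`-th input is reduced once the earlier ones are small. The
bound `N` is independent of the alphabet size `n`, the laws, the channel and the order, which is
what compactness needs. -/
theorem exists_bound_numAtoms (Y : Type*) [Fintype Y] (m k : ℕ) :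
    ∃ N, 0 < N ∧ ∀ (n : ℕ) (p : Fin m → Fin n → ℝ), (∀ j, p j ∈ stdSimplex ℝ (Fin n)) →
      ∀ (W : (Fin m → Fin n) → Y → ℝ) (π : Equiv.Perm (Fin m)),
      ∃ p' : Fin m → Fin n → ℝ, (∀ j, p' j ∈ stdSimplex ℝ (Fin n)) ∧
        (∀ j, (π j : ℕ) < k → numAtoms (p' j) ≤ N) ∧
        (∀ x, prodExp p' (fun u => W u x) = prodExp p (fun u => W u x)) ∧
        ∀ l ≤ m, condEnt p' W (initSeg π l) = condEnt p W (initSeg π l) := by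
  induction k with
  | zero => exact ⟨1, one_pos, fun n p hp W π => ⟨p, hp, by simp, fun _ => rfl, fun _ _ => rfl⟩⟩
  | succ k ih =>
    obtain ⟨N, hN0, hN⟩ := ih
    refine ⟨max N (Fintype.card (((Fin m → Fin N) × Y) ⊕ (Y ⊕ Fin (m + 1))) + 1),
      lt_max_of_lt_left hN0, fun n p hp W π => ?_⟩
    obtain ⟨p₁, hp₁, hat, hmarg, hent⟩ := hN n p hp W π
    by_cases hk : k < m
    · obtain ⟨j, hj⟩ : ∃ j, (π j : ℕ) = k := ⟨π.symm ⟨k, hk⟩, by simp⟩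
      have hjn : j ∉ initSeg π k := hj ▸ notMem_initSeg π j
      obtain ⟨r, hr, hcard, hx, hsub, hl⟩ := exists_update_numAtoms_le hp₁ W hjn hN0
        (fun i hi => hat i (mem_initSeg.1 hi)) (fun l : Fin (m + 1) => initSeg π l)
      refine ⟨Function.update p₁ j r, fun i => ?_, fun i hi => ?_, fun x => (hx x).trans (hmarg x),
        fun l hlm => (?_ : _ = _).trans (hent l hlm)⟩
      · by_cases hij : i = j
        · subst hij; simpa using hr
        · simpa [hij] using hp₁ i
      · by_cases hij : i = j
        · subst hij
          rw [Function.update_self]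
          exact hcard.trans (le_max_right _ _)
        · rw [Function.update_of_ne hij]
          refine (hat i ?_).trans (le_max_left _ _)
          have : (π i : ℕ) ≠ k := fun h => hij (π.injective (Fin.ext (h.trans hj.symm)))
          omega
      -- A set of the chain either lies among the inputs already reduced or contains the current
      -- one.
      · by_cases hlk : l ≤ k
        · exact hsub _ (initSeg_mono π hlk)
        · exact hl ⟨l, by omega⟩ (mem_initSeg.2 (by simp only; omega))
    · exact ⟨p₁, hp₁, fun j _ => (hat j (by have := (π j).2; omega)).trans (le_max_left _ _),
        hmarg, hent⟩

/-! ### Single-letter models with a common alphabet -/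

section Model

variable {t h : ℕ} {X : Fin t → Type*} [∀ i, Fintype (X i)]

/-- The product channel with the factors `K i`. -/
def chan {β : Type*} (K : ∀ i, β → X i → ℝ) (u : β) (x : ∀ i, X i) : ℝ := ∏ i, K i u (x i)

/-- The p.m.f.s `p 0` of `U` and `p j.succ` of `U_j` and the kernels `K i` form a model: the
kernel `K i` depends on `U` and `U_{V i}` only. -/
def IsModel (V : Fin t → Finset (Fin h)) {α : Type*} [Fintype α] (p : Fin (h + 1) → α → ℝ)
    (K : ∀ i, (Fin (h + 1) → α) → X i → ℝ) : Prop :=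
  (∀ j, p j ∈ stdSimplex ℝ α) ∧ (∀ i u, K i u ∈ stdSimplex ℝ (X i)) ∧
    ∀ i u v, u 0 = v 0 → (∀ j ∈ V i, u j.succ = v j.succ) → K i u = K i v

/-- The p.m.f. of the outputs of a model. -/
def outPmf {α : Type*} [Fintype α] (p : Fin (h + 1) → α → ℝ)
    (K : ∀ i, (Fin (h + 1) → α) → X i → ℝ) (x : ∀ i, X i) : ℝ :=
  prodExp p (fun u => chan K u x)

/-- The lower bounds for the rates, up to the entropy of the output: minus the conditional entropy
of the outputs given the inputs in `T` if `0 ∈ T`, and zero otherwise. -/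
def rateBound {α : Type*} [Fintype α] (p : Fin (h + 1) → α → ℝ)
    (K : ∀ i, (Fin (h + 1) → α) → X i → ℝ) (T : Finset (Fin (h + 1))) : ℝ :=
  if 0 ∈ T then - condEnt p (chan K) T else 0

/-- The pairs of an output p.m.f. and a rate tuple that satisfies the bounds of some model. -/
def modelRegion (V : Fin t → Finset (Fin h)) (X : Fin t → Type*) [∀ i, Fintype (X i)] :
    Set (((∀ i, X i) → ℝ) × (Fin (h + 1) → ℝ)) :=
  {z | ∃ (N : ℕ) (p : Fin (h + 1) → Fin N → ℝ) (K : ∀ i, (Fin (h + 1) → Fin N) → X i → ℝ),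
    IsModel V p K ∧ z.1 = outPmf p K ∧ ∀ T, rateBound p K T ≤ ∑ j ∈ T, z.2 j}

theorem chan_nonneg {β : Type*} {K : ∀ i, β → X i → ℝ} (hK : ∀ i u, K i u ∈ stdSimplex ℝ (X i))
    (u : β) (x : ∀ i, X i) : 0 ≤ chan K u x := Finset.prod_nonneg fun i _ => (hK i u).1 _

theorem chan_mem_stdSimplex {β : Type*} {K : ∀ i, β → X i → ℝ}
    (hK : ∀ i u, K i u ∈ stdSimplex ℝ (X i)) (u : β) : chan K u ∈ stdSimplex ℝ (∀ i, X i) := by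
  refine ⟨chan_nonneg hK u, ?_⟩
  have h := Finset.prod_univ_sum (fun i => (Finset.univ : Finset (X i))) fun i x => K i u x
  simp only [(hK _ u).2, Finset.prod_const_one, Fintype.piFinset_univ] at h
  exact h.symm

theorem rateBound_empty {α : Type*} [Fintype α] (p : Fin (h + 1) → α → ℝ)
    (K : ∀ i, (Fin (h + 1) → α) → X i → ℝ) : rateBound p K ∅ = 0 := by simp [rateBound]

/-- With `0` in both sets this is submodularity of the conditional entropy. If `0` enters as an
element of `T` only, or as the added element `j`, monotonicity of the conditional entropy suffices,
despite the value zero on sets without `0`. -/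
theorem rateBound_supermodular {V : Fin t → Finset (Fin h)} {α : Type*} [Fintype α]
    {p : Fin (h + 1) → α → ℝ} {K : ∀ i, (Fin (h + 1) → α) → X i → ℝ} (hM : IsModel V p K)
    (S T : Finset (Fin (h + 1))) (hST : S ⊆ T) (j : Fin (h + 1)) (hj : j ∉ T) :
    rateBound p K (insert j S) - rateBound p K S ≤
      rateBound p K (insert j T) - rateBound p K T := by
  have hW := chan_nonneg hM.2.1
  by_cases hS : 0 ∈ S
  · have hT := hST hS
    have := condEnt_submodular hM.1 hW hST hj
    simp only [rateBound, hS, hT, Finset.mem_insert, or_true, if_true]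
    linarith
  · by_cases hT : 0 ∈ T
    · have h0j : (0 : Fin (h + 1)) ≠ j := fun e => hj (e ▸ hT)
      have := condEnt_anti hM.1 hW (Finset.subset_insert j T)
      simp only [rateBound, hS, hT, Finset.mem_insert, or_true, if_true, h0j, or_false, if_false]
      linarith
    · by_cases h0j : (0 : Fin (h + 1)) = j
      · have := condEnt_anti hM.1 hW (Finset.insert_subset_insert j hST)
        simp only [rateBound, Finset.mem_insert, h0j, true_or, if_true]
        rw [if_neg (h0j ▸ hS), if_neg (h0j ▸ hT)]
        linarith
      · simp [rateBound, hS, hT, h0j]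

theorem isModel_map {V : Fin t → Finset (Fin h)} {α β : Type*} [Fintype α] [Fintype β]
    {p : Fin (h + 1) → α → ℝ} {K : ∀ i, (Fin (h + 1) → α) → X i → ℝ}
    (hM : IsModel V p K) {w : Fin (h + 1) → β → ℝ} (hw : ∀ j, w j ∈ stdSimplex ℝ β)
    (s : Fin (h + 1) → β → α) : IsModel V w (fun i u => K i (fun j => s j (u j))) :=
  ⟨hw, fun i u => hM.2.1 i _, fun i u v h0 hV => hM.2.2 i _ _ (by rw [h0])
    fun j hj => by rw [hV j hj]⟩

theorem outPmf_map {α β : Type*} [Fintype α] [DecidableEq α] [Fintype β]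
    {p : Fin (h + 1) → α → ℝ} {w : Fin (h + 1) → β → ℝ} {s : Fin (h + 1) → β → α}
    (hs : ∀ j a, law (w j) (s j) a = p j a) (K : ∀ i, (Fin (h + 1) → α) → X i → ℝ) :
    outPmf w (fun i u => K i (fun j => s j (u j))) = outPmf p K := by
  funext x
  exact prodExp_map p w s hs fun u => chan K u x

theorem condEnt_chan_map {α β : Type*} [Fintype α] [DecidableEq α] [Fintype β]
    {p : Fin (h + 1) → α → ℝ} {w : Fin (h + 1) → β → ℝ} {s : Fin (h + 1) → β → α}
    (hs : ∀ j a, law (w j) (s j) a = p j a) (K : ∀ i, (Fin (h + 1) → α) → X i → ℝ)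
    (T : Finset (Fin (h + 1))) :
    condEnt w (chan (fun i u => K i (fun j => s j (u j)))) T = condEnt p (chan K) T :=
  condEnt_map p w s hs (chan K) T

theorem mem_modelRegion {V : Fin t → Finset (Fin h)} {α : Type*} [Fintype α]
    {p : Fin (h + 1) → α → ℝ} {K : ∀ i, (Fin (h + 1) → α) → X i → ℝ} (hM : IsModel V p K)
    {r : Fin (h + 1) → ℝ} (hr : ∀ T, rateBound p K T ≤ ∑ j ∈ T, r j) :
    (outPmf p K, r) ∈ modelRegion V X := by
  classical
  set e := Fintype.equivFin α
  have hs : ∀ j a, law (fun b => p j (e.symm b)) e.symm a = p j a := by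
    intro j a
    rw [law, ← Equiv.sum_comp e]
    simp
  have hw : ∀ j, (fun b => p j (e.symm b)) ∈ stdSimplex ℝ (Fin (Fintype.card α)) :=
    fun j => ⟨fun b => (hM.1 j).1 _, by rw [Equiv.sum_comp e.symm (p j)]; exact (hM.1 j).2⟩
  refine ⟨_, _, _, isModel_map hM hw (fun _ => e.symm), (outPmf_map hs K).symm, fun T => ?_⟩
  rw [rateBound, condEnt_chan_map hs]
  exact hr T

/-! ### Compactness of the set of greedy vertices -/

/-- The output p.m.f.s and greedy vertices of the models with alphabet `Fin N`. -/
def vertexSet (V : Fin t → Finset (Fin h)) (X : Fin t → Type*) [∀ i, Fintype (X i)] (N : ℕ)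
    (π : Equiv.Perm (Fin (h + 1))) : Set (((∀ i, X i) → ℝ) × (Fin (h + 1) → ℝ)) :=
  (fun y : (Fin (h + 1) → Fin N → ℝ) × (∀ i, (Fin (h + 1) → Fin N) → X i → ℝ) =>
    (outPmf y.1 y.2, greedy (rateBound y.1 y.2) π)) '' {y | IsModel V y.1 y.2}

/-- Models with a fixed alphabet are a closed subset of a product of simplices, and `negMulLog` is
continuous also at zero. -/
theorem isCompact_vertexSet (V : Fin t → Finset (Fin h)) (N : ℕ) (π : Equiv.Perm (Fin (h + 1))) :
    IsCompact (vertexSet V X N π) := by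
  refine IsCompact.image ?_ ?_
  · have h1 : IsCompact ((Set.univ.pi fun _ => stdSimplex ℝ (Fin N)) ×ˢ
        (Set.univ.pi fun i => Set.univ.pi fun _ => stdSimplex ℝ (X i)) :
        Set ((Fin (h + 1) → Fin N → ℝ) × (∀ i, (Fin (h + 1) → Fin N) → X i → ℝ))) :=
      (isCompact_univ_pi fun _ => isCompact_stdSimplex ℝ _).prod
        (isCompact_univ_pi fun i => isCompact_univ_pi fun _ => isCompact_stdSimplex ℝ _)
    refine h1.of_isClosed_subset ?_ fun y hy =>
      ⟨fun j _ => hy.1 j, fun i _ u _ => hy.2.1 i u⟩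
    simp only [IsModel, Set.ofPred_and, Set.ofPred_forall]
    refine IsClosed.inter ?_ (IsClosed.inter ?_ ?_)
    · exact isClosed_iInter fun j => (isClosed_stdSimplex ℝ _).preimage (by fun_prop)
    · exact isClosed_iInter fun i => isClosed_iInter fun u =>
        (isClosed_stdSimplex ℝ _).preimage (by fun_prop)
    · refine isClosed_iInter fun i => isClosed_iInter fun u => isClosed_iInter fun v =>
        isClosed_iInter fun _ => isClosed_iInter fun _ => isClosed_eq (by fun_prop) (by fun_prop)
  · have h2 : ∀ T, Continuous fun y : (Fin (h + 1) → Fin N → ℝ) ×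
        (∀ i, (Fin (h + 1) → Fin N) → X i → ℝ) => rateBound y.1 y.2 T := by
      intro T
      unfold rateBound
      split_ifs
      · have := Real.continuous_negMulLog
        unfold condEnt resample prodExp chan
        fun_prop
      · exact continuous_const
    refine Continuous.prodMk ?_ ?_
    · unfold outPmf prodExp chan
      fun_prop
    · refine continuous_pi fun j => ?_
      unfold greedy
      exact (h2 _).sub (h2 _)

/-- A greedy vertex depends on the initial segments of one order only, so the reduction along that
order preserves it; afterwards the few atoms are relabelled by `Fin N`. -/
theorem exists_forall_mem_vertexSet (V : Fin t → Finset (Fin h)) (X : Fin t → Type*)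
    [∀ i, Fintype (X i)] :
    ∃ N, ∀ (n : ℕ) (p : Fin (h + 1) → Fin n → ℝ) (K : ∀ i, (Fin (h + 1) → Fin n) → X i → ℝ),
      IsModel V p K → ∀ π, (outPmf p K, greedy (rateBound p K) π) ∈ vertexSet V X N π := by
  obtain ⟨N, -, hN⟩ := exists_bound_numAtoms (∀ i, X i) (h + 1) (h + 1)
  refine ⟨N, fun n p K hM π => ?_⟩
  obtain ⟨p', hp', hat, hmarg, hent⟩ := hN n p hM.1 (chan K) π
  choose s _ w hw hs using fun j => exists_fin_law_eq (hp' j) (hat j (π j).2)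
  have hM' : IsModel V p' K := ⟨hp', hM.2⟩
  refine ⟨(w, fun i u => K i (fun j => s j (u j))), isModel_map hM' hw s, ?_⟩
  refine Prod.ext ?_ ?_
  · simp only
    rw [outPmf_map hs]
    exact funext hmarg
  · funext j
    have h3 : ∀ l ≤ h + 1, rateBound w (fun i u => K i (fun j => s j (u j))) (initSeg π l) =
        rateBound p K (initSeg π l) := fun l hl => by
      rw [rateBound, rateBound, condEnt_chan_map hs, hent l hl]
    simp only [greedy]
    rw [h3 _ (by have := (π j).2; omega), h3 _ (by have := (π j).2; omega)]

/-! ### Time sharing -/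

theorem prodExp_mul_prod {J : Type*} [Fintype J] [DecidableEq J] {α β : Type*} [Fintype α]
    [Fintype β] (p : J → α → ℝ) (q : J → β → ℝ) (f : (J → α) → ℝ) (g : (J → β) → ℝ) :
    prodExp (fun j (z : α × β) => p j z.1 * q j z.2)
      (fun u => f (fun j => (u j).1) * g (fun j => (u j).2)) = prodExp p f * prodExp q g := by
  rw [prodExp, prodExp, prodExp, Finset.sum_mul_sum, ← Fintype.sum_prod_type',
    ← (Equiv.arrowProdEquivProdArrow J (fun _ => α) (fun _ => β)).sum_comp]
  refine Finset.sum_congr rfl fun u _ => ?_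
  simp only [Finset.prod_mul_distrib, Equiv.arrowProdEquivProdArrow, Equiv.coe_fn_mk]
  ring

/-- Time sharing with the switching bit stored in `U`, which every processor observes and every
nontrivial bound conditions on. Output law and bounds then mix linearly. -/
theorem convex_modelRegion (V : Fin t → Finset (Fin h)) : Convex ℝ (modelRegion V X) := by
  rintro ⟨q₁, r₁⟩ ⟨n₁, p₁, K₁, hM₁, hq₁, hr₁⟩ ⟨q₂, r₂⟩ ⟨n₂, p₂, K₂, hM₂, hq₂, hr₂⟩ a b ha hb hab
  simp only at hq₁ hq₂ hr₁ hr₂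
  set c : Bool → ℝ := fun β => if β then a else b with hc
  have hcs : c ∈ stdSimplex ℝ Bool := ⟨fun β => by cases β <;> simp [hc, ha, hb], by simp [hc, hab]⟩
  set s : Fin (h + 1) → Fin n₁ × Fin n₂ → ℝ := fun j z => p₁ j z.1 * p₂ j z.2 with hs
  -- All inputs receive a bit to keep the alphabet common; only the bit of input `0` is ever read.
  set p : Fin (h + 1) → Bool × (Fin n₁ × Fin n₂) → ℝ := fun j z => c z.1 * s j z.2 with hp
  set K : ∀ i, (Fin (h + 1) → Bool × (Fin n₁ × Fin n₂)) → X i → ℝ := fun i u =>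
    if (u 0).1 then K₁ i (fun j => (u j).2.1) else K₂ i (fun j => (u j).2.2) with hK
  have hmul : ∀ {α β : Type} [Fintype α] [Fintype β] (p : α → ℝ) (q : β → ℝ),
      p ∈ stdSimplex ℝ α → q ∈ stdSimplex ℝ β →
      (fun z : α × β => p z.1 * q z.2) ∈ stdSimplex ℝ (α × β) := by
    intro α β _ _ p q hp hq
    refine ⟨fun z => mul_nonneg (hp.1 _) (hq.1 _), ?_⟩
    rw [Fintype.sum_prod_type]
    simp only [← Finset.mul_sum, hq.2, mul_one, hp.2]
  have hss : ∀ j, s j ∈ stdSimplex ℝ (Fin n₁ × Fin n₂) := fun j => hmul _ _ (hM₁.1 j) (hM₂.1 j)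
  have hps : ∀ j, p j ∈ stdSimplex ℝ (Bool × (Fin n₁ × Fin n₂)) := fun j => hmul _ _ hcs (hss j)
  have hlaw₁ : ∀ j a, law (p j) (fun z => z.2.1) a = p₁ j a := by
    intro j a
    simp only [law, hp, hs, Fintype.sum_prod_type]
    rw [Finset.sum_comm, Finset.sum_eq_single a (fun a' _ ha' => by simp [ha']) (by simp)]
    simp only [if_true, ← Finset.mul_sum, (hM₂.1 j).2, mul_one, ← Finset.sum_mul, hcs.2, one_mul]
  have hlaw₂ : ∀ j a, law (p j) (fun z => z.2.2) a = p₂ j a := by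
    intro j a
    simp only [law, hp, hs, Fintype.sum_prod_type]
    simp only [Finset.sum_ite_eq', Finset.mem_univ, if_true]
    simp only [← Finset.mul_sum, ← Finset.sum_mul, (hM₁.1 j).2, hcs.2, one_mul]
  have hmix : ∀ (f : (Fin (h + 1) → Fin n₁) → ℝ) (g : (Fin (h + 1) → Fin n₂) → ℝ),
      prodExp p (fun u => if (u 0).1 then f (fun j => (u j).2.1) else g (fun j => (u j).2.2)) =
        a * prodExp p₁ f + b * prodExp p₂ g := by
    intro f g
    have e : ∀ u : Fin (h + 1) → Bool × (Fin n₁ × Fin n₂),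
        (if (u 0).1 then f (fun j => (u j).2.1) else g (fun j => (u j).2.2)) =
        (if (u 0).1 then 1 else 0) * (f (fun j => (u j).2.1) * 1) +
        (if (u 0).1 then 0 else 1) * (1 * g (fun j => (u j).2.2)) := fun u => by
      split_ifs <;> simp
    simp only [e, prodExp_add]
    rw [prodExp_mul_prod (fun _ => c) s (fun β => if β 0 then 1 else 0)
        (fun v => f (fun j => (v j).1) * 1),
      prodExp_mul_prod (fun _ => c) s (fun β => if β 0 then 0 else 1)
        (fun v => 1 * g (fun j => (v j).2)),
      prodExp_mul_prod p₁ p₂ f (fun _ => 1), prodExp_mul_prod p₁ p₂ (fun _ => 1) g,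
      prodExp_const hM₁.1, prodExp_const hM₂.1,
      prodExp_coord (fun _ => hcs) 0 (fun β => if β then 1 else 0),
      prodExp_coord (fun _ => hcs) 0 (fun β => if β then 0 else 1)]
    simp [hc]
  have hchan : ∀ u, chan K u = if (u 0).1 then chan K₁ (fun j => (u j).2.1) else
      chan K₂ (fun j => (u j).2.2) := by
    intro u
    funext x
    by_cases hu : (u 0).1 <;> simp [chan, hK, hu]
  have hM : IsModel V p K := by
    refine ⟨hps, fun i u => ?_, fun i u v h0 hV => ?_⟩
    · simp only [hK]
      split_ifs
      exacts [hM₁.2.1 i _, hM₂.2.1 i _]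
    · simp only [hK, h0]
      rw [hM₁.2.2 i (fun j => (u j).2.1) (fun j => (v j).2.1) (by rw [h0])
        (fun j hj => by rw [hV j hj]), hM₂.2.2 i (fun j => (u j).2.2) (fun j => (v j).2.2)
        (by rw [h0]) (fun j hj => by rw [hV j hj])]
  have hout : outPmf p K = a • q₁ + b • q₂ := by
    funext x
    simp only [outPmf, hchan, ite_apply]
    rw [hmix (fun u => chan K₁ u x) (fun u => chan K₂ u x), hq₁, hq₂]
    rfl
  have hent : ∀ T, 0 ∈ T → condEnt p (chan K) T =
      a * condEnt p₁ (chan K₁) T + b * condEnt p₂ (chan K₂) T := by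
    intro T hT
    have hres : ∀ u x, resample p T (fun v => chan K v x) u = if (u 0).1 then
        resample p₁ T (fun v => chan K₁ v x) (fun j => (u j).2.1) else
        resample p₂ T (fun v => chan K₂ v x) (fun j => (u j).2.2) := by
      intro u x
      rw [← resample_map p₁ p (fun _ z => z.2.1) hlaw₁ T,
        ← resample_map p₂ p (fun _ z => z.2.2) hlaw₂ T]
      by_cases hu : (u 0).1 <;> simp only [hu, resample, hchan, Finset.piecewise_eq_of_mem _ _ _ hT] <;>
        simp
    rw [condEnt, condEnt, condEnt, ← hmix]
    congr 1
    funext u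
    simp only [hres]
    split_ifs <;> rfl
  have hmem := mem_modelRegion hM (r := a • r₁ + b • r₂) fun T => ?_
  · rw [hout] at hmem
    exact hmem
  · have e : ∑ j ∈ T, (a • r₁ + b • r₂) j = a * ∑ j ∈ T, r₁ j + b * ∑ j ∈ T, r₂ j := by
      simp [Finset.sum_add_distrib, Finset.mul_sum]
    rw [e]
    have h1 := mul_le_mul_of_nonneg_left (hr₁ T) ha
    have h2 := mul_le_mul_of_nonneg_left (hr₂ T) hb
    by_cases hT : 0 ∈ T
    · simp only [rateBound, hT, if_true, hent T hT] at h1 h2 ⊢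
      linarith
    · simp only [rateBound, hT, if_false] at h1 h2 ⊢
      linarith

/-! ### The region is closed -/

/-- The region equals a compact convex hull of vertices plus a closed orthant in the rate
coordinates. One inclusion decomposes a tuple into vertices of its own model; the other uses
supermodularity, for the vertices to be admissible, and convexity. -/
theorem isClosed_modelRegion (V : Fin t → Finset (Fin h)) : IsClosed (modelRegion V X) := by
  obtain ⟨N, hN⟩ := exists_forall_mem_vertexSet V X
  have h : modelRegion V X = convexHull ℝ (⋃ π, vertexSet V X N π) +
      ({0} ×ˢ Set.Ici 0 : Set (((∀ i, X i) → ℝ) × (Fin (h + 1) → ℝ))) := by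
    apply Set.Subset.antisymm
    · rintro ⟨q, r⟩ ⟨n, p, K, hM, hq, hr⟩
      simp only at hq hr
      obtain ⟨v, hv, hvr⟩ := mem_convexHull_greedy_add (rateBound_empty p K) hr
      refine ⟨(q, v), ?_, (0, r - v), ⟨rfl, sub_nonneg.2 hvr⟩, by simp⟩
      have h1 : (q, v) ∈ convexHull ℝ (({q} : Set ((∀ i, X i) → ℝ)) ×ˢ
          Set.range (greedy (rateBound p K))) := by
        rw [convexHull_prod]
        exact ⟨subset_convexHull ℝ _ rfl, hv⟩
      refine convexHull_mono ?_ h1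
      rintro ⟨_, _⟩ ⟨rfl, π, rfl⟩
      refine Set.mem_iUnion.2 ⟨π, ?_⟩
      have := hN n p K hM π
      rwa [← hq] at this
    · rintro _ ⟨z, hz, ⟨z₁, w⟩, ⟨rfl, hw⟩, rfl⟩
      have hsub : (⋃ π, vertexSet V X N π) ⊆ modelRegion V X := by
        refine Set.iUnion_subset fun π => ?_
        rintro _ ⟨⟨p, K⟩, hM, rfl⟩
        exact ⟨N, p, K, hM, rfl, le_sum_greedy (rateBound_empty p K) (rateBound_supermodular hM) π⟩
      obtain ⟨n, p, K, hM, hq, hr⟩ := convexHull_min hsub (convex_modelRegion V) hz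
      refine ⟨n, p, K, hM, by simpa using hq, fun T => (hr T).trans ?_⟩
      exact Finset.sum_le_sum fun j _ => le_add_of_nonneg_right (hw j)
  rw [h]
  refine IsClosed.add_left_of_isCompact ?_ (isCompact_convexHull_of_finiteDimensional
    (isCompact_iUnion fun π => isCompact_vertexSet V N π))
  exact isClosed_singleton.prod isClosed_Ici

end Model

/-! ### Mutual information of superposition models -/

theorem mutualInfo_eq_sum {Ω A B : Type*} [Fintype Ω] [Fintype A] [Fintype B] [DecidableEq A]
    [DecidableEq B] (P : Ω → ℝ) (f : Ω → A) (g : Ω → B) :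
    mutualInfo P f g = ∑ ω, P ω * Real.logb 2 (law P (fun ω => (f ω, g ω)) (f ω, g ω) /
      (law P f (f ω) * law P g (g ω))) := by
  rw [← sum_law_mul P (fun ω => (f ω, g ω)) fun z => Real.logb 2
    (law P (fun ω => (f ω, g ω)) z / (law P f z.1 * law P g z.2)), Fintype.sum_prod_type]
  rfl

theorem law_eq_sum_mul {Ω A : Type*} [Fintype Ω] [DecidableEq A] (P : Ω → ℝ) (f : Ω → A) (a : A) :
    law P f a = ∑ ω, P ω * if f ω = a then 1 else 0 := by
  simp [law]

/-- The entropy in nats. -/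
def ent {Y : Type*} [Fintype Y] (q : Y → ℝ) : ℝ := ∑ y, Real.negMulLog (q y)

section Aux

variable {J : Type*} [Fintype J] [DecidableEq J] {A₀ : Type*} [Fintype A₀] {A : J → Type*}
  [∀ j, Fintype (A j)] {Y : Type*} [Fintype Y]

/-- The joint p.m.f. of independent `U`, `U_j` and the output of the channel `W`. -/
def auxPmf (pU : A₀ → ℝ) (pUs : ∀ j, A j → ℝ) (W : A₀ → (∀ j, A j) → Y → ℝ)
    (ω : A₀ × (∀ j, A j) × Y) : ℝ :=
  pU ω.1 * (∏ j, pUs j (ω.2.1 j)) * W ω.1 ω.2.1 ω.2.2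

variable {pU : A₀ → ℝ} {pUs : ∀ j, A j → ℝ} {W : A₀ → (∀ j, A j) → Y → ℝ} {q : Y → ℝ}

theorem sum_auxPmf_mul (pU : A₀ → ℝ) (pUs : ∀ j, A j → ℝ) (W : A₀ → (∀ j, A j) → Y → ℝ)
    (F : A₀ × (∀ j, A j) × Y → ℝ) :
    ∑ ω, auxPmf pU pUs W ω * F ω =
      ∑ u, pU u * prodExp pUs (fun us => ∑ x, W u us x * F (u, us, x)) := by
  simp only [Fintype.sum_prod_type, auxPmf, prodExp, Finset.mul_sum, mul_assoc]

theorem auxPmf_mem_stdSimplex (hU : pU ∈ stdSimplex ℝ A₀) (hUs : ∀ j, pUs j ∈ stdSimplex ℝ (A j))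
    (hW : ∀ u us, W u us ∈ stdSimplex ℝ Y) :
    auxPmf pU pUs W ∈ stdSimplex ℝ (A₀ × (∀ j, A j) × Y) := by
  refine ⟨fun ω => mul_nonneg (mul_nonneg (hU.1 _) (prodExp_weight_nonneg hUs _)) ((hW _ _).1 _), ?_⟩
  have h := sum_auxPmf_mul pU pUs W fun _ => 1
  simp only [mul_one, (hW _ _).2, prodExp_const hUs, hU.2] at h
  exact h

theorem law_auxPmf_output [DecidableEq Y] (x₀ : Y) :
    law (auxPmf pU pUs W) (fun ω => ω.2.2) x₀ = ∑ u, pU u * prodExp pUs (fun us => W u us x₀) := by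
  rw [law_eq_sum_mul, sum_auxPmf_mul]
  simp

variable [DecidableEq A₀] [∀ j, DecidableEq (A j)]

theorem law_auxPmf_joint [DecidableEq Y] (hUs : ∀ j, pUs j ∈ stdSimplex ℝ (A j)) (S : Finset J)
    (x₀ : Y) (u₀ : A₀) (us₀ : ∀ j, A j) :
    law (auxPmf pU pUs W) (fun ω => (ω.2.2, (ω.1, S.restrict ω.2.1)))
      (x₀, (u₀, S.restrict us₀)) =
        (pU u₀ * ∏ j ∈ S, pUs j (us₀ j)) * resample pUs S (fun us => W u₀ us x₀) us₀ := by
  have e : ∀ (x : Y) (u : A₀) (us : ∀ j, A j),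
      (if (x, (u, S.restrict us)) = (x₀, (u₀, S.restrict us₀)) then (1 : ℝ) else 0) =
      (if u = u₀ then 1 else 0) * ((if x = x₀ then 1 else 0) *
        if ∀ j ∈ S, us j = us₀ j then 1 else 0) := fun x u us => by
    have : S.restrict us = S.restrict us₀ ↔ ∀ j ∈ S, us j = us₀ j := by
      simp [funext_iff]
    simp only [Prod.mk.injEq, this]
    by_cases h1 : x = x₀ <;> by_cases h2 : u = u₀ <;> simp [h1, h2]
  rw [law_eq_sum_mul, sum_auxPmf_mul]
  simp only [e]
  rw [Finset.sum_eq_single u₀ (fun u _ hu => by simp [hu, prodExp]) (by simp), mul_assoc,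
    ← prodExp_agree hUs]
  congr 2
  funext us
  rw [Finset.sum_eq_single x₀ (fun x _ hx => by simp [hx]) (by simp)]
  simp

theorem law_auxPmf_input (hUs : ∀ j, pUs j ∈ stdSimplex ℝ (A j))
    (hW : ∀ u us, W u us ∈ stdSimplex ℝ Y) (S : Finset J) (u₀ : A₀) (us₀ : ∀ j, A j) :
    law (auxPmf pU pUs W) (fun ω => (ω.1, S.restrict ω.2.1)) (u₀, S.restrict us₀) =
      pU u₀ * ∏ j ∈ S, pUs j (us₀ j) := by
  classical
  have h1 := fun x => law_auxPmf_joint (pU := pU) (W := W) hUs S x u₀ us₀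
  have h2 : law (auxPmf pU pUs W) (fun ω => (ω.1, S.restrict ω.2.1)) (u₀, S.restrict us₀) =
      ∑ x, law (auxPmf pU pUs W) (fun ω => (ω.2.2, (ω.1, S.restrict ω.2.1)))
      (x, (u₀, S.restrict us₀)) := by
    simp only [law]
    rw [Finset.sum_comm]
    refine Finset.sum_congr rfl fun ω _ => ?_
    rw [Finset.sum_eq_single ω.2.2 (fun x _ hx => by simp [hx.symm]) (by simp)]
    simp
  rw [h2]
  simp only [h1, ← Finset.mul_sum, resample, ← prodExp_sum]
  simp [(hW _ _).2, prodExp_const hUs]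

/-- The probability of the conditioning event cancels in the density ratio wherever the joint p.m.f.
is nonzero. -/
theorem mutualInfo_auxPmf [DecidableEq Y] (hUs : ∀ j, pUs j ∈ stdSimplex ℝ (A j))
    (hW : ∀ u us, W u us ∈ stdSimplex ℝ Y)
    (hq : law (auxPmf pU pUs W) (fun ω => ω.2.2) = q) (S : Finset J) :
    mutualInfo (auxPmf pU pUs W) (fun ω => ω.2.2) (fun ω => (ω.1, S.restrict ω.2.1)) =
      ∑ ω, auxPmf pU pUs W ω *
        Real.logb 2 (resample pUs S (fun us => W ω.1 us ω.2.2) ω.2.1 / q ω.2.2) := by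
  rw [mutualInfo_eq_sum]
  refine Finset.sum_congr rfl fun ω _ => ?_
  rcases eq_or_ne (auxPmf pU pUs W ω) 0 with h | h
  · rw [h, zero_mul, zero_mul]
  obtain ⟨u, us, x⟩ := ω
  have hc : pU u * ∏ j ∈ S, pUs j (us j) ≠ 0 := by
    refine mul_ne_zero (fun h0 => h (by simp [auxPmf, h0])) ?_
    refine Finset.prod_ne_zero_iff.2 fun j _ h0 => h ?_
    simp only [auxPmf]
    rw [Finset.prod_eq_zero (Finset.mem_univ j) h0, mul_zero, zero_mul]
  simp only
  rw [law_auxPmf_joint hUs, law_auxPmf_input hUs hW, hq, mul_comm (q x), mul_div_mul_left _ _ hc]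

theorem auxPmf_pos_iff (hU : pU ∈ stdSimplex ℝ A₀) (hUs : ∀ j, pUs j ∈ stdSimplex ℝ (A j))
    (hW : ∀ u us, W u us ∈ stdSimplex ℝ Y) [DecidableEq Y]
    (hq : law (auxPmf pU pUs W) (fun ω => ω.2.2) = q) (S : Finset J) {u : A₀} {us : ∀ j, A j}
    {x : Y} (h : 0 < auxPmf pU pUs W (u, us, x)) :
    0 < resample pUs S (fun us => W u us x) us ∧ 0 < q x := by
  constructor
  · refine lt_of_lt_of_le ?_ (weight_mul_le_resample hUs S (fun us => (hW u us).1 x) us)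
    simp only [auxPmf, mul_assoc] at h
    exact pos_of_mul_pos_right h (hU.1 u)
  · rw [← hq, law]
    refine lt_of_lt_of_le ?_ (Finset.single_le_sum (fun ω _ => ?_) (Finset.mem_univ (u, us, x)))
    · simpa using h
    · split_ifs
      exacts [(auxPmf_mem_stdSimplex hU hUs hW).1 ω, le_rfl]

theorem mutualInfo_auxPmf_eq_ent_sub [DecidableEq Y] (hU : pU ∈ stdSimplex ℝ A₀)
    (hUs : ∀ j, pUs j ∈ stdSimplex ℝ (A j)) (hW : ∀ u us, W u us ∈ stdSimplex ℝ Y)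
    (hq : law (auxPmf pU pUs W) (fun ω => ω.2.2) = q) (S : Finset J) :
    mutualInfo (auxPmf pU pUs W) (fun ω => ω.2.2) (fun ω => (ω.1, S.restrict ω.2.1)) * Real.log 2 =
      ent q - ∑ u, pU u * condEnt pUs (W u) S := by
  have h1 : mutualInfo (auxPmf pU pUs W) (fun ω => ω.2.2) (fun ω => (ω.1, S.restrict ω.2.1)) *
      Real.log 2 = ∑ ω, auxPmf pU pUs W ω * -Real.log (q ω.2.2) - ∑ ω, auxPmf pU pUs W ω *
        -Real.log (resample pUs S (fun us => W ω.1 us ω.2.2) ω.2.1) := by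
    rw [mutualInfo_auxPmf hUs hW hq, Finset.sum_mul, ← Finset.sum_sub_distrib]
    refine Finset.sum_congr rfl fun ω _ => ?_
    rcases ((auxPmf_mem_stdSimplex hU hUs hW).1 ω).eq_or_lt with h | h
    · rw [← h]; simp
    · obtain ⟨h2, h3⟩ := auxPmf_pos_iff hU hUs hW hq S h
      rw [Real.logb, Real.log_div h2.ne' h3.ne']
      have : Real.log 2 ≠ 0 := (Real.log_pos one_lt_two).ne'
      field_simp
      ring
  rw [h1]
  congr 1
  · rw [← sum_law_mul _ (fun ω : A₀ × (∀ j, A j) × Y => ω.2.2) fun x => -Real.log (q x), hq]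
    simp [ent, Real.negMulLog]
  · rw [sum_auxPmf_mul]
    refine Finset.sum_congr rfl fun u _ => ?_
    rw [condEnt, prodExp_sum, prodExp_sum]
    congr 1
    refine Finset.sum_congr rfl fun x _ => ?_
    exact (prodExp_negMulLog_resample hUs S fun us => W u us x).symm

end Aux

/-! ### From models with a common alphabet to the single-letter region -/

section Cons

variable {h : ℕ} {α : Type*} [Fintype α]

theorem prodExp_succ (p : Fin (h + 1) → α → ℝ) (G : (Fin (h + 1) → α) → ℝ) :
    prodExp p G = ∑ u, p 0 u * prodExp (fun j => p j.succ) (fun us => G (Fin.cons u us)) := by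
  rw [prodExp, ← (Fin.consEquiv fun _ => α).sum_comp, Fintype.sum_prod_type]
  simp only [prodExp, Finset.mul_sum, Fin.prod_univ_succ, Fin.consEquiv, Equiv.coe_fn_mk,
    Fin.cons_zero, Fin.cons_succ, mul_assoc]

theorem resample_cons {p : Fin (h + 1) → α → ℝ} (hp : p 0 ∈ stdSimplex ℝ α)
    {T : Finset (Fin (h + 1))} (hT : 0 ∈ T) {S : Finset (Fin h)} (hS : ∀ j, j.succ ∈ T ↔ j ∈ S)
    (G : (Fin (h + 1) → α) → ℝ) (u : α) (us : Fin h → α) :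
    resample p T G (Fin.cons u us) =
      resample (fun j => p j.succ) S (fun us => G (Fin.cons u us)) us := by
  have h1 : ∀ v vs, T.piecewise (Fin.cons u us : Fin (h + 1) → α) (Fin.cons v vs) =
      (Fin.cons u (S.piecewise us vs) : Fin (h + 1) → α) := by
    intro v vs
    funext j
    refine Fin.cases ?_ (fun j => ?_) j
    · simp [hT]
    · by_cases hj : j ∈ S
      · simp [(hS j).2 hj, hj]
      · simp [mt (hS j).1 hj, hj]
  rw [resample, prodExp_succ]
  simp only [h1, ← Finset.sum_mul, hp.2, one_mul, resample]

theorem condEnt_cons {Y : Type*} [Fintype Y] {p : Fin (h + 1) → α → ℝ} (hp : p 0 ∈ stdSimplex ℝ α)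
    {T : Finset (Fin (h + 1))} (hT : 0 ∈ T) {S : Finset (Fin h)} (hS : ∀ j, j.succ ∈ T ↔ j ∈ S)
    (W : (Fin (h + 1) → α) → Y → ℝ) :
    condEnt p W T = ∑ u, p 0 u * condEnt (fun j => p j.succ) (fun us => W (Fin.cons u us)) S := by
  rw [condEnt, prodExp_succ]
  simp only [resample_cons hp hT hS, condEnt]

end Cons

section

variable {t h : ℕ} {V : Fin t → Finset (Fin h)} {X : Fin t → Type*} [∀ i, Fintype (X i)]
  [∀ i, DecidableEq (X i)]

/-- The first rate coordinate carries `-H(q)` in nats, so the bound for `{0} ∪ S` is `R + R_S ≥ H(X)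
- H(X | U, U_S)` after division by `log 2`. -/
theorem mem_singleLetterRegion_of_mem_modelRegion {q : (∀ i, X i) → ℝ} {R : ℝ} {Rs : Fin h → ℝ}
    (hR : 0 ≤ R) (hRs : ∀ j, 0 ≤ Rs j)
    (hmem : (q, (Fin.cons (R * Real.log 2 - ent q) fun j => Rs j * Real.log 2 :
      Fin (h + 1) → ℝ)) ∈ modelRegion V X) : (R, Rs) ∈ singleLetterRegion V q := by
  obtain ⟨N, p, K, hM, hq, hr⟩ := hmem
  simp only at hq hr
  have hN : 0 < N := by
    rcases Nat.eq_zero_or_pos N with rfl | h0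
    · have := (hM.1 0).2
      simp at this
    · exact h0
  set W : Fin N → (Fin h → Fin N) → (∀ i, X i) → ℝ := fun u us => chan K (Fin.cons u us) with hWdef
  have hW : ∀ u us, W u us ∈ stdSimplex ℝ (∀ i, X i) := fun u us => chan_mem_stdSimplex hM.2.1 _
  have hlaw : law (auxPmf (p 0) (fun j => p j.succ) W) (fun ω => ω.2.2) = q := by
    funext x
    rw [law_auxPmf_output, hq, outPmf, prodExp_succ]
  refine ⟨hR, hRs, N, fun _ => N, auxPmf (p 0) (fun j => p j.succ) W,
    ⟨auxPmf_mem_stdSimplex (hM.1 0) (fun j => hM.1 j.succ) hW, hlaw, p 0, fun j => p j.succ,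
      -- Inputs outside `V i` are set to a dummy letter, which the kernel ignores.
      fun i u v => K i (Fin.cons u fun j => if hj : j ∈ V i then v ⟨j, hj⟩ else ⟨0, hN⟩),
      hM.1 0, fun j => hM.1 j.succ, fun i u v => hM.2.1 _ _, fun u us x => ?_⟩, fun S => ?_⟩
  · simp only [auxPmf, hWdef, chan]
    congr 1
    refine Finset.prod_congr rfl fun i _ => ?_
    rw [hM.2.2 i (Fin.cons u us) (Fin.cons u fun j => if j ∈ V i then us j else ⟨0, hN⟩) rfl
      fun j hj => by simp [hj]]
    simp
  · have hT0 : (0 : Fin (h + 1)) ∈ insert 0 (S.map (Fin.succEmb h)) := Finset.mem_insert_self _ _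
    have hTS : ∀ j : Fin h, j.succ ∈ insert 0 (S.map (Fin.succEmb h)) ↔ j ∈ S := fun j => by
      simp [Fin.succ_ne_zero]
    have h1 := hr (insert 0 (S.map (Fin.succEmb h)))
    rw [rateBound, if_pos hT0, condEnt_cons (hM.1 0) hT0 hTS,
      Finset.sum_insert (by simp [Fin.succ_ne_zero]), Finset.sum_map] at h1
    simp only [Fin.cons_zero, Fin.coe_succEmb, Fin.cons_succ, ← Finset.sum_mul] at h1
    have h2 := mutualInfo_auxPmf_eq_ent_sub (hM.1 0) (fun j => hM.1 j.succ) hW hlaw S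
    have h3 : 0 < Real.log 2 := Real.log_pos one_lt_two
    refine le_of_mul_le_mul_right ?_ h3
    rw [h2, add_mul]
    simp only [hWdef]
    linarith

end

/-! ### Continuity and subadditivity of the entropy -/

/-- For `a ≤ b` monotonicity of the logarithm gives subadditivity, without the linear term; for `b ≤
a` the bound `b * log (a / b) ≤ a - b` produces it. -/
theorem negMulLog_sub_le {a b : ℝ} (ha : 0 ≤ a) (ha1 : a ≤ 1) (hb : 0 ≤ b) (hb1 : b ≤ 1) :
    Real.negMulLog b - Real.negMulLog a ≤ Real.negMulLog |a - b| + |a - b| := by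
  rcases le_total a b with hab | hab
  · rw [abs_sub_comm, abs_of_nonneg (sub_nonneg.2 hab)]
    obtain ⟨d, rfl⟩ : ∃ d, b = a + d := ⟨b - a, by ring⟩
    have hd : 0 ≤ d := by linarith
    rw [add_sub_cancel_left]
    rcases ha.eq_or_lt with rfl | ha
    · simp [hd]
    rcases hd.eq_or_lt with rfl | hd'
    · simp
    have h1 : Real.log a ≤ Real.log (a + d) := Real.log_le_log ha (by linarith)
    have h2 : Real.log d ≤ Real.log (a + d) := Real.log_le_log hd' (by linarith)
    simp only [Real.negMulLog]
    nlinarith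
  · rw [abs_of_nonneg (sub_nonneg.2 hab)]
    obtain ⟨d, rfl⟩ : ∃ d, a = b + d := ⟨a - b, by ring⟩
    have hd : 0 ≤ d := by linarith
    rw [add_sub_cancel_left]
    have h0 : 0 ≤ Real.negMulLog d := Real.negMulLog_nonneg hd (by linarith)
    have h1 : Real.log (b + d) ≤ 0 := Real.log_nonpos ha ha1
    rcases hb.eq_or_lt with rfl | hb
    · rw [zero_add, Real.negMulLog_zero]
      linarith
    have h2 := Real.log_le_sub_one_of_pos (show 0 < (b + d) / b by positivity)
    rw [Real.log_div (by positivity) hb.ne'] at h2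
    have h3 := mul_le_mul_of_nonneg_left h2 hb.le
    have h4 : b * ((b + d) / b - 1) = d := by field_simp; ring
    simp only [Real.negMulLog] at h0 ⊢
    nlinarith

theorem sum_negMulLog_le {Y : Type*} [Fintype Y] {d : Y → ℝ} (hd : ∀ y, 0 ≤ d y) :
    ∑ y, Real.negMulLog (d y) ≤
      Real.negMulLog (∑ y, d y) + (∑ y, d y) * Real.log (Fintype.card Y) := by
  set D := ∑ y, d y with hD
  have hD0 : 0 ≤ D := Finset.sum_nonneg fun y _ => hd y
  rcases hD0.eq_or_lt with h0 | h0
  · have : ∀ y, d y = 0 := fun y =>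
      (Finset.sum_eq_zero_iff_of_nonneg fun y _ => hd y).1 h0.symm y (Finset.mem_univ y)
    simp [this, ← h0]
  have hne : Nonempty Y := by
    by_contra hne
    rw [not_nonempty_iff] at hne
    simp [hD] at h0
  have hN : (0 : ℝ) < Fintype.card Y := by exact_mod_cast Fintype.card_pos
  have h1 : ∀ y, Real.negMulLog (d y) ≤
      d y * (Real.log (Fintype.card Y) - Real.log D) + (D / Fintype.card Y - d y) := by
    intro y
    rcases (hd y).eq_or_lt with h | h
    · rw [← h]
      simp only [Real.negMulLog_zero, zero_mul, sub_zero, zero_add]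
      positivity
    have h2 := Real.log_le_sub_one_of_pos (show 0 < D / Fintype.card Y / d y by positivity)
    rw [Real.log_div (by positivity) h.ne', Real.log_div h0.ne' hN.ne'] at h2
    have h3 := mul_le_mul_of_nonneg_left h2 h.le
    rw [mul_sub (d y) _ 1, mul_div_cancel₀ _ h.ne'] at h3
    simp only [Real.negMulLog]
    linarith
  refine (Finset.sum_le_sum fun y _ => h1 y).trans (le_of_eq ?_)
  rw [Finset.sum_add_distrib, Finset.sum_sub_distrib, ← Finset.sum_mul, ← hD, Finset.sum_const,
    Finset.card_univ, nsmul_eq_mul, mul_div_cancel₀ _ hN.ne', Real.negMulLog]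
  ring

/-- One-sided continuity of the entropy, with a modulus linear in `log |Y|`. On sequences this is of
order `n` times the variation distance, hence negligible after division by `n`. -/
theorem ent_sub_ent_le {Y : Type*} [Fintype Y] {p q : Y → ℝ} (hp : p ∈ stdSimplex ℝ Y)
    (hq : q ∈ stdSimplex ℝ Y) :
    ent q - ent p ≤ Real.negMulLog (∑ y, |p y - q y|) +
      (∑ y, |p y - q y|) * Real.log (Fintype.card Y) + ∑ y, |p y - q y| := by
  have hle : ∀ {r : Y → ℝ}, r ∈ stdSimplex ℝ Y → ∀ y, r y ≤ 1 := fun hr y => by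
    rw [← hr.2]
    exact Finset.single_le_sum (fun y _ => hr.1 y) (Finset.mem_univ y)
  refine le_trans ?_ (add_le_add_left (sum_negMulLog_le fun y => abs_nonneg (p y - q y)) _)
  rw [ent, ent, ← Finset.sum_sub_distrib, ← Finset.sum_add_distrib]
  exact Finset.sum_le_sum fun y _ =>
    negMulLog_sub_le (hp.1 y) (hle hp y) (hq.1 y) (hle hq y)

/-- The `k`-th letters of a family of sequences. -/
def letter {I : Type*} {X : I → Type*} {n : ℕ} (k : Fin n) (x : ∀ i, Fin n → X i) (i : I) : X i :=
  x i k

theorem sum_prod_letter {I : Type*} [Fintype I] [DecidableEq I] {X : I → Type*}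
    [∀ i, Fintype (X i)] {n : ℕ} (f : Fin n → (∀ i, X i) → ℝ) :
    ∑ x : (∀ i, Fin n → X i), ∏ k, f k (letter k x) = ∏ k, ∑ z, f k z := by
  rw [Finset.prod_univ_sum, Fintype.piFinset_univ]
  exact Equiv.sum_comp (Equiv.piComm fun (i : I) (_ : Fin n) => X i)
    (fun y => ∏ k, f k (y k))

section Sequence

variable {t : ℕ} {X : Fin t → Type*} [∀ i, Fintype (X i)] {n : ℕ}

theorem iidPmf_mem_stdSimplex {q : (∀ i, X i) → ℝ} (hq : q ∈ stdSimplex ℝ (∀ i, X i)) :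
    iidPmf q n ∈ stdSimplex ℝ (∀ i, Fin n → X i) := by
  refine ⟨fun x => Finset.prod_nonneg fun k _ => hq.1 _, ?_⟩
  have h := sum_prod_letter (n := n) fun _ => q
  simp only [hq.2, Finset.prod_const_one] at h
  exact h

theorem sum_iidPmf_mul_letter {q : (∀ i, X i) → ℝ} (hq : q ∈ stdSimplex ℝ (∀ i, X i)) (k : Fin n)
    (f : (∀ i, X i) → ℝ) : ∑ x, iidPmf q n x * f (letter k x) = ∑ z, q z * f z := by
  have h := prodExp_coord (fun _ : Fin n => hq) k f
  rw [← h, prodExp, ← Equiv.sum_comp (Equiv.piComm fun (i : Fin t) (_ : Fin n) => X i)]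
  rfl

theorem ent_iidPmf {q : (∀ i, X i) → ℝ} (hq : q ∈ stdSimplex ℝ (∀ i, X i)) :
    ent (iidPmf q n) = n * ent q := by
  have h1 : ∀ x : (∀ i, Fin n → X i), Real.negMulLog (iidPmf q n x) =
      ∑ k, iidPmf q n x * -Real.log (q (letter k x)) := by
    intro x
    by_cases h : ∀ k : Fin n, q (letter k x) ≠ 0
    · rw [← Finset.mul_sum, Finset.sum_neg_distrib, ← Real.log_prod fun k _ => h k,
        Real.negMulLog, neg_mul, mul_neg]
      rfl
    · push Not at h
      obtain ⟨k, hk⟩ := h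
      have : iidPmf q n x = 0 := Finset.prod_eq_zero (Finset.mem_univ k) hk
      simp [this]
  rw [ent]
  simp only [h1]
  rw [Finset.sum_comm]
  rw [Finset.sum_congr rfl fun k _ => sum_iidPmf_mul_letter hq k fun z => -Real.log (q z)]
  simp [ent, Real.negMulLog]

variable [∀ i, DecidableEq (X i)]

/-- Gibbs' inequality against the product of the letter marginals; the pointwise correction terms
sum to zero. -/
theorem ent_le_sum_ent_letter {p : (∀ i, Fin n → X i) → ℝ}
    (hp : p ∈ stdSimplex ℝ (∀ i, Fin n → X i)) : ent p ≤ ∑ k, ent (law p (letter k)) := by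
  have h1 : ∀ x, Real.negMulLog (p x) ≤ ∑ k, p x * -Real.log (law p (letter k) (letter k x)) +
      (∏ k, law p (letter k) (letter k x) - p x) := by
    intro x
    have h0 : ∀ k, 0 ≤ law p (letter k) (letter k x) := fun k =>
      (law_mem_stdSimplex hp (letter k)).1 _
    rcases (hp.1 x).eq_or_lt with h | h
    · rw [← h]
      simp only [Real.negMulLog_zero, zero_mul, sub_zero, Finset.sum_const_zero, zero_add]
      exact Finset.prod_nonneg fun k _ => h0 k
    have hpos : ∀ k, 0 < law p (letter k) (letter k x) := fun k => by
      refine lt_of_lt_of_le ?_ (Finset.single_le_sum (fun y _ => ?_) (Finset.mem_univ x))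
      · simpa using h
      · split_ifs
        exacts [hp.1 y, le_rfl]
    have hP : 0 < ∏ k, law p (letter k) (letter k x) := Finset.prod_pos fun k _ => hpos k
    have h2 := Real.log_le_sub_one_of_pos (div_pos hP h)
    rw [Real.log_div hP.ne' h.ne', Real.log_prod fun k _ => (hpos k).ne'] at h2
    have h3 := mul_le_mul_of_nonneg_left h2 h.le
    rw [mul_sub (p x) _ 1, mul_div_cancel₀ _ h.ne'] at h3
    rw [← Finset.mul_sum, Finset.sum_neg_distrib]
    simp only [Real.negMulLog]
    linarith
  have h2 : ∑ x, ∏ k, law p (letter k) (letter k x) = 1 := by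
    rw [sum_prod_letter fun k => law p (letter k)]
    exact Finset.prod_eq_one fun k _ => (law_mem_stdSimplex hp (letter k)).2
  refine (Finset.sum_le_sum fun x _ => h1 x).trans (le_of_eq ?_)
  rw [Finset.sum_add_distrib, Finset.sum_sub_distrib, h2, hp.2, sub_self, add_zero,
    Finset.sum_comm]
  refine Finset.sum_congr rfl fun k _ => ?_
  rw [← sum_law_mul p (letter k) fun z => -Real.log (law p (letter k) z)]
  simp [ent, Real.negMulLog]

end Sequence

/-! ### The converse -/

theorem law_pi {I : Type*} [Fintype I] [DecidableEq I] {Ω A : I → Type*} [∀ i, Fintype (Ω i)]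
    [∀ i, DecidableEq (A i)] (P : ∀ i, Ω i → ℝ) (f : ∀ i, Ω i → A i) (a : ∀ i, A i) :
    law (fun ω : ∀ i, Ω i => ∏ i, P i (ω i)) (fun ω i => f i (ω i)) a = ∏ i, law (P i) (f i) (a i) := by
  simp only [law_eq_sum_mul]
  rw [Finset.prod_univ_sum, Fintype.piFinset_univ]
  refine Finset.sum_congr rfl fun ω _ => ?_
  rw [Finset.prod_mul_distrib, Finset.prod_ite_zero]
  simp [funext_iff]

theorem one_le_size {n : ℕ} {r : ℝ} (hr : 0 ≤ r) : 1 ≤ size n r := by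
  rw [size, Nat.one_le_floor_iff]
  exact Real.one_le_rpow one_le_two (by positivity)

theorem log_size_le {n : ℕ} {r : ℝ} (hr : 0 ≤ r) :
    Real.log (size n r) ≤ n * (r * Real.log 2) := by
  have h1 : (size n r : ℝ) ≤ (2 : ℝ) ^ ((n : ℝ) * r) := Nat.floor_le (by positivity)
  have h2 : (0 : ℝ) < size n r := by exact_mod_cast one_le_size hr
  refine (Real.log_le_log h2 h1).trans (le_of_eq ?_)
  rw [Real.log_rpow two_pos]
  ring

/-- The uniform p.m.f. -/
def unif (α : Type*) [Fintype α] (_ : α) : ℝ := (Fintype.card α : ℝ)⁻¹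

theorem unif_mem_stdSimplex (α : Type*) [Fintype α] [Nonempty α] :
    unif α ∈ stdSimplex ℝ α :=
  ⟨fun _ => by simp [unif], by simp [unif]⟩

theorem law_unif_snd_apply {B I : Type*} [Fintype B] [Nonempty B] [Fintype I] [DecidableEq I]
    {D : I → Type*} [∀ i, Fintype (D i)] [∀ i, Nonempty (D i)] [∀ i, DecidableEq (D i)] (i : I)
    (d : D i) : law (unif (B × ∀ i, D i)) (fun z => z.2 i) d = unif (D i) d := by
  have h := prodExp_coord (fun i => unif_mem_stdSimplex (D i)) i (fun a => if a = d then 1 else 0)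
  simp only [prodExp, unif, mul_ite, mul_one, mul_zero, Finset.sum_ite_eq', Finset.mem_univ,
    if_true] at h
  have hB : (Fintype.card B : ℝ) ≠ 0 := by positivity
  rw [unif, ← h, law_eq_sum_mul, Fintype.sum_prod_type]
  rw [Finset.sum_comm]
  refine Finset.sum_congr rfl fun w _ => ?_
  by_cases hw : w i = d
  · simp only [unif, hw, if_true, mul_one, Finset.sum_const, Finset.card_univ, nsmul_eq_mul,
      Fintype.card_prod, Fintype.card_pi, Nat.cast_mul, Nat.cast_prod]
    rw [Finset.prod_inv_distrib, mul_inv, ← mul_assoc, mul_inv_cancel₀ hB, one_mul]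
  · simp [hw]

section Converse

variable {t h : ℕ} {V : Fin t → Finset (Fin h)} {X : Fin t → Type*} [∀ i, Fintype (X i)]
  {n : ℕ} {R : ℝ} {Rs : Fin h → ℝ}

/-- The conditional p.m.f. of the outputs of a code given all messages. -/
def Code.cond (c : Code V X n R Rs) (m : Fin (size n R)) (w : ∀ j, Fin (size n (Rs j)))
    (x : ∀ i, Fin n → X i) : ℝ := ∏ i, c.dec i m ((V i).restrict w) (x i)

theorem Code.cond_mem (c : Code V X n R Rs) (m : Fin (size n R)) (w : ∀ j, Fin (size n (Rs j))) :
    c.cond m w ∈ stdSimplex ℝ (∀ i, Fin n → X i) :=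
  chan_mem_stdSimplex (K := fun i (_ : Unit) => c.dec i m ((V i).restrict w))
    (fun i _ => c.dec_mem i m _) ()

theorem Code.induced_eq (c : Code V X n R Rs) (x : ∀ i, Fin n → X i) :
    c.induced x = ∑ m, unif (Fin (size n R)) m *
      prodExp (fun j => unif (Fin (size n (Rs j)))) (fun w => c.cond m w x) := by
  simp only [Code.induced, Code.cond, prodExp, unif, Fintype.card_fin, Finset.mul_sum,
    Finset.prod_inv_distrib]
  refine Finset.sum_congr rfl fun m _ => Finset.sum_congr rfl fun w _ => ?_
  rw [div_eq_inv_mul, mul_inv, mul_assoc]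

/-- The conditional p.m.f. of the outputs of a code given the messages `m` and `w j`, `j ∈ S`. -/
def Code.condOn (c : Code V X n R Rs) (S : Finset (Fin h)) (m : Fin (size n R))
    (w : ∀ j, Fin (size n (Rs j))) (x : ∀ i, Fin n → X i) : ℝ :=
  resample (fun j => unif (Fin (size n (Rs j)))) S (fun w => c.cond m w x) w

theorem Code.condOn_mem (c : Code V X n R Rs)
    (hu : ∀ j, unif (Fin (size n (Rs j))) ∈ stdSimplex ℝ (Fin (size n (Rs j))))
    (S : Finset (Fin h)) (m : Fin (size n R)) (w : ∀ j, Fin (size n (Rs j))) :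
    c.condOn S m w ∈ stdSimplex ℝ (∀ i, Fin n → X i) := by
  refine ⟨fun x => resample_nonneg hu S (fun w => (c.cond_mem m w).1 x) w, ?_⟩
  simp only [condOn, resample, ← prodExp_sum, (c.cond_mem m _).2, prodExp_const hu]

theorem nonempty_fin_size {n : ℕ} {r : ℝ} (hr : 0 ≤ r) : Nonempty (Fin (size n r)) :=
  ⟨⟨0, one_le_size hr⟩⟩

theorem Code.induced_mem (c : Code V X n R Rs) (hR : 0 ≤ R) (hRs : ∀ j, 0 ≤ Rs j) :
    c.induced ∈ stdSimplex ℝ (∀ i, Fin n → X i) := by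
  have := nonempty_fin_size (n := n) hR
  have := fun j => nonempty_fin_size (n := n) (hRs j)
  have hu := fun j => unif_mem_stdSimplex (Fin (size n (Rs j)))
  have hm := unif_mem_stdSimplex (Fin (size n R))
  refine ⟨fun x => ?_, ?_⟩
  · rw [c.induced_eq]
    exact Finset.sum_nonneg fun m _ => mul_nonneg (hm.1 m)
      (prodExp_nonneg hu fun w => (c.cond_mem m w).1 x)
  · simp only [c.induced_eq]
    rw [Finset.sum_comm]
    simp only [← Finset.mul_sum, ← prodExp_sum, (c.cond_mem _ _).2, prodExp_const hu, mul_one, hm.2]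

/-- This is `H(X^n) ≤ H(W, W_S) + H(X^n | W, W_S)`. The output probability is at least the
conditional one times the probability of the conditioning value, so the bound already holds
pointwise under the logarithm. -/
theorem Code.ent_induced_le (c : Code V X n R Rs) (hR : 0 ≤ R) (hRs : ∀ j, 0 ≤ Rs j)
    (S : Finset (Fin h)) :
    ent c.induced ≤ Real.log (size n R) + ∑ j ∈ S, Real.log (size n (Rs j)) +
      ∑ m, unif (Fin (size n R)) m *
        prodExp (fun j => unif (Fin (size n (Rs j)))) (fun w => ent (c.condOn S m w)) := by
  have := nonempty_fin_size (n := n) hR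
  have := fun j => nonempty_fin_size (n := n) (hRs j)
  have hu := fun j => unif_mem_stdSimplex (Fin (size n (Rs j)))
  have hm := unif_mem_stdSimplex (Fin (size n R))
  have hM : (0 : ℝ) < size n R := by exact_mod_cast one_le_size hR
  have hMs : ∀ j, (0 : ℝ) < size n (Rs j) := fun j => by exact_mod_cast one_le_size (hRs j)
  set L := Real.log (size n R) + ∑ j ∈ S, Real.log (size n (Rs j)) with hL
  have hS : 0 < ∏ j ∈ S, (size n (Rs j) : ℝ)⁻¹ := Finset.prod_pos fun j _ => inv_pos.2 (hMs j)
  have hlog : ∀ Q I : ℝ, 0 < Q → (size n R : ℝ)⁻¹ * ((∏ j ∈ S, (size n (Rs j) : ℝ)⁻¹) * Q) ≤ I →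
      Q * -Real.log I ≤ Q * L + Real.negMulLog Q := by
    intro Q I hQ hI
    have h2 := Real.log_le_log (mul_pos (inv_pos.2 hM) (mul_pos hS hQ)) hI
    rw [Real.log_mul (inv_pos.2 hM).ne' (mul_pos hS hQ).ne', Real.log_mul hS.ne' hQ.ne',
      Real.log_inv, Real.log_prod fun j _ => (inv_pos.2 (hMs j)).ne'] at h2
    simp only [Real.log_inv, Finset.sum_neg_distrib] at h2
    have h3 : -Real.log I ≤ L - Real.log Q := by linarith
    have h4 := mul_le_mul_of_nonneg_left h3 hQ.le
    simp only [Real.negMulLog]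
    linarith
  have hle : ∀ m w x, c.condOn S m w x * (-Real.log (c.induced x)) ≤
      c.condOn S m w x * L + Real.negMulLog (c.condOn S m w x) := by
    intro m w x
    rcases ((c.condOn_mem hu S m w).1 x).eq_or_lt with h0 | h0
    · rw [← h0]; simp
    have h1 : (size n R : ℝ)⁻¹ * ((∏ j ∈ S, (size n (Rs j) : ℝ)⁻¹) * c.condOn S m w x) ≤
        c.induced x := by
      rw [c.induced_eq]
      have h2 := prod_mul_resample_le hu S (fun w => (c.cond_mem m w).1 x) w
      simp only [unif, Fintype.card_fin] at h2
      have h3 := Finset.single_le_sum (f := fun m => unif (Fin (size n R)) m *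
        prodExp (fun j => unif (Fin (size n (Rs j)))) (fun w => c.cond m w x))
        (fun m _ => mul_nonneg (hm.1 m) (prodExp_nonneg hu fun w => (c.cond_mem m w).1 x))
        (Finset.mem_univ m)
      refine le_trans ?_ h3
      simp only [unif, Fintype.card_fin]
      exact mul_le_mul_of_nonneg_left h2 (inv_nonneg.2 hM.le)
    exact hlog _ _ h0 h1
  have h1 : ent c.induced = ∑ m, unif (Fin (size n R)) m *
      prodExp (fun j => unif (Fin (size n (Rs j))))
        (fun w => ∑ x, c.condOn S m w x * (-Real.log (c.induced x))) := by
    have h2 : ∀ x, Real.negMulLog (c.induced x) = ∑ m, unif (Fin (size n R)) m *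
        prodExp (fun j => unif (Fin (size n (Rs j))))
          (fun w => c.condOn S m w x * (-Real.log (c.induced x))) := by
      intro x
      have h3 : ∀ m, prodExp (fun j => unif (Fin (size n (Rs j)))) (fun w => c.condOn S m w x) =
          prodExp (fun j => unif (Fin (size n (Rs j)))) (fun w => c.cond m w x) :=
        fun m => prodExp_resample hu S _
      simp only [prodExp_mul_const, h3, ← mul_assoc, ← Finset.sum_mul]
      rw [← c.induced_eq]
      simp [Real.negMulLog]
    rw [ent]
    simp only [h2]
    rw [Finset.sum_comm]
    simp only [← Finset.mul_sum, ← prodExp_sum]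
  have h2 : L = ∑ m, unif (Fin (size n R)) m *
      prodExp (fun j => unif (Fin (size n (Rs j)))) (fun _ => L) := by
    simp only [prodExp_const hu]
    rw [← Finset.sum_mul, hm.2, one_mul]
  rw [h1, h2, ← Finset.sum_add_distrib]
  refine Finset.sum_le_sum fun m _ => ?_
  rw [← mul_add, ← prodExp_add]
  refine mul_le_mul_of_nonneg_left (prodExp_mono hu fun w => ?_) (hm.1 m)
  refine (Finset.sum_le_sum fun x _ => hle m w x).trans (le_of_eq ?_)
  rw [Finset.sum_add_distrib, ← Finset.sum_mul, (c.condOn_mem hu S m w).2, one_mul]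
  rfl

variable [∀ i, DecidableEq (X i)]

/-- The alphabet of the single-letter model of a code. -/
abbrev CodeAlphabet (n : ℕ) (R : ℝ) (Rs : Fin h → ℝ) : Type :=
  (Fin (size n R) × Fin n) × ∀ j, Fin (size n (Rs j))

/-- The kernels of the single-letter model of a code: `U` is the message together with a time
index, `U_j` is `w_j`. -/
def Code.kernel (c : Code V X n R Rs) (i : Fin t) (u : Fin (h + 1) → CodeAlphabet n R Rs) :
    X i → ℝ :=
  law (c.dec i (u 0).1.1 ((V i).restrict fun j => (u j.succ).2 j)) fun x => x (u 0).1.2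

theorem Code.chan_kernel (c : Code V X n R Rs) (u : Fin (h + 1) → CodeAlphabet n R Rs) :
    chan c.kernel u = law (c.cond (u 0).1.1 fun j => (u j.succ).2 j) (letter (u 0).1.2) := by
  funext x
  exact (law_pi _ (fun i (y : Fin n → X i) => y (u 0).1.2) x).symm

theorem sum_unif_prod_mul {A B : Type*} [Fintype A] [Fintype B] [Nonempty B] (f : A → ℝ) :
    ∑ z : A × B, unif (A × B) z * f z.1 = ∑ a, unif A a * f a := by
  have hB : (Fintype.card B : ℝ) ≠ 0 := by positivity
  simp only [Fintype.sum_prod_type, unif, Finset.sum_const, Finset.card_univ, nsmul_eq_mul,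
    Fintype.card_prod, Nat.cast_mul]
  refine Finset.sum_congr rfl fun a _ => ?_
  rw [mul_inv]
  field_simp

theorem Code.isModel_kernel [NeZero n] (c : Code V X n R Rs) (hR : 0 ≤ R) (hRs : ∀ j, 0 ≤ Rs j) :
    IsModel V (fun _ => unif (CodeAlphabet n R Rs)) c.kernel := by
  have := nonempty_fin_size (n := n) hR
  have := fun j => nonempty_fin_size (n := n) (hRs j)
  refine ⟨fun j => unif_mem_stdSimplex _, fun i u => law_mem_stdSimplex (c.dec_mem i _ _) _,
    fun i u v h0 hV => ?_⟩
  have : ((V i).restrict fun j => (u j.succ).2 j) = (V i).restrict fun j => (v j.succ).2 j := by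
    funext j
    simp [hV j j.2]
  simp only [Code.kernel, h0, this]

theorem law_prodExp {J : Type*} [Fintype J] [DecidableEq J] {A : J → Type*} [∀ j, Fintype (A j)]
    {Ω Y : Type*} [Fintype Ω] [DecidableEq Y] (p : ∀ j, A j → ℝ) (G : (∀ j, A j) → Ω → ℝ)
    (f : Ω → Y) (y : Y) :
    law (fun ω => prodExp p fun u => G u ω) f y = prodExp p fun u => law (G u) f y := by
  simp only [law_eq_sum_mul, prodExp_sum, prodExp_mul_const]

theorem Code.outPmf_kernel [NeZero n] (c : Code V X n R Rs) (hR : 0 ≤ R) (hRs : ∀ j, 0 ≤ Rs j)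
    (x : ∀ i, X i) : outPmf (fun _ => unif (CodeAlphabet n R Rs)) c.kernel x =
      (n : ℝ)⁻¹ * ∑ k, law c.induced (letter k) x := by
  have := nonempty_fin_size (n := n) hR
  have := fun j => nonempty_fin_size (n := n) (hRs j)
  rw [outPmf, prodExp_succ]
  simp only [c.chan_kernel, Fin.cons_zero, Fin.cons_succ]
  have h1 : ∀ m k, prodExp (fun _ : Fin h => unif (CodeAlphabet n R Rs))
      (fun us => law (c.cond m fun j => (us j).2 j) (letter k) x) =
      law (fun y => prodExp (fun j => unif (Fin (size n (Rs j)))) fun w => c.cond m w y)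
        (letter k) x := fun m k => by
    rw [law_prodExp]
    exact prodExp_map _ _ (fun j (z : CodeAlphabet n R Rs) => z.2 j)
      (fun j => law_unif_snd_apply (D := fun j => Fin (size n (Rs j))) j) fun w => law (c.cond m w) (letter k) x
  simp only [h1]
  rw [sum_unif_prod_mul (B := ∀ j, Fin (size n (Rs j))) fun z : Fin (size n R) × Fin n =>
    law (fun y => prodExp (fun j => unif (Fin (size n (Rs j)))) fun w => c.cond z.1 w y)
        (letter z.2) x, Fintype.sum_prod_type_right]
  simp only [law_eq_sum_mul, c.induced_eq, Finset.mul_sum, Finset.sum_mul]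
  refine Finset.sum_congr rfl fun k _ => ?_
  rw [Finset.sum_comm]
  refine Finset.sum_congr rfl fun y _ => Finset.sum_congr rfl fun m _ => ?_
  simp only [unif, Fintype.card_prod, Fintype.card_fin, Nat.cast_mul, mul_inv]
  ring

/-- Every input is uniform on the same large alphabet, but the kernels read only message and time
from input `0` and only `w_j` from input `j.succ`; the unused components average out. -/
theorem Code.condEnt_kernel [NeZero n] (c : Code V X n R Rs) (hR : 0 ≤ R) (hRs : ∀ j, 0 ≤ Rs j)
    {T : Finset (Fin (h + 1))} (hT : 0 ∈ T) {S : Finset (Fin h)} (hS : ∀ j, j.succ ∈ T ↔ j ∈ S) :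
    condEnt (fun _ => unif (CodeAlphabet n R Rs)) (chan c.kernel) T =
      (n : ℝ)⁻¹ * ∑ m, unif (Fin (size n R)) m * prodExp (fun j => unif (Fin (size n (Rs j))))
        (fun w => ∑ k, ent (law (c.condOn S m w) (letter k))) := by
  have := nonempty_fin_size (n := n) hR
  have := fun j => nonempty_fin_size (n := n) (hRs j)
  rw [condEnt_cons (unif_mem_stdSimplex _) hT hS]
  simp only [c.chan_kernel, Fin.cons_zero, Fin.cons_succ]
  have h1 : ∀ m k, condEnt (fun _ : Fin h => unif (CodeAlphabet n R Rs))
      (fun us => law (c.cond m fun j => (us j).2 j) (letter k)) S =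
      prodExp (fun j => unif (Fin (size n (Rs j))))
        (fun w => ent (law (c.condOn S m w) (letter k))) := fun m k => by
    rw [condEnt_map _ _ (fun j (z : CodeAlphabet n R Rs) => z.2 j)
      (fun j => law_unif_snd_apply (D := fun j => Fin (size n (Rs j))) j) (fun w => law (c.cond m w) (letter k)) S]
    rw [condEnt]
    congr 1
    funext w
    refine Finset.sum_congr rfl fun x _ => ?_
    congr 1
    exact (law_prodExp _ (fun v => c.cond m (S.piecewise w v)) (letter k) x).symm
  simp only [h1]
  rw [sum_unif_prod_mul (B := ∀ j, Fin (size n (Rs j))) fun z : Fin (size n R) × Fin n =>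
    prodExp (fun j => unif (Fin (size n (Rs j))))
        (fun w => ent (law (c.condOn S z.1 w) (letter z.2))), Fintype.sum_prod_type]
  simp only [prodExp_sum, Finset.mul_sum]
  refine Finset.sum_congr rfl fun m _ => Finset.sum_congr rfl fun k _ => ?_
  simp only [unif, Fintype.card_prod, Fintype.card_fin, Nat.cast_mul, mul_inv]
  ring

/-- The loss in the single-letter bounds for codes with total variation error `D`. -/
def converseLoss (X : Fin t → Type*) [∀ i, Fintype (X i)] (n : ℕ) (D : ℝ) : ℝ :=
  (Real.negMulLog D + D) * (n : ℝ)⁻¹ + D * Real.log (Fintype.card (∀ i, X i))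

/-- The single-letter bounds at finite blocklength: replace `H(X^n)` by `n H(q)` through continuity,
and bound the conditional entropy of the sequence by that of its letters. The loss is charged to the
first rate, which enters every nontrivial bound. -/
theorem Code.mem_modelRegion [NeZero n] (c : Code V X n R Rs) (hR : 0 ≤ R) (hRs : ∀ j, 0 ≤ Rs j)
    {q : (∀ i, X i) → ℝ} (hq : q ∈ stdSimplex ℝ (∀ i, X i)) :
    ((fun x => (n : ℝ)⁻¹ * ∑ k, law c.induced (letter k) x : (∀ i, X i) → ℝ),
      (Fin.cons (R * Real.log 2 - ent q +
        converseLoss X n (∑ x, |c.induced x - iidPmf q n x|)) fun j => Rs j * Real.log 2 :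
        Fin (h + 1) → ℝ)) ∈ modelRegion V X := by
  have hlog : 0 < Real.log 2 := Real.log_pos one_lt_two
  have hn : (0 : ℝ) < n := by exact_mod_cast Nat.pos_of_ne_zero (NeZero.ne n)
  rw [← funext (c.outPmf_kernel hR hRs)]
  refine ObliviousCoordinator.mem_modelRegion (c.isModel_kernel hR hRs) fun T => ?_
  rw [rateBound]
  split_ifs with hT
  · set S : Finset (Fin h) := Finset.univ.filter fun j => j.succ ∈ T with hSdef
    have hS : ∀ j, j.succ ∈ T ↔ j ∈ S := fun j => by simp [hSdef]
    have hTS : T = insert 0 (S.map (Fin.succEmb h)) := by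
      ext j
      refine Fin.cases ?_ (fun j => ?_) j
      · simp [hT]
      · simp [hS, Fin.succ_ne_zero]
    have hsum : ∀ f : Fin (h + 1) → ℝ, ∑ j ∈ T, f j = f 0 + ∑ j ∈ S, f j.succ := fun f => by
      rw [hTS, Finset.sum_insert (by simp [Fin.succ_ne_zero]), Finset.sum_map]
      rfl
    rw [c.condEnt_kernel hR hRs hT hS, hsum]
    simp only [Fin.cons_zero, Fin.cons_succ]
    have := nonempty_fin_size (n := n) hR
    have := fun j => nonempty_fin_size (n := n) (hRs j)
    have hu := fun j => unif_mem_stdSimplex (Fin (size n (Rs j)))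
    have hm := unif_mem_stdSimplex (Fin (size n R))
    have h1 : ∑ m, unif (Fin (size n R)) m * prodExp (fun j => unif (Fin (size n (Rs j))))
          (fun w => ent (c.condOn S m w)) ≤
        ∑ m, unif (Fin (size n R)) m * prodExp (fun j => unif (Fin (size n (Rs j))))
          (fun w => ∑ k, ent (law (c.condOn S m w) (letter k))) :=
      Finset.sum_le_sum fun m _ => mul_le_mul_of_nonneg_left
        (prodExp_mono hu fun w => ent_le_sum_ent_letter (c.condOn_mem hu S m w)) (hm.1 m)
    have h2 := c.ent_induced_le hR hRs S
    have h3 := ent_sub_ent_le (c.induced_mem hR hRs) (iidPmf_mem_stdSimplex (n := n) hq)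
    rw [ent_iidPmf hq] at h3
    have h4 := log_size_le (n := n) hR
    have h5 : ∑ j ∈ S, Real.log (size n (Rs j)) ≤ n * ∑ j ∈ S, Rs j * Real.log 2 := by
      rw [Finset.mul_sum]
      exact Finset.sum_le_sum fun j _ => log_size_le (hRs j)
    have h6 : Real.log (Fintype.card (∀ i, Fin n → X i)) =
        n * Real.log (Fintype.card (∀ i, X i)) := by
      rw [Fintype.card_congr (Equiv.piComm fun (i : Fin t) (_ : Fin n) => X i), Fintype.card_pi]
      simp
    rw [h6] at h3
    set B := ∑ m, unif (Fin (size n R)) m * prodExp (fun j => unif (Fin (size n (Rs j))))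
          (fun w => ∑ k, ent (law (c.condOn S m w) (letter k)))
    set D := ∑ x, |c.induced x - iidPmf q n x|
    have h7 : n * ent q - (Real.negMulLog D + D * (n * Real.log (Fintype.card (∀ i, X i))) + D) -
        n * (R * Real.log 2) - n * ∑ j ∈ S, Rs j * Real.log 2 ≤ B := by linarith
    have h8 := mul_le_mul_of_nonneg_left h7 (inv_nonneg.2 hn.le)
    have h9 : (n : ℝ)⁻¹ * (n * ent q - (Real.negMulLog D + D * (n *
        Real.log (Fintype.card (∀ i, X i))) + D) - n * (R * Real.log 2) -
        n * ∑ j ∈ S, Rs j * Real.log 2) = ent q - converseLoss X n D - R * Real.log 2 -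
        ∑ j ∈ S, Rs j * Real.log 2 := by
      rw [converseLoss]
      field_simp
      ring
    linarith
  · refine Finset.sum_nonneg fun j hj => ?_
    obtain ⟨i, rfl⟩ := Fin.exists_succ_eq.2 fun h0 : j = 0 => hT (h0 ▸ hj)
    rw [Fin.cons_succ]
    exact mul_nonneg (hRs i) hlog.le

/-- The averaged letter laws tend to `q` and the losses to zero; closedness of the region supplies a
single finite model in the limit. -/
theorem mem_modelRegion_of_achievable {q : (∀ i, X i) → ℝ} (hq : q ∈ stdSimplex ℝ (∀ i, X i))
    (hA : Achievable V q R Rs) :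
    (q, (Fin.cons (R * Real.log 2 - ent q) fun j => Rs j * Real.log 2 : Fin (h + 1) → ℝ)) ∈
      modelRegion V X := by
  obtain ⟨hR, hRs, c, hc⟩ := hA
  set D : ℕ → ℝ := fun n => ∑ x, |(c n).induced x - iidPmf q n x| with hD
  have hinv : Tendsto (fun n : ℕ => (n : ℝ)⁻¹) atTop (𝓝 0) := tendsto_inv_atTop_nhds_zero_nat
  have hη : Tendsto (fun n => Real.negMulLog (D n)) atTop (𝓝 0) := by
    have := (Real.continuous_negMulLog.tendsto 0).comp hc
    rwa [Real.negMulLog_zero] at this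
  have hloss : Tendsto (fun n => converseLoss X n (D n)) atTop (𝓝 0) := by
    have := ((hη.add hc).mul hinv).add (hc.mul_const (Real.log (Fintype.card (∀ i, X i))))
    simpa [converseLoss] using this
  refine (isClosed_modelRegion V).mem_of_tendsto (f := fun n : ℕ =>
    ((fun x => (n : ℝ)⁻¹ * ∑ k, law (c n).induced (letter k) x : (∀ i, X i) → ℝ),
      (Fin.cons (R * Real.log 2 - ent q + converseLoss X n (D n)) fun j => Rs j * Real.log 2 :
        Fin (h + 1) → ℝ))) (b := atTop) ?_ ?_
  · refine Tendsto.prodMk_nhds (tendsto_pi_nhds.2 fun x => ?_) (tendsto_pi_nhds.2 fun j => ?_)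
    · rw [tendsto_iff_dist_tendsto_zero]
      refine squeeze_zero' (Eventually.of_forall fun _ => dist_nonneg) ?_ hc
      filter_upwards [eventually_gt_atTop 0] with n hn
      have hn' : (0 : ℝ) < n := by exact_mod_cast hn
      have h1 : ∀ k : Fin n, |law (c n).induced (letter k) x - q x| ≤ D n := by
        intro k
        have h2 := sum_iidPmf_mul_letter hq k (fun z => if z = x then 1 else 0)
        simp only [mul_ite, mul_one, mul_zero, Finset.sum_ite_eq', Finset.mem_univ, if_true] at h2
        rw [← h2, law, ← Finset.sum_sub_distrib]
        refine (Finset.abs_sum_le_sum_abs _ _).trans (Finset.sum_le_sum fun y _ => ?_)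
        split_ifs
        · exact le_rfl
        · simp
      have h3 : (n : ℝ)⁻¹ * ∑ k, law (c n).induced (letter k) x - q x =
          (n : ℝ)⁻¹ * ∑ k : Fin n, (law (c n).induced (letter k) x - q x) := by
        rw [Finset.sum_sub_distrib, Finset.sum_const, Finset.card_univ, Fintype.card_fin,
          nsmul_eq_mul]
        field_simp
      rw [Real.dist_eq, h3, abs_mul, abs_of_pos (inv_pos.2 hn')]
      have h4 : |∑ k : Fin n, (law (c n).induced (letter k) x - q x)| ≤ n * D n := by
        refine (Finset.abs_sum_le_sum_abs _ _).trans ((Finset.sum_le_sum fun k _ => h1 k).trans ?_)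
        simp
      refine (mul_le_mul_of_nonneg_left h4 (inv_nonneg.2 hn'.le)).trans (le_of_eq ?_)
      field_simp
    · refine Fin.cases ?_ (fun j => ?_) j
      · simp only [Fin.cons_zero]
        simpa using hloss.const_add (R * Real.log 2 - ent q)
      · simp only [Fin.cons_succ]
        exact tendsto_const_nhds
  · filter_upwards [eventually_gt_atTop 0] with n hn
    have : NeZero n := ⟨hn.ne'⟩
    exact (c n).mem_modelRegion hR hRs hq

theorem rateRegion_subset_singleLetterRegion {q : (∀ i, X i) → ℝ}
    (hq : q ∈ stdSimplex ℝ (∀ i, X i)) : rateRegion V q ⊆ singleLetterRegion V q := by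
  -- The model region is pulled back along a continuous map, so passing to the closure of the
  -- achievable tuples costs nothing.
  have hclosed : IsClosed {r : ℝ × (Fin h → ℝ) | 0 ≤ r.1 ∧ (∀ j, 0 ≤ r.2 j) ∧
      (q, (Fin.cons (r.1 * Real.log 2 - ent q) fun j => r.2 j * Real.log 2 : Fin (h + 1) → ℝ)) ∈
        modelRegion V X} := by
    simp only [Set.ofPred_and, Set.ofPred_forall]
    refine (isClosed_le continuous_const continuous_fst).inter (IsClosed.inter
      (isClosed_iInter fun j => isClosed_le continuous_const (by fun_prop))
      ((isClosed_modelRegion V).preimage (continuous_const.prodMk (continuous_pi fun j => ?_))))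
    refine Fin.cases ?_ (fun j => ?_) j
    · simp only [Fin.cons_zero]
      fun_prop
    · simp only [Fin.cons_succ]
      fun_prop
  intro r hr
  obtain ⟨hR, hRs, hmem⟩ := hclosed.closure_subset_iff.2
    (fun r (hr : Achievable V q r.1 r.2) =>
      And.intro hr.1 (And.intro hr.2.1 (mem_modelRegion_of_achievable hq hr))) hr
  exact mem_singleLetterRegion_of_mem_modelRegion hR hRs hmem

end Converse

/-! ### Moments of averages over i.i.d. variables -/

section Moments

variable {J : Type*} [Fintype J] [DecidableEq J] {A : J → Type*} [∀ j, Fintype (A j)]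

theorem sq_prodExp_abs_le {p : ∀ j, A j → ℝ} (hp : ∀ j, p j ∈ stdSimplex ℝ (A j))
    (G : (∀ j, A j) → ℝ) : prodExp p (fun u => |G u|) ^ 2 ≤ prodExp p (fun u => G u ^ 2) := by
  set e := prodExp p (fun u => |G u|) with he
  have h1 : prodExp p (fun u => (2 * e) * |G u| - e ^ 2) ≤ prodExp p (fun u => G u ^ 2) :=
    prodExp_mono hp fun u => by
      rw [← sq_abs (G u)]
      nlinarith [sq_nonneg (|G u| - e)]
  rw [prodExp_sub, prodExp_const_mul, prodExp_const hp, ← he] at h1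
  nlinarith

theorem exists_le_of_prodExp_le {p : ∀ j, A j → ℝ} (hp : ∀ j, p j ∈ stdSimplex ℝ (A j))
    {G : (∀ j, A j) → ℝ} {c : ℝ} (h : prodExp p G ≤ c) : ∃ u, G u ≤ c := by
  have : Nonempty (∀ j, A j) := by
    by_contra hne
    rw [not_nonempty_iff] at hne
    have := prodExp_const hp (1 : ℝ)
    simp [prodExp] at this
  obtain ⟨u, hu⟩ := Finite.exists_min G
  refine ⟨u, le_trans ?_ h⟩
  rw [← prodExp_const hp (G u)]
  exact prodExp_mono hp hu

/-- Variance of an i.i.d. average: the centred cross terms vanish, and the variance of one term is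
at most its second moment. -/
theorem prodExp_sq_average_sub_le {D Ω : Type*} [Fintype D] [DecidableEq D] [Nonempty D]
    [Fintype Ω] {ρ : Ω → ℝ} (hρ : ρ ∈ stdSimplex ℝ Ω) {Y : Ω → ℝ} {μ : ℝ}
    (hμ : ∑ ω, ρ ω * Y ω = μ) :
    prodExp (fun _ : D => ρ) (fun ω => (∑ m, unif D m * Y (ω m) - μ) ^ 2) ≤
      (Fintype.card D : ℝ)⁻¹ * ∑ ω, ρ ω * Y ω ^ 2 := by
  have hρ' : ∀ _ : D, ρ ∈ stdSimplex ℝ Ω := fun _ => hρ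
  have hD : (Fintype.card D : ℝ) ≠ 0 := by positivity
  have h0 : ∑ ω, ρ ω * (Y ω - μ) = 0 := by
    simp only [mul_sub, Finset.sum_sub_distrib, ← Finset.sum_mul, hρ.2, hμ, one_mul, sub_self]
  have h1 : ∀ ω : D → Ω, (∑ m, unif D m * Y (ω m) - μ) ^ 2 =
      (Fintype.card D : ℝ)⁻¹ ^ 2 * ∑ m, ∑ m', (Y (ω m') - μ) * (Y (ω m) - μ) := by
    intro ω
    have e : ∑ m, unif D m * Y (ω m) - μ = (Fintype.card D : ℝ)⁻¹ * ∑ m, (Y (ω m) - μ) := by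
      simp only [unif, ← Finset.mul_sum, Finset.sum_sub_distrib, Finset.sum_const,
        Finset.card_univ, nsmul_eq_mul]
      field_simp
    rw [e, mul_pow, sq (∑ m, (Y (ω m) - μ)), Finset.sum_mul_sum]
    congr 1
    rw [Finset.sum_comm]
  have h2 : ∀ m m' : D, m' ≠ m →
      prodExp (fun _ : D => ρ) (fun ω => (Y (ω m') - μ) * (Y (ω m) - μ)) = 0 := by
    intro m m' hne
    rw [← prodExp_resample_mul hρ' {m} (fun ω => Y (ω m') - μ) (fun ω => Y (ω m) - μ)
      (fun u v => by simp)]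
    have e : ∀ u, resample (fun _ : D => ρ) {m} (fun ω => Y (ω m') - μ) u = 0 := by
      intro u
      rw [resample, ← h0, ← prodExp_coord hρ' m' (fun ω => Y ω - μ)]
      congr 1
      funext v
      simp [hne]
    simp only [e, zero_mul, prodExp_const hρ']
  have h3 : ∀ m : D, prodExp (fun _ : D => ρ) (fun ω => (Y (ω m) - μ) * (Y (ω m) - μ)) ≤
      ∑ ω, ρ ω * Y ω ^ 2 := by
    intro m
    rw [prodExp_coord hρ' m (fun ω => (Y ω - μ) * (Y ω - μ))]
    have e : ∀ ω, ρ ω * ((Y ω - μ) * (Y ω - μ)) =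
        ρ ω * Y ω ^ 2 - 2 * μ * (ρ ω * (Y ω - μ)) - μ ^ 2 * ρ ω := fun ω => by ring
    simp only [e, Finset.sum_sub_distrib, ← Finset.mul_sum, h0, hρ.2]
    nlinarith [sq_nonneg μ]
  simp only [h1, prodExp_const_mul, prodExp_sum]
  have h4 : ∀ m : D, ∑ m', prodExp (fun _ : D => ρ) (fun ω => (Y (ω m') - μ) * (Y (ω m) - μ)) ≤
      ∑ ω, ρ ω * Y ω ^ 2 := fun m => by
    rw [Finset.sum_eq_single m (fun m' _ hne => h2 m m' hne) (by simp)]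
    exact h3 m
  refine (mul_le_mul_of_nonneg_left (Finset.sum_le_sum fun m _ => h4 m) (by positivity)).trans
    (le_of_eq ?_)
  rw [Finset.sum_const, Finset.card_univ, nsmul_eq_mul]
  field_simp

end Moments

/-! ### Soft covering with superposition codebooks -/

section SoftCovering

variable {J : Type*} [Fintype J] [DecidableEq J] {B₀ : Type*} [Fintype B₀] {B : J → Type*}
  [∀ j, Fintype (B j)] {D : J → Type*} [∀ j, Fintype (D j)] [∀ j, DecidableEq (D j)]
  [∀ j, Nonempty (D j)] {Y : Type*} [Fintype Y]

/-- The codewords for one value of the message: a cloud centre and, for every `j`, a codeword for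
each value of the `j`-th shared random variable. -/
abbrev SubCodebook (B₀ : Type*) (B D : J → Type*) : Type _ := B₀ × ∀ s : (Σ j, D j), B s.1

/-- The p.m.f. of a random subcodebook with independent codewords. -/
def subPmf (p₀ : B₀ → ℝ) (p : ∀ j, B j → ℝ) (ω : SubCodebook B₀ B D) : ℝ :=
  p₀ ω.1 * ∏ s, p s.1 (ω.2 s)

/-- The output of the channel `f` averaged over the codewords of a subcodebook. -/
def subOutput (f : B₀ → (∀ j, B j) → Y → ℝ) (ω : SubCodebook B₀ B D) (y : Y) : ℝ :=
  prodExp (fun j => unif (D j)) (fun w => f ω.1 (fun j => ω.2 ⟨j, w j⟩) y)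

theorem sum_subPmf_mul (p₀ : B₀ → ℝ) (p : ∀ j, B j → ℝ) (G : SubCodebook B₀ B D → ℝ) :
    ∑ ω, subPmf p₀ p ω * G ω =
      ∑ b, p₀ b * prodExp (fun s : (Σ j, D j) => p s.1) (fun v => G (b, v)) := by
  simp only [Fintype.sum_prod_type, subPmf, prodExp, Finset.mul_sum, mul_assoc]

theorem subPmf_mem {p₀ : B₀ → ℝ} {p : ∀ j, B j → ℝ} (h₀ : p₀ ∈ stdSimplex ℝ B₀)
    (hp : ∀ j, p j ∈ stdSimplex ℝ (B j)) :
    (subPmf p₀ p : SubCodebook B₀ B D → ℝ) ∈ stdSimplex ℝ (SubCodebook B₀ B D) := by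
  refine ⟨fun ω => mul_nonneg (h₀.1 _) (Finset.prod_nonneg fun s _ => (hp s.1).1 _), ?_⟩
  have h := sum_subPmf_mul (D := D) p₀ p fun _ => 1
  simp only [prodExp_const (fun s : (Σ j, D j) => hp s.1), mul_one, h₀.2] at h
  exact h

theorem prodExp_codeword {p : ∀ j, B j → ℝ} (hp : ∀ j, p j ∈ stdSimplex ℝ (B j)) (w : ∀ j, D j)
    (F : (∀ j, B j) → ℝ) :
    prodExp (fun s : (Σ j, D j) => p s.1) (fun v => F (fun j => v ⟨j, w j⟩)) = prodExp p F := by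
  classical
  have h1 : ∀ u : ∀ j, B j, prodExp (fun s : (Σ j, D j) => p s.1)
      (fun v => ∏ j, if v ⟨j, w j⟩ = u j then (1 : ℝ) else 0) = ∏ j, p j (u j) := by
    intro u
    have h := prodExp_prod (fun s : (Σ j, D j) => p s.1)
      (fun s a => if s.2 = w s.1 then (if a = u s.1 then (1 : ℝ) else 0) else 1)
    have e : ∀ v : ∀ s : (Σ j, D j), B s.1, ∏ s : (Σ j, D j),
        (if s.2 = w s.1 then (if v s = u s.1 then (1 : ℝ) else 0) else 1) =
        ∏ j, if v ⟨j, w j⟩ = u j then (1 : ℝ) else 0 := by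
      intro v
      rw [Fintype.prod_sigma]
      exact Finset.prod_congr rfl fun j _ => by simp
    simp only [e] at h
    rw [h, Fintype.prod_sigma]
    refine Finset.prod_congr rfl fun j _ => ?_
    rw [Fintype.prod_eq_single (w j) fun d hd => by simp [hd, (hp j).2]]
    simp
  have h2 : ∀ v : ∀ s : (Σ j, D j), B s.1, F (fun j => v ⟨j, w j⟩) =
      ∑ u, (∏ j, if v ⟨j, w j⟩ = u j then (1 : ℝ) else 0) * F u := by
    intro v
    simp only [Fintype.prod_ite_zero, Finset.prod_const_one]
    rw [Finset.sum_eq_single (fun j => v ⟨j, w j⟩)]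
    · simp
    · intro u _ hu
      rw [if_neg fun h => hu (funext fun j => (h j).symm), zero_mul]
    · simp
  simp only [h2, prodExp_sum, prodExp_mul_const, h1]
  rfl

/-- Two index tuples select the same codewords where they agree and independent ones elsewhere, so
given the first selection the second is resampled outside the agreement set. -/
theorem prodExp_codeword_mul {p : ∀ j, B j → ℝ} (hp : ∀ j, p j ∈ stdSimplex ℝ (B j))
    (w w' : ∀ j, D j) (F : (∀ j, B j) → ℝ) :
    prodExp (fun s : (Σ j, D j) => p s.1)
      (fun v => F (fun j => v ⟨j, w' j⟩) * F (fun j => v ⟨j, w j⟩)) =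
      prodExp p fun u => resample p (Finset.univ.filter fun j => w' j = w j) F u * F u := by
  classical
  set S := Finset.univ.filter fun j => w' j = w j with hS
  set T : Finset (Σ j, D j) := Finset.univ.filter fun s => s.2 = w s.1 with hT
  rw [← prodExp_resample_mul (fun s : (Σ j, D j) => hp s.1) T
    (fun v => F (fun j => v ⟨j, w' j⟩)) (fun v => F (fun j => v ⟨j, w j⟩))
    (fun u v => by simp [hT]),
    ← prodExp_codeword hp w]
  congr 1
  funext v
  congr 1
  rw [resample, resample, ← prodExp_codeword hp w']
  congr 1
  funext v'
  congr 1
  funext j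
  by_cases hj : w' j = w j
  · rw [Finset.piecewise_eq_of_mem _ _ _ (by simp [hT, hj]),
      Finset.piecewise_eq_of_mem _ _ _ (by simp [hS, hj]), hj]
  · rw [Finset.piecewise_eq_of_notMem _ _ _ (by simp [hT, hj]),
      Finset.piecewise_eq_of_notMem _ _ _ (by simp [hS, hj])]

theorem sum_subPmf_mul_subOutput {p₀ : B₀ → ℝ} {p : ∀ j, B j → ℝ}
    (hp : ∀ j, p j ∈ stdSimplex ℝ (B j)) (f : B₀ → (∀ j, B j) → Y → ℝ) (y : Y) :
    ∑ ω : SubCodebook B₀ B D, subPmf p₀ p ω * subOutput f ω y =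
      ∑ b, p₀ b * prodExp p (fun v => f b v y) := by
  rw [sum_subPmf_mul]
  refine Finset.sum_congr rfl fun b _ => ?_
  congr 1
  have hu := fun j => unif_mem_stdSimplex (D j)
  have h1 : prodExp (fun s : (Σ j, D j) => p s.1) (fun v => subOutput f (b, v) y) =
      prodExp (fun j => unif (D j)) (fun w => prodExp (fun s : (Σ j, D j) => p s.1)
        (fun v => f b (fun j => v ⟨j, w j⟩) y)) := by
    conv_lhs => simp only [subOutput, prodExp.eq_1 (fun j => unif (D j)), prodExp_sum,
      prodExp_const_mul]
    rfl
  rw [h1]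
  simp only [prodExp_codeword hp _ (fun v => f b v y), prodExp_const hu]

/-- Expand the square over pairs of index tuples and sort the pairs by agreement set. Agreement on
`S` has probability `∏_{j ∈ S} 1 / |D j|`, and the conditional output is then at most `C S`. -/
theorem sum_subPmf_mul_subOutput_sq_le {p₀ : B₀ → ℝ} {p : ∀ j, B j → ℝ}
    (h₀ : p₀ ∈ stdSimplex ℝ B₀) (hp : ∀ j, p j ∈ stdSimplex ℝ (B j))
    {f : B₀ → (∀ j, B j) → Y → ℝ} (hf : ∀ b v y, 0 ≤ f b v y) (y : Y) {C : Finset J → ℝ}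
    (hC : ∀ S, 0 ≤ C S) (hfC : ∀ b S v, resample p S (fun v => f b v y) v ≤ C S) :
    ∑ ω : SubCodebook B₀ B D, subPmf p₀ p ω * subOutput f ω y ^ 2 ≤
      (∑ b, p₀ b * prodExp p (fun v => f b v y)) *
        ∑ S, C S * ∏ j ∈ S, (Fintype.card (D j) : ℝ)⁻¹ := by
  have hu := fun j => unif_mem_stdSimplex (D j)
  rw [sum_subPmf_mul, Finset.sum_mul]
  refine Finset.sum_le_sum fun b _ => ?_
  rw [mul_assoc]
  refine mul_le_mul_of_nonneg_left ?_ (h₀.1 b)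
  set F : (∀ j, B j) → ℝ := fun v => f b v y with hF
  have hF0 : 0 ≤ prodExp p F := prodExp_nonneg hp fun v => hf b v y
  have h1 : prodExp (fun s : (Σ j, D j) => p s.1) (fun v => subOutput f (b, v) y ^ 2) =
      prodExp (fun j => unif (D j)) (fun w => prodExp (fun j => unif (D j)) fun w' =>
        prodExp (fun s : (Σ j, D j) => p s.1)
          (fun v => F (fun j => v ⟨j, w' j⟩) * F (fun j => v ⟨j, w j⟩))) := by
    have e : ∀ v : ∀ s : (Σ j, D j), B s.1, subOutput f (b, v) y ^ 2 =
        ∑ w : ∀ j, D j, (∏ j, unif (D j) (w j)) * ∑ w' : ∀ j, D j, (∏ j, unif (D j) (w' j)) *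
          (F (fun j => v ⟨j, w' j⟩) * F (fun j => v ⟨j, w j⟩)) := by
      intro v
      rw [sq, subOutput, prodExp, Finset.sum_mul_sum]
      refine Finset.sum_congr rfl fun w _ => ?_
      rw [Finset.mul_sum]
      exact Finset.sum_congr rfl fun w' _ => by simp only [hF]; ring
    simp only [e, prodExp_sum, prodExp_const_mul]
    rfl
  rw [h1]
  -- The exact agreement set contributes one term of this nonnegative sum. Allowing agreement on at
  -- least `S` makes each term computable by `prodExp_agree`.
  have h2 : ∀ w w' : ∀ j, D j, prodExp (fun s : (Σ j, D j) => p s.1)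
      (fun v => F (fun j => v ⟨j, w' j⟩) * F (fun j => v ⟨j, w j⟩)) ≤
      ∑ S, (prodExp p F * C S) * (1 * if ∀ j ∈ S, w' j = w j then 1 else 0) := by
    intro w w'
    rw [prodExp_codeword_mul hp w w' F]
    set S := Finset.univ.filter fun j => w' j = w j with hS
    have h3 : prodExp p (fun u => resample p S F u * F u) ≤ prodExp p F * C S := by
      rw [← prodExp_mul_const]
      refine prodExp_mono hp fun u => ?_
      rw [mul_comm]
      exact mul_le_mul_of_nonneg_left (hfC b S u) (hf b u y)
    refine h3.trans ?_
    have h4 := Finset.single_le_sum (f := fun S : Finset J =>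
      (prodExp p F * C S) * (1 * if ∀ j ∈ S, w' j = w j then (1 : ℝ) else 0))
      (fun S _ => mul_nonneg (mul_nonneg hF0 (hC S)) (by split_ifs <;> simp)) (Finset.mem_univ S)
    refine le_trans (le_of_eq ?_) h4
    beta_reduce
    rw [if_pos (fun j hj => (Finset.mem_filter.1 hj).2)]
    ring
  refine (prodExp_mono hu fun w => prodExp_mono hu fun w' => h2 w w').trans (le_of_eq ?_)
  simp only [prodExp_sum, prodExp_const_mul, prodExp_agree hu]
  simp only [resample, prodExp_const hu, mul_one, unif, mul_assoc, ← Finset.mul_sum]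

/-- The output p.m.f. of a code that averages the channel `f` over all codewords. -/
def codeOutput {D₀ : Type*} [Fintype D₀] (f : B₀ → (∀ j, B j) → Y → ℝ)
    (ω : D₀ → SubCodebook B₀ B D) (y : Y) : ℝ :=
  ∑ m, unif D₀ m * subOutput f (ω m) y

/-- Random coding for a channel split into a typical part `f` and a remainder `r`. The typical part
concentrates by the second moment; the remainder counts once in the code and once in the target,
whence the factor two. -/
theorem exists_codebook {D₀ : Type*} [Fintype D₀] [DecidableEq D₀] [Nonempty D₀] {p₀ : B₀ → ℝ}
    {p : ∀ j, B j → ℝ} (h₀ : p₀ ∈ stdSimplex ℝ B₀) (hp : ∀ j, p j ∈ stdSimplex ℝ (B j))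
    {f r : B₀ → (∀ j, B j) → Y → ℝ} (hf : ∀ b v y, 0 ≤ f b v y) (hr : ∀ b v y, 0 ≤ r b v y)
    {q : Y → ℝ} (hq : q ∈ stdSimplex ℝ Y)
    (hfr : ∀ y, ∑ b, p₀ b * prodExp p (fun v => f b v y + r b v y) = q y) {C : Finset J → ℝ}
    (hC : ∀ S, 0 ≤ C S) (hfC : ∀ b S v y, resample p S (fun v => f b v y) v ≤ q y * C S) :
    ∃ ω : D₀ → SubCodebook B₀ B D,
      ∑ y, |codeOutput (fun b v y => f b v y + r b v y) ω y - q y| ≤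
        √((Fintype.card D₀ : ℝ)⁻¹ * ∑ S, C S * ∏ j ∈ S, (Fintype.card (D j) : ℝ)⁻¹) +
          2 * ∑ b, p₀ b * prodExp p (fun v => ∑ y, r b v y) := by
  set μ : Y → ℝ := fun y => ∑ b, p₀ b * prodExp p (fun v => f b v y) with hμ
  set τ : Y → ℝ := fun y => ∑ b, p₀ b * prodExp p (fun v => r b v y) with hτ
  set E := (Fintype.card D₀ : ℝ)⁻¹ * ∑ S, C S * ∏ j ∈ S, (Fintype.card (D j) : ℝ)⁻¹ with hE
  have hE0 : 0 ≤ E := mul_nonneg (by positivity) (Finset.sum_nonneg fun S _ =>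
    mul_nonneg (hC S) (Finset.prod_nonneg fun j _ => by positivity))
  have hρ : ∀ _ : D₀, (subPmf p₀ p : SubCodebook B₀ B D → ℝ) ∈ stdSimplex ℝ _ :=
    fun _ => subPmf_mem h₀ hp
  have hμτ : ∀ y, μ y + τ y = q y := fun y => by
    rw [← hfr y]
    simp only [hμ, hτ, prodExp_add, mul_add, Finset.sum_add_distrib]
  have hμ0 : ∀ y, 0 ≤ μ y := fun y => Finset.sum_nonneg fun b _ =>
    mul_nonneg (h₀.1 b) (prodExp_nonneg hp fun v => hf b v y)
  have hτ0 : ∀ y, 0 ≤ τ y := fun y => Finset.sum_nonneg fun b _ =>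
    mul_nonneg (h₀.1 b) (prodExp_nonneg hp fun v => hr b v y)
  have hτsum : ∑ y, τ y = ∑ b, p₀ b * prodExp p (fun v => ∑ y, r b v y) := by
    simp only [hτ, prodExp_sum, Finset.mul_sum]
    rw [Finset.sum_comm]
  have hu := unif_mem_stdSimplex D₀
  have huD := fun j => unif_mem_stdSimplex (D j)
  have hdev : ∀ y, prodExp (fun _ : D₀ => (subPmf p₀ p : SubCodebook B₀ B D → ℝ))
      (fun ω => |codeOutput f ω y - μ y|) ≤ q y * √E := by
    intro y
    refine abs_le_of_sq_le_sq' ?_ (mul_nonneg (hq.1 y) (Real.sqrt_nonneg _)) |>.2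
    rw [mul_pow, Real.sq_sqrt hE0]
    refine (sq_prodExp_abs_le hρ _).trans ?_
    refine (prodExp_sq_average_sub_le (hρ (Classical.arbitrary D₀))
      (sum_subPmf_mul_subOutput hp f y)).trans ?_
    have h1 := sum_subPmf_mul_subOutput_sq_le (D := D) h₀ hp hf y (C := fun S => q y * C S)
      (fun S => mul_nonneg (hq.1 y) (hC S)) (fun b S v => hfC b S v y)
    refine (mul_le_mul_of_nonneg_left h1 (by positivity)).trans ?_
    simp only [mul_assoc (q y), ← Finset.mul_sum]
    -- This makes the variance at most `q y ^ 2 * E`, so that the deviations sum to `√E` with no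
    -- alphabet-size factor.
    have h2 : μ y ≤ q y := by linarith [hμτ y, hτ0 y]
    have h3 : (Fintype.card D₀ : ℝ)⁻¹ * (μ y * (q y * ∑ S, C S * ∏ j ∈ S,
        (Fintype.card (D j) : ℝ)⁻¹)) = μ y * (q y * E) := by rw [hE]; ring
    rw [h3, sq, mul_assoc]
    exact mul_le_mul_of_nonneg_right h2 (mul_nonneg (hq.1 y) hE0)
  have hrem : ∀ y, prodExp (fun _ : D₀ => (subPmf p₀ p : SubCodebook B₀ B D → ℝ))
      (fun ω => codeOutput r ω y) = τ y := by
    intro y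
    simp only [codeOutput, prodExp_sum, prodExp_const_mul]
    have h1 := fun m : D₀ => prodExp_coord hρ m fun ω => subOutput r ω y
    simp only [h1, sum_subPmf_mul_subOutput hp]
    rw [← Finset.sum_mul, hu.2, one_mul]
  refine exists_le_of_prodExp_le hρ ?_
  have hbound : ∀ ω : D₀ → SubCodebook B₀ B D,
      ∑ y, |codeOutput (fun b v y => f b v y + r b v y) ω y - q y| ≤
        ∑ y, (|codeOutput f ω y - μ y| + codeOutput r ω y + τ y) := by
    intro ω
    refine Finset.sum_le_sum fun y _ => ?_
    have h1 : codeOutput (fun b v y => f b v y + r b v y) ω y =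
        codeOutput f ω y + codeOutput r ω y := by
      simp only [codeOutput, subOutput, prodExp_add, mul_add, Finset.sum_add_distrib]
    have h2 : 0 ≤ codeOutput r ω y := Finset.sum_nonneg fun m _ =>
      mul_nonneg (hu.1 m) (prodExp_nonneg huD fun w => hr _ _ y)
    have h3 : codeOutput f ω y + codeOutput r ω y - q y =
        (codeOutput f ω y - μ y) + (codeOutput r ω y - τ y) := by linarith [hμτ y]
    rw [h1, h3]
    refine (abs_add_le _ _).trans ?_
    have h4 : |codeOutput r ω y - τ y| ≤ codeOutput r ω y + τ y :=
      abs_le.2 ⟨by linarith [hτ0 y], by linarith [hτ0 y]⟩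
    linarith
  refine (prodExp_mono hρ hbound).trans ?_
  simp only [prodExp_sum, prodExp_add, hrem, prodExp_const hρ, Finset.sum_add_distrib, hτsum]
  have h1 := Finset.sum_le_sum fun y (_ : y ∈ Finset.univ) => hdev y
  rw [← Finset.sum_mul, hq.2, one_mul] at h1
  linarith

end SoftCovering

/-! ### Achievability -/

/-- Chernoff exponent: the shifted variable has mean `-δ`, so its moment generating function
decreases at zero. -/
theorem exists_sum_mul_exp_lt_one {Ω : Type*} [Fintype Ω] {P : Ω → ℝ} (hP : P ∈ stdSimplex ℝ Ω)
    (L : Ω → ℝ) {δ : ℝ} (hδ : 0 < δ) :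
    ∃ s, 0 < s ∧ ∑ ω, P ω * Real.exp (s * (L ω - ∑ ω, P ω * L ω - δ)) < 1 := by
  set Z : Ω → ℝ := fun ω => L ω - ∑ ω, P ω * L ω - δ with hZ
  have hmean : ∑ ω, P ω * Z ω = -δ := by
    simp only [hZ, mul_sub, Finset.sum_sub_distrib, ← Finset.sum_mul, hP.2]
    ring
  set b := 1 + ∑ ω, |Z ω| with hb
  have hb0 : 0 < b := by positivity
  have hZb : ∀ ω, |Z ω| ≤ b := fun ω => by
    have := Finset.single_le_sum (f := fun ω => |Z ω|) (fun ω _ => abs_nonneg _) (Finset.mem_univ ω)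
    linarith
  -- The first bound permits `exp x ≤ 1 + x + x ^ 2`; the second makes the quadratic term at most
  -- half of the linear gain `s * δ`.
  set s := min (1 / b) (δ / (2 * b ^ 2)) with hs
  have hs0 : 0 < s := lt_min (by positivity) (by positivity)
  have hs1 : s * b ≤ 1 := by
    have := mul_le_mul_of_nonneg_right (min_le_left (1 / b) (δ / (2 * b ^ 2))) hb0.le
    rwa [div_mul_cancel₀ _ hb0.ne'] at this
  have hs2 : s * b ^ 2 ≤ δ / 2 := by
    have := mul_le_mul_of_nonneg_right (min_le_right (1 / b) (δ / (2 * b ^ 2))) (sq_nonneg b)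
    refine this.trans (le_of_eq ?_)
    field_simp
  have hexp : ∀ ω, Real.exp (s * Z ω) ≤ 1 + s * Z ω + s ^ 2 * b ^ 2 := by
    intro ω
    have h1 : |s * Z ω| ≤ s * b := by
      rw [abs_mul, abs_of_pos hs0]
      exact mul_le_mul_of_nonneg_left (hZb ω) hs0.le
    have h2 := (abs_le.1 (Real.abs_exp_sub_one_sub_id_le (h1.trans hs1))).2
    have h3 : (s * Z ω) ^ 2 ≤ (s * b) ^ 2 := sq_le_sq' (abs_le.1 h1).1 (abs_le.1 h1).2
    nlinarith
  refine ⟨s, hs0, ?_⟩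
  calc ∑ ω, P ω * Real.exp (s * Z ω)
      ≤ ∑ ω, P ω * (1 + s * Z ω + s ^ 2 * b ^ 2) :=
        Finset.sum_le_sum fun ω _ => mul_le_mul_of_nonneg_left (hexp ω) (hP.1 ω)
    _ = 1 + s * (-δ) + s ^ 2 * b ^ 2 := by
        have e : ∀ ω, P ω * (1 + s * Z ω + s ^ 2 * b ^ 2) =
          P ω + s * (P ω * Z ω) + P ω * (s ^ 2 * b ^ 2) := fun ω => by ring
        simp only [e, Finset.sum_add_distrib, ← Finset.mul_sum, ← Finset.sum_mul, hP.2, hmean,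
          one_mul]
    _ < 1 := by nlinarith

section SeqPmf

variable {n : ℕ}

/-- The p.m.f. of `n` i.i.d. letters. -/
def seqPmf {A : Type*} (p : A → ℝ) (n : ℕ) (u : Fin n → A) : ℝ := ∏ k, p (u k)

theorem seqPmf_mem {A : Type*} [Fintype A] {p : A → ℝ} (hp : p ∈ stdSimplex ℝ A) :
    seqPmf p n ∈ stdSimplex ℝ (Fin n → A) :=
  chan_mem_stdSimplex (t := n) (X := fun _ => A) (K := fun _ (_ : Unit) => p) (fun _ _ => hp) ()

variable {J : Type*} [Fintype J] [DecidableEq J] {A : J → Type*} [∀ j, Fintype (A j)]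

theorem prod_seqPmf (p : ∀ j, A j → ℝ) (v : ∀ j, Fin n → A j) :
    ∏ j, seqPmf (p j) n (v j) = ∏ k, ∏ j, p j (letter k v j) := Finset.prod_comm

theorem prodExp_seqPmf (p : ∀ j, A j → ℝ) (g : Fin n → (∀ j, A j) → ℝ) :
    prodExp (fun j => seqPmf (p j) n) (fun v => ∏ k, g k (letter k v)) =
      ∏ k, prodExp p (g k) := by
  simp only [prodExp, prod_seqPmf, ← Finset.prod_mul_distrib]
  exact sum_prod_letter fun k u => (∏ j, p j (u j)) * g k u

theorem resample_seqPmf (p : ∀ j, A j → ℝ) (S : Finset J) (g : Fin n → (∀ j, A j) → ℝ)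
    (v : ∀ j, Fin n → A j) :
    resample (fun j => seqPmf (p j) n) S (fun v => ∏ k, g k (letter k v)) v =
      ∏ k, resample p S (g k) (letter k v) := by
  have h : ∀ (k : Fin n) (v' : ∀ j, Fin n → A j), letter k (S.piecewise v v') =
      S.piecewise (letter k v) (letter k v') := fun k v' => by
    funext j
    by_cases hj : j ∈ S <;> simp [letter, hj]
  simp only [resample, h]
  exact prodExp_seqPmf p fun k u => g k (S.piecewise (letter k v) u)

theorem sum_prod_letters {A₀ : Type*} [Fintype A₀] {I : Type*} [Fintype I] [DecidableEq I]
    {X : I → Type*} [∀ i, Fintype (X i)] (F : A₀ × (∀ j, A j) × (∀ i, X i) → ℝ) :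
    ∑ b : Fin n → A₀, ∑ v : (∀ j, Fin n → A j), ∑ y : (∀ i, Fin n → X i),
      ∏ k, F (b k, letter k v, letter k y) = (∑ ω, F ω) ^ n := by
  have h1 : ∀ (b : Fin n → A₀) (v : ∀ j, Fin n → A j), ∑ y : (∀ i, Fin n → X i),
      ∏ k, F (b k, letter k v, letter k y) = ∏ k, ∑ x, F (b k, letter k v, x) :=
    fun b v => sum_prod_letter fun k x => F (b k, letter k v, x)
  have h2 : ∀ b : Fin n → A₀, ∑ v : (∀ j, Fin n → A j), ∏ k, ∑ x, F (b k, letter k v, x) =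
      ∏ k, ∑ us, ∑ x, F (b k, us, x) :=
    fun b => sum_prod_letter fun k us => ∑ x, F (b k, us, x)
  simp only [h1, h2]
  have h3 := Finset.prod_univ_sum (fun _ : Fin n => (Finset.univ : Finset A₀))
    fun _ u => ∑ us, ∑ x, F (u, us, x)
  rw [Fintype.piFinset_univ] at h3
  rw [← h3, Finset.prod_const, Finset.card_univ, Fintype.card_fin]
  simp only [Fintype.sum_prod_type]

end SeqPmf

/-- The factor two pays for the floor, since the size is at least one. -/
theorem inv_size_le {n : ℕ} {r : ℝ} (hr : 0 ≤ r) :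
    (size n r : ℝ)⁻¹ ≤ 2 * Real.exp (-(n * (r * Real.log 2))) := by
  have h1 : (2 : ℝ) ^ ((n : ℝ) * r) = Real.exp (n * (r * Real.log 2)) := by
    rw [Real.rpow_def_of_pos two_pos]
    ring_nf
  have h2 : (2 : ℝ) ^ ((n : ℝ) * r) < size n r + 1 := Nat.lt_floor_add_one _
  have h3 : (1 : ℝ) ≤ size n r := by exact_mod_cast one_le_size hr
  rw [Real.exp_neg, ← h1, ← div_eq_mul_inv, inv_le_comm₀ (by positivity) (by positivity), inv_div,
    div_le_iff₀ two_pos]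
  linarith

section Achievability

variable {t h : ℕ} {V : Fin t → Finset (Fin h)} {X : Fin t → Type*} [∀ i, Fintype (X i)]
  {A₀ : Type*} [Fintype A₀] {A : Fin h → Type*} [∀ j, Fintype (A j)] {n : ℕ} {R : ℝ}
  {Rs : Fin h → ℝ}

/-- The code in which the processors apply the kernels `K i` letter by letter to the codewords. -/
def codebookCode {K : ∀ i, A₀ → (∀ j : V i, A j) → X i → ℝ}
    (hK : ∀ i u v, K i u v ∈ stdSimplex ℝ (X i))
    (ω : Fin (size n R) → SubCodebook (Fin n → A₀) (fun j => Fin n → A j)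
      fun j => Fin (size n (Rs j))) : Code V X n R Rs where
  dec i m w y := ∏ k, K i ((ω m).1 k) (fun j => (ω m).2 ⟨j, w j⟩ k) (y k)
  dec_mem i m w := chan_mem_stdSimplex (t := n) (X := fun _ => X i)
    (K := fun k (_ : Unit) => K i ((ω m).1 k) (fun j => (ω m).2 ⟨j, w j⟩ k))
    (fun _ _ => hK i _ _) ()

theorem codebookCode_induced {K : ∀ i, A₀ → (∀ j : V i, A j) → X i → ℝ}
    (hK : ∀ i u v, K i u v ∈ stdSimplex ℝ (X i))
    (ω : Fin (size n R) → SubCodebook (Fin n → A₀) (fun j => Fin n → A j)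
      fun j => Fin (size n (Rs j))) (y : ∀ i, Fin n → X i) :
    (codebookCode hK ω).induced y = codeOutput (fun b v y => ∏ k : Fin n,
      ∏ i, K i (b k) ((V i).restrict (letter k v)) (letter k y i)) ω y := by
  rw [Code.induced_eq, codeOutput]
  refine Finset.sum_congr rfl fun m _ => ?_
  congr 1
  rw [subOutput]
  congr 1
  funext w
  simp only [Code.cond, codebookCode]
  rw [Finset.prod_comm]
  rfl

variable [∀ i, DecidableEq (X i)] {pU : A₀ → ℝ} {pUs : ∀ j, A j → ℝ}
  {W : A₀ → (∀ j, A j) → (∀ i, X i) → ℝ} {q : (∀ i, X i) → ℝ}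

/-- Union bound combined with Markov's inequality: a violated condition for `S` makes the
exponential factor of the `S`-term at least one. The terms are products over letters, so their total
sums are `n`-th powers. -/
theorem sum_atypical_le [DecidableEq A₀] [∀ j, DecidableEq (A j)] (hU : pU ∈ stdSimplex ℝ A₀)
    (hUs : ∀ j, pUs j ∈ stdSimplex ℝ (A j)) (hW : ∀ u us, W u us ∈ stdSimplex ℝ (∀ i, X i))
    (hq : law (auxPmf pU pUs W) (fun ω => ω.2.2) = q) (c s : Finset (Fin h) → ℝ)
    (hs : ∀ S, 0 ≤ s S) (b : Fin n → A₀) (v : ∀ j, Fin n → A j) (y : ∀ i, Fin n → X i)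
    (hatyp : ¬ ∀ S, ∏ k, resample pUs S (fun us => W (b k) us (letter k y)) (letter k v) ≤
      iidPmf q n y * Real.exp (n * c S)) :
    seqPmf pU n b * ((∏ j, seqPmf (pUs j) n (v j)) * ∏ k, W (b k) (letter k v) (letter k y)) ≤
      ∑ S, ∏ k, (auxPmf pU pUs W (b k, letter k v, letter k y) * Real.exp (s S *
        (Real.log (resample pUs S (fun us => W (b k) us (letter k y)) (letter k v) /
          q (letter k y)) - c S))) := by
  have hP := auxPmf_mem_stdSimplex hU hUs hW
  have hlhs : seqPmf pU n b * ((∏ j, seqPmf (pUs j) n (v j)) *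
      ∏ k, W (b k) (letter k v) (letter k y)) =
      ∏ k, auxPmf pU pUs W (b k, letter k v, letter k y) := by
    rw [prod_seqPmf]
    simp only [seqPmf, auxPmf, Finset.prod_mul_distrib, mul_assoc]
  rw [hlhs]
  have hterm0 : ∀ S, 0 ≤ ∏ k, (auxPmf pU pUs W (b k, letter k v, letter k y) * Real.exp (s S *
        (Real.log (resample pUs S (fun us => W (b k) us (letter k y)) (letter k v) /
          q (letter k y)) - c S))) := fun S =>
    Finset.prod_nonneg fun k _ => mul_nonneg (hP.1 _) (Real.exp_pos _).le
  by_cases hz : ∃ k : Fin n, auxPmf pU pUs W (b k, letter k v, letter k y) = 0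
  · obtain ⟨k, hk⟩ := hz
    rw [Finset.prod_eq_zero (Finset.mem_univ k) hk]
    exact Finset.sum_nonneg fun S _ => hterm0 S
  push Not at hz hatyp
  have hpos : ∀ k, 0 < auxPmf pU pUs W (b k, letter k v, letter k y) :=
    fun k => lt_of_le_of_ne (hP.1 _) (hz k).symm
  obtain ⟨S, hS⟩ := hatyp
  refine le_trans ?_ (Finset.single_le_sum (fun S _ => hterm0 S) (Finset.mem_univ S))
  rw [Finset.prod_mul_distrib, ← Real.exp_sum, ← Finset.mul_sum]
  refine le_mul_of_one_le_right (Finset.prod_nonneg fun k _ => (hpos k).le) ?_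
  rw [Real.one_le_exp_iff]
  refine mul_nonneg (hs S) ?_
  have hr := fun k => (auxPmf_pos_iff hU hUs hW hq S (hpos k)).1
  have hqp := fun k => (auxPmf_pos_iff hU hUs hW hq S (hpos k)).2
  have hqn : 0 < iidPmf q n y := Finset.prod_pos fun k _ => hqp k
  have h1 := Real.log_le_log (mul_pos hqn (Real.exp_pos _)) hS.le
  rw [Real.log_mul hqn.ne' (Real.exp_pos _).ne', Real.log_exp,
    Real.log_prod fun k _ => (hr k).ne'] at h1
  have h2 : Real.log (iidPmf q n y) = ∑ k, Real.log (q (letter k y)) :=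
    Real.log_prod fun k _ => (hqp k).ne'
  rw [h2] at h1
  rw [Finset.sum_sub_distrib, Finset.sum_const, Finset.card_univ, Fintype.card_fin, nsmul_eq_mul,
    Finset.sum_congr rfl fun k _ => Real.log_div (hr k).ne' (hqp k).ne', Finset.sum_sub_distrib]
  linarith

theorem exists_code [DecidableEq A₀] [∀ j, DecidableEq (A j)] (hU : pU ∈ stdSimplex ℝ A₀)
    (hUs : ∀ j, pUs j ∈ stdSimplex ℝ (A j)) {K : ∀ i, A₀ → (∀ j : V i, A j) → X i → ℝ}
    (hK : ∀ i u v, K i u v ∈ stdSimplex ℝ (X i))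
    (hWK : ∀ u us x, W u us x = ∏ i, K i u ((V i).restrict us) (x i))
    (hlaw : law (auxPmf pU pUs W) (fun ω => ω.2.2) = q) (hR : 0 ≤ R) (hRs : ∀ j, 0 ≤ Rs j)
    (c s : Finset (Fin h) → ℝ) (hs : ∀ S, 0 ≤ s S) :
    ∃ C : Code V X n R Rs, ∑ x, |C.induced x - iidPmf q n x| ≤
      √((size n R : ℝ)⁻¹ * ∑ S, Real.exp (n * c S) * ∏ j ∈ S, (size n (Rs j) : ℝ)⁻¹) +
      2 * ∑ S, (∑ ω, auxPmf pU pUs W ω * Real.exp (s S * (Real.log (resample pUs S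
        (fun us => W ω.1 us ω.2.2) ω.2.1 / q ω.2.2) - c S))) ^ n := by
  classical
  have := nonempty_fin_size (n := n) hR
  have := fun j => nonempty_fin_size (n := n) (hRs j)
  have hW : ∀ u us, W u us ∈ stdSimplex ℝ (∀ i, X i) := fun u us => by
    have := chan_mem_stdSimplex (K := fun i (_ : Unit) => K i u ((V i).restrict us))
      (fun i _ => hK i _ _) ()
    rwa [show W u us = _ from funext (hWK u us)]
  have hP := auxPmf_mem_stdSimplex hU hUs hW
  have hq : q ∈ stdSimplex ℝ (∀ i, X i) := hlaw ▸ law_mem_stdSimplex hP _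
  have hUn := seqPmf_mem (n := n) hU
  have hUsn := fun j => seqPmf_mem (n := n) (hUs j)
  set g : (Fin n → A₀) → (∀ j, Fin n → A j) → (∀ i, Fin n → X i) → ℝ := fun b v y =>
    ∏ k, W (b k) (letter k v) (letter k y) with hg
  have hg0 : ∀ b v y, 0 ≤ g b v y := fun b v y => Finset.prod_nonneg fun k _ => (hW _ _).1 _
  set typ : (Fin n → A₀) → (∀ j, Fin n → A j) → (∀ i, Fin n → X i) → Prop := fun b v y =>
    ∀ S, ∏ k, resample pUs S (fun us => W (b k) us (letter k y)) (letter k v) ≤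
      iidPmf q n y * Real.exp (n * c S) with htyp
  set f : (Fin n → A₀) → (∀ j, Fin n → A j) → (∀ i, Fin n → X i) → ℝ := fun b v y =>
    if typ b v y then g b v y else 0 with hf
  set r : (Fin n → A₀) → (∀ j, Fin n → A j) → (∀ i, Fin n → X i) → ℝ := fun b v y =>
    if typ b v y then 0 else g b v y with hr
  have hfr : ∀ b v y, f b v y + r b v y = g b v y := fun b v y => by
    simp only [hf, hr]
    split_ifs <;> simp
  have hf0 : ∀ b v y, 0 ≤ f b v y := fun b v y => by
    simp only [hf]
    split_ifs
    exacts [hg0 b v y, le_rfl]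
  have hr0 : ∀ b v y, 0 ≤ r b v y := fun b v y => by
    simp only [hr]
    split_ifs
    exacts [le_rfl, hg0 b v y]
  have hres : ∀ b S v y, resample (fun j => seqPmf (pUs j) n) S (fun v => g b v y) v =
      ∏ k, resample pUs S (fun us => W (b k) us (letter k y)) (letter k v) := fun b S v y =>
    resample_seqPmf pUs S (fun k us => W (b k) us (letter k y)) v
  have hmean : ∀ y, ∑ b, seqPmf pU n b * prodExp (fun j => seqPmf (pUs j) n)
      (fun v => f b v y + r b v y) = iidPmf q n y := by
    intro y
    simp only [hfr, hg]
    have h1 : ∀ b : Fin n → A₀, seqPmf pU n b * prodExp (fun j => seqPmf (pUs j) n)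
        (fun v => ∏ k, W (b k) (letter k v) (letter k y)) =
        ∏ k, (pU (b k) * prodExp pUs fun us => W (b k) us (letter k y)) := fun b => by
      rw [prodExp_seqPmf pUs fun k us => W (b k) us (letter k y), seqPmf,
        Finset.prod_mul_distrib]
    simp only [h1]
    have h3 := Finset.prod_univ_sum (fun _ : Fin n => (Finset.univ : Finset A₀))
      fun k u => pU u * prodExp pUs fun us => W u us (letter k y)
    rw [Fintype.piFinset_univ] at h3
    rw [← h3]
    refine Finset.prod_congr rfl fun k _ => ?_
    rw [← law_auxPmf_output, hlaw]
    rfl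
  -- The typicality condition for `S` depends on the codewords in `S` only: if some completion is
  -- typical the untruncated average obeys the bound, and otherwise the truncated one is zero.
  have hfC : ∀ b S v y, resample (fun j => seqPmf (pUs j) n) S (fun v => f b v y) v ≤
      iidPmf q n y * Real.exp (n * c S) := by
    intro b S v y
    have hbd : 0 ≤ iidPmf q n y * Real.exp (n * c S) :=
      mul_nonneg ((iidPmf_mem_stdSimplex hq).1 y) (Real.exp_pos _).le
    by_cases hex : ∃ v', typ b (S.piecewise v v') y
    · obtain ⟨v', hv'⟩ := hex
      have h1 := hv' S
      rw [← hres, resample_piecewise] at h1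
      refine le_trans (prodExp_mono hUsn fun v'' => ?_) h1
      beta_reduce
      rw [← hfr]
      exact le_add_of_nonneg_right (hr0 _ _ _)
    · push Not at hex
      rw [resample]
      simp only [hf, if_neg (hex _), prodExp_const hUsn]
      exact hbd
  obtain ⟨ω, hω⟩ := exists_codebook (D₀ := Fin (size n R)) (D := fun j => Fin (size n (Rs j)))
    hUn hUsn hf0 hr0 (iidPmf_mem_stdSimplex hq) hmean (fun S => (Real.exp_pos (n * c S)).le) hfC
  refine ⟨codebookCode hK ω, ?_⟩
  have hind : ∀ y, (codebookCode hK ω).induced y =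
      codeOutput (fun b v y => f b v y + r b v y) ω y := fun y => by
    rw [codebookCode_induced]
    simp only [hfr, hg, hWK]
  simp only [hind]
  refine hω.trans ?_
  simp only [Fintype.card_fin]
  refine add_le_add_right (mul_le_mul_of_nonneg_left ?_ zero_le_two) _
  simp only [prodExp, Finset.mul_sum]
  calc ∑ b, ∑ v, ∑ y, seqPmf pU n b * ((∏ j, seqPmf (pUs j) n (v j)) * r b v y)
      ≤ ∑ b : Fin n → A₀, ∑ v : (∀ j, Fin n → A j), ∑ y : (∀ i, Fin n → X i), ∑ S,
        ∏ k, (auxPmf pU pUs W (b k, letter k v, letter k y) * Real.exp (s S *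
        (Real.log (resample pUs S (fun us => W (b k) us (letter k y)) (letter k v) /
          q (letter k y)) - c S))) := by
        refine Finset.sum_le_sum fun b _ => Finset.sum_le_sum fun v _ => Finset.sum_le_sum
          fun y _ => ?_
        by_cases ht : typ b v y
        · simp only [hr, if_pos ht, mul_zero]
          exact Finset.sum_nonneg fun S _ => Finset.prod_nonneg fun k _ =>
            mul_nonneg (hP.1 _) (Real.exp_pos _).le
        · simp only [hr, if_neg ht]
          exact sum_atypical_le hU hUs hW hlaw c s hs b v y ht
    _ = _ := by
        simp only [Finset.sum_comm (s := (Finset.univ : Finset (∀ i, Fin n → X i)))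
          (t := (Finset.univ : Finset (Finset (Fin h)))),
          Finset.sum_comm (s := (Finset.univ : Finset (∀ j, Fin n → A j)))
          (t := (Finset.univ : Finset (Finset (Fin h)))),
          Finset.sum_comm (s := (Finset.univ : Finset (Fin n → A₀)))
          (t := (Finset.univ : Finset (Finset (Fin h))))]
        refine Finset.sum_congr rfl fun S _ => ?_
        exact sum_prod_letters fun ω => auxPmf pU pUs W ω * Real.exp (s S * (Real.log
          (resample pUs S (fun us => W ω.1 us ω.2.2) ω.2.1 / q ω.2.2) - c S))

/-- Raising `R` alone creates slack in all constraints at once, because `R` occurs in each of them.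
-/
theorem achievable_add {q : (∀ i, X i) → ℝ} {r : ℝ × (Fin h → ℝ)}
    (hr : r ∈ singleLetterRegion V q) {ε : ℝ} (hε : 0 < ε) : Achievable V q (r.1 + ε) r.2 := by
  obtain ⟨hR, hRs, a, b, P, ⟨hP, hlaw, pU, pUs, K, hU, hUs, hK, hPK⟩, hI⟩ := hr
  set W : Fin a → (∀ j, Fin (b j)) → (∀ i, X i) → ℝ :=
    fun u us x => ∏ i, K i u ((V i).restrict us) (x i) with hWdef
  have hPeq : P = auxPmf pU pUs W := by
    funext ω
    exact hPK ω.1 ω.2.1 ω.2.2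
  subst hPeq
  have hW : ∀ u us, W u us ∈ stdSimplex ℝ (∀ i, X i) := fun u us =>
    chan_mem_stdSimplex (K := fun i (_ : Unit) => K i u ((V i).restrict us))
      (fun i _ => hK i _ _) ()
  have hlog : 0 < Real.log 2 := Real.log_pos one_lt_two
  set δ := ε * Real.log 2 / 2 with hδ
  have hδ0 : 0 < δ := by positivity
  set L : Finset (Fin h) → (Fin a × (∀ j, Fin (b j)) × (∀ i, X i)) → ℝ := fun S ω =>
    Real.log (resample pUs S (fun us => W ω.1 us ω.2.2) ω.2.1 / q ω.2.2) with hL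
  -- The thresholds lie `δ` above the informations, and `ε * log 2 = 2 * δ`: half of the slack
  -- defines typicality, the other half is the covering exponent.
  set c : Finset (Fin h) → ℝ := fun S => ∑ ω, auxPmf pU pUs W ω * L S ω + δ with hc
  have hcle : ∀ S, c S ≤ (r.1 + ∑ j ∈ S, r.2 j) * Real.log 2 + δ := by
    intro S
    have h1 := mul_le_mul_of_nonneg_right (hI S) hlog.le
    rw [mutualInfo_auxPmf hUs hW hlaw, Finset.sum_mul] at h1
    refine add_le_add_left (le_trans (le_of_eq ?_) h1) _
    refine Finset.sum_congr rfl fun ω _ => ?_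
    rw [mul_assoc, Real.logb, div_mul_cancel₀ _ hlog.ne']
  choose s hs hs1 using fun S => exists_sum_mul_exp_lt_one hP (L S) hδ0
  set ρ : Finset (Fin h) → ℝ := fun S => ∑ ω, auxPmf pU pUs W ω *
    Real.exp (s S * (L S ω - c S)) with hρ
  have hρ1 : ∀ S, ρ S < 1 := fun S => by
    have := hs1 S
    simpa only [hρ, hc, sub_add_eq_sub_sub] using this
  have hρ0 : ∀ S, 0 ≤ ρ S := fun S => Finset.sum_nonneg fun ω _ =>
    mul_nonneg (hP.1 ω) (Real.exp_pos _).le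
  have hRε : 0 ≤ r.1 + ε := by linarith
  choose C hC using fun n => exists_code (n := n) hU hUs hK (fun _ _ _ => rfl) hlaw hRε hRs c s
    fun S => (hs S).le
  refine ⟨hRε, hRs, C, ?_⟩
  set B : ℝ := ∑ S : Finset (Fin h), 2 * ∏ _j ∈ S, (2 : ℝ) with hB
  have hE : ∀ n : ℕ, (size n (r.1 + ε) : ℝ)⁻¹ * ∑ S, Real.exp (n * c S) *
      ∏ j ∈ S, (size n (r.2 j) : ℝ)⁻¹ ≤ B * Real.exp (-δ) ^ n := by
    intro n
    rw [Finset.mul_sum, hB, Finset.sum_mul]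
    refine Finset.sum_le_sum fun S _ => ?_
    have h1 := inv_size_le (n := n) hRε
    have h2 : ∏ j ∈ S, (size n (r.2 j) : ℝ)⁻¹ ≤
        ∏ j ∈ S, (2 * Real.exp (-(n * (r.2 j * Real.log 2)))) :=
      Finset.prod_le_prod (fun j _ => by positivity) fun j _ => inv_size_le (hRs j)
    rw [Finset.prod_mul_distrib, ← Real.exp_sum] at h2
    have h3 : Real.exp (n * c S) ≤
        Real.exp (n * ((r.1 + ∑ j ∈ S, r.2 j) * Real.log 2 + δ)) :=
      Real.exp_le_exp.2 (mul_le_mul_of_nonneg_left (hcle S) (Nat.cast_nonneg n))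
    have hprod0 : 0 ≤ ∏ j ∈ S, (size n (r.2 j) : ℝ)⁻¹ :=
      Finset.prod_nonneg fun j _ => by positivity
    refine (mul_le_mul h1 (mul_le_mul h3 h2 hprod0 (Real.exp_pos _).le)
      (mul_nonneg (Real.exp_pos _).le hprod0) (by positivity)).trans (le_of_eq ?_)
    rw [← Real.exp_nat_mul]
    have h4 : ∀ x y z w v : ℝ, 2 * Real.exp x * (Real.exp y * (w * Real.exp z)) =
        2 * w * Real.exp (x + y + z) := fun x y z w v => by
      rw [Real.exp_add, Real.exp_add]; ring
    rw [h4 _ _ _ _ 0]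
    congr 2
    rw [Finset.sum_neg_distrib, ← Finset.mul_sum, ← Finset.sum_mul, hδ]
    ring
  have hlim : Tendsto (fun n : ℕ => √(B * Real.exp (-δ) ^ n) + 2 * ∑ S, ρ S ^ n) atTop (𝓝 0) := by
    have h1 : Tendsto (fun n : ℕ => Real.exp (-δ) ^ n) atTop (𝓝 0) :=
      tendsto_pow_atTop_nhds_zero_of_lt_one (Real.exp_pos _).le
        (by simpa using Real.exp_lt_exp.2 (neg_lt_zero.2 hδ0))
    have h2 := (Real.continuous_sqrt.tendsto _).comp (h1.const_mul B)
    have h3 : Tendsto (fun n : ℕ => ∑ S, ρ S ^ n) atTop (𝓝 (∑ _S : Finset (Fin h), 0)) :=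
      tendsto_finsetSum _ fun S _ => tendsto_pow_atTop_nhds_zero_of_lt_one (hρ0 S) (hρ1 S)
    have h4 := h2.add (h3.const_mul 2)
    simpa using h4
  refine squeeze_zero (fun n => Finset.sum_nonneg fun x _ => abs_nonneg _) (fun n => ?_) hlim
  exact (hC n).trans (add_le_add_left (Real.sqrt_le_sqrt (hE n)) _)

theorem singleLetterRegion_subset_rateRegion (q : (∀ i, X i) → ℝ) :
    singleLetterRegion V q ⊆ rateRegion V q := by
  intro r hr
  have h1 : Tendsto (fun n : ℕ => (r.1 + 1 / ((n : ℝ) + 1), r.2)) atTop (𝓝 r) := by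
    have := (tendsto_one_div_add_atTop_nhds_zero_nat (𝕜 := ℝ)).const_add r.1
    rw [add_zero] at this
    exact this.prodMk_nhds tendsto_const_nhds
  exact mem_closure_of_tendsto h1 (Eventually.of_forall fun n =>
    achievable_add hr (by positivity))

end Achievability

/-! ### The multi-user Wyner common information -/

theorem law_prodMk_le {Ω A B : Type*} [Fintype Ω] [DecidableEq A] [DecidableEq B] {P : Ω → ℝ}
    (hP : P ∈ stdSimplex ℝ Ω) (f : Ω → A) (g : Ω → B) (a : A) (b : B) :
    law P (fun ω => (f ω, g ω)) (a, b) ≤ law P f a ∧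
      law P (fun ω => (f ω, g ω)) (a, b) ≤ law P g b := by
  constructor <;> refine Finset.sum_le_sum fun ω _ => ?_
  · by_cases h : f ω = a <;> by_cases h' : g ω = b <;> simp [h, h', hP.1 ω]
  · by_cases h : f ω = a <;> by_cases h' : g ω = b <;> simp [h, h', hP.1 ω]

theorem mutualInfo_nonneg {Ω A B : Type*} [Fintype Ω] [Fintype A] [Fintype B] [DecidableEq A]
    [DecidableEq B] {P : Ω → ℝ} (hP : P ∈ stdSimplex ℝ Ω) (f : Ω → A) (g : Ω → B) :
    0 ≤ mutualInfo P f g := by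
  have hlog : 0 < Real.log 2 := Real.log_pos one_lt_two
  have hf := law_mem_stdSimplex hP f
  have hg := law_mem_stdSimplex hP g
  have hfg := law_mem_stdSimplex hP fun ω => (f ω, g ω)
  have h1 : ∀ a b, law P (fun ω => (f ω, g ω)) (a, b) - law P f a * law P g b ≤
      law P (fun ω => (f ω, g ω)) (a, b) *
        Real.log (law P (fun ω => (f ω, g ω)) (a, b) / (law P f a * law P g b)) := by
    intro a b
    have hle := law_prodMk_le hP f g a b
    set l := law P (fun ω => (f ω, g ω)) (a, b)
    rcases (hfg.1 (a, b)).eq_or_lt with h | h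
    · have h0 : l = 0 := h.symm
      rw [h0, zero_sub, zero_mul, neg_nonpos]
      exact mul_nonneg (hf.1 a) (hg.1 b)
    · have h0 : 0 < l := h
      have ha := h0.trans_le hle.1
      have hb := h0.trans_le hle.2
      have h2 := Real.one_sub_inv_le_log_of_pos (div_pos h0 (mul_pos ha hb))
      have h3 := mul_le_mul_of_nonneg_left h2 h0.le
      rwa [inv_div, mul_sub, mul_one, mul_div_cancel₀ _ h0.ne'] at h3
  have h2 : 0 ≤ ∑ a, ∑ b, (law P (fun ω => (f ω, g ω)) (a, b) - law P f a * law P g b) := by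
    simp only [Finset.sum_sub_distrib, ← Finset.mul_sum, hg.2, mul_one, hf.2]
    rw [← Fintype.sum_prod_type (fun z => law P (fun ω => (f ω, g ω)) z), hfg.2, sub_self]
  have h3 : mutualInfo P f g * Real.log 2 = ∑ a, ∑ b, law P (fun ω => (f ω, g ω)) (a, b) *
        Real.log (law P (fun ω => (f ω, g ω)) (a, b) / (law P f a * law P g b)) := by
    simp only [mutualInfo, Finset.sum_mul, mul_assoc, Real.logb, div_mul_cancel₀ _ hlog.ne']
  refine nonneg_of_mul_nonneg_left ?_ hlog
  rw [h3]
  exact h2.trans (Finset.sum_le_sum fun a _ => Finset.sum_le_sum fun b _ => h1 a b)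

theorem mutualInfo_auxPmf_of_indep {J : Type*} [Fintype J] [DecidableEq J] {A₀ : Type*} [Fintype A₀]
    [DecidableEq A₀] {A : J → Type*} [∀ j, Fintype (A j)] [∀ j, DecidableEq (A j)] {Y : Type*}
    [Fintype Y] [DecidableEq Y] {pU : A₀ → ℝ} {pUs : ∀ j, A j → ℝ} {w : A₀ → Y → ℝ} {q : Y → ℝ}
    (hUs : ∀ j, pUs j ∈ stdSimplex ℝ (A j)) (hw : ∀ u, w u ∈ stdSimplex ℝ Y)
    (hq : law (auxPmf pU pUs fun u _ => w u) (fun ω => ω.2.2) = q) (S : Finset J) :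
    mutualInfo (auxPmf pU pUs fun u _ => w u) (fun ω => ω.2.2)
      (fun ω => (ω.1, S.restrict ω.2.1)) =
      ∑ u, ∑ x, pU u * w u x * Real.logb 2 (w u x / q x) := by
  rw [mutualInfo_auxPmf hUs (fun u _ => hw u) hq, sum_auxPmf_mul]
  simp only [resample, prodExp_const hUs, Finset.mul_sum, mul_assoc]

theorem mutualInfo_mixture {A₀ Y : Type*} [Fintype A₀] [DecidableEq A₀] [Fintype Y] [DecidableEq Y]
    {P : A₀ × Y → ℝ} {pU : A₀ → ℝ} {w : A₀ → Y → ℝ} {q : Y → ℝ} (hw : ∀ u, w u ∈ stdSimplex ℝ Y)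
    (hP : ∀ u x, P (u, x) = pU u * w u x) (hq : law P (fun ω => ω.2) = q) :
    mutualInfo P (fun ω => ω.2) (fun ω => ω.1) =
      ∑ u, ∑ x, pU u * w u x * Real.logb 2 (w u x / q x) := by
  have h1 : ∀ u x, law P (fun ω => (ω.2, ω.1)) (x, u) = pU u * w u x := fun u x => by
    rw [← hP, law_eq_sum_mul, Finset.sum_eq_single (u, x)]
    · simp
    · rintro ⟨u', x'⟩ _ hne
      rw [if_neg (fun h => hne (by simp only [Prod.mk.injEq] at h ⊢; exact ⟨h.2, h.1⟩)), mul_zero]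
    · simp
  have h2 : ∀ u, law P (fun ω => ω.1) u = pU u := fun u => by
    rw [law_eq_sum_mul, Fintype.sum_prod_type, Finset.sum_eq_single u]
    · simp [hP, ← Finset.mul_sum, (hw u).2]
    · intro u' _ hne
      simp [hne]
    · simp
  rw [mutualInfo, Finset.sum_comm]
  refine Finset.sum_congr rfl fun u _ => Finset.sum_congr rfl fun x _ => ?_
  rw [h1, h2, hq]
  rcases eq_or_ne (pU u) 0 with h0 | h0
  · simp [h0]
  · rw [mul_comm (q x), mul_div_mul_left _ _ h0]

section Wyner

variable {t h : ℕ} {V : Fin t → Finset (Fin h)} {X : Fin t → Type*} [∀ i, Fintype (X i)]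
  [∀ i, DecidableEq (X i)] {q : (∀ i, X i) → ℝ}

/-- The values of `I(X_{[1:t]}; U)` whose infimum is the Wyner common information. -/
def wynerSet (q : (∀ i, X i) → ℝ) : Set ℝ :=
  {c | ∃ (a : ℕ) (P : Fin a × (∀ i, X i) → ℝ) (pU : Fin a → ℝ) (K : ∀ i, Fin a → X i → ℝ),
    P ∈ stdSimplex ℝ (Fin a × (∀ i, X i)) ∧ law P (fun ω => ω.2) = q ∧
    pU ∈ stdSimplex ℝ (Fin a) ∧ (∀ i u, K i u ∈ stdSimplex ℝ (X i)) ∧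
    (∀ u x, P (u, x) = pU u * ∏ i, K i u (x i)) ∧
    c = mutualInfo P (fun ω => ω.2) (fun ω => ω.1)}

theorem wynerSet_nonneg {c : ℝ} (hc : c ∈ wynerSet q) : 0 ≤ c := by
  obtain ⟨a, P, pU, K, hP, -, -, -, -, rfl⟩ := hc
  exact mutualInfo_nonneg hP _ _

theorem mixture_mem_stdSimplex {A₀ Y : Type*} [Fintype A₀] [Fintype Y] {pU : A₀ → ℝ}
    {w : A₀ → Y → ℝ} (hU : pU ∈ stdSimplex ℝ A₀) (hw : ∀ u, w u ∈ stdSimplex ℝ Y) :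
    (fun ω : A₀ × Y => pU ω.1 * w ω.1 ω.2) ∈ stdSimplex ℝ (A₀ × Y) := by
  refine ⟨fun ω => mul_nonneg (hU.1 _) ((hw _).1 _), ?_⟩
  rw [Fintype.sum_prod_type]
  simp only [← Finset.mul_sum, (hw _).2, mul_one, hU.2]

theorem law_mixture {A₀ Y : Type*} [Fintype A₀] [Fintype Y] [DecidableEq Y] (pU : A₀ → ℝ)
    (w : A₀ → Y → ℝ) (x : Y) :
    law (fun ω : A₀ × Y => pU ω.1 * w ω.1 ω.2) (fun ω => ω.2) x = ∑ u, pU u * w u x := by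
  rw [law, Fintype.sum_prod_type]
  simp

/-- Take `U` to be the whole tuple `X`, with deterministic kernels. -/
theorem wynerSet_nonempty (hq : q ∈ stdSimplex ℝ (∀ i, X i)) : (wynerSet q).Nonempty := by
  set e := Fintype.equivFin (∀ i, X i) with he
  set K : ∀ i, Fin (Fintype.card (∀ i, X i)) → X i → ℝ :=
    fun i u => Pi.single (e.symm u i) 1 with hKdef
  have hK : ∀ i u, K i u ∈ stdSimplex ℝ (X i) := fun i u => single_mem_stdSimplex ℝ _
  have hU : (fun u => q (e.symm u)) ∈ stdSimplex ℝ (Fin (Fintype.card (∀ i, X i))) :=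
    ⟨fun u => hq.1 _, by rw [Equiv.sum_comp e.symm q]; exact hq.2⟩
  have hw : ∀ u, (fun x : ∀ i, X i => ∏ i, K i u (x i)) ∈ stdSimplex ℝ (∀ i, X i) :=
    fun u => chan_mem_stdSimplex hK u
  refine ⟨_, _, fun ω => q (e.symm ω.1) * ∏ i, K i ω.1 (ω.2 i), fun u => q (e.symm u), K,
    mixture_mem_stdSimplex hU hw, ?_, hU, hK, fun u x => rfl, rfl⟩
  funext x
  rw [law_mixture (fun u => q (e.symm u)) (fun u (x : ∀ i, X i) => ∏ i, K i u (x i)),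
    Equiv.sum_comp e.symm (fun y => q y * ∏ i, (Pi.single (y i) 1 : X i → ℝ) (x i)),
    Finset.sum_eq_single x]
  · simp
  · intro y _ hne
    obtain ⟨i, hi⟩ := Function.ne_iff.1 hne
    rw [Finset.prod_eq_zero (Finset.mem_univ i) (by simp [Ne.symm hi]), mul_zero]
  · simp

/-- With constant `U_j` the information is the same for all `S`, so the bound on `R` alone implies
all the others. -/
theorem mem_singleLetterRegion_of_mem_wynerSet {c : ℝ} (hc : c ∈ wynerSet q)
    {r : ℝ × (Fin h → ℝ)} (hcr : c ≤ r.1) (hr : ∀ j, 0 ≤ r.2 j) : r ∈ singleLetterRegion V q := by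
  have hc0 := wynerSet_nonneg hc
  obtain ⟨a, P, pU, K, hP, hlaw, hU, hK, hPK, rfl⟩ := hc
  set w : Fin a → (∀ i, X i) → ℝ := fun u x => ∏ i, K i u (x i) with hwdef
  have hw : ∀ u, w u ∈ stdSimplex ℝ (∀ i, X i) := fun u => chan_mem_stdSimplex hK u
  have hUs : ∀ _ : Fin h, (fun _ => 1 : Fin 1 → ℝ) ∈ stdSimplex ℝ (Fin 1) :=
    fun _ => ⟨fun _ => zero_le_one, by simp⟩
  have hlaw' : law (auxPmf pU (fun (_ : Fin h) (_ : Fin 1) => (1 : ℝ)) fun u _ => w u)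
      (fun ω => ω.2.2) = q := by
    funext x
    rw [law_auxPmf_output, ← hlaw, show P = fun ω => pU ω.1 * w ω.1 ω.2 from
      funext fun ω => hPK ω.1 ω.2, law_mixture]
    simp only [prodExp_const hUs]
  refine ⟨hc0.trans hcr, hr, a, fun _ => 1, auxPmf pU (fun _ _ => 1) fun u _ => w u,
    ⟨auxPmf_mem_stdSimplex hU hUs fun u _ => hw u, hlaw', pU, fun _ _ => 1, fun i u _ => K i u,
      hU, hUs, fun i u _ => hK i u, fun u us x => rfl⟩, fun S => ?_⟩
  rw [mutualInfo_auxPmf_of_indep hUs hw hlaw', ← mutualInfo_mixture hw hPK hlaw]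
  exact hcr.trans (le_add_of_nonneg_right (Finset.sum_nonneg fun j _ => hr j))

/-- Only `S = ∅` is used; the `U_j` reach no kernel and can be summed out. -/
theorem exists_mem_wynerSet_le (hV : ∀ i, V i = ∅) {r : ℝ × (Fin h → ℝ)}
    (hr : r ∈ singleLetterRegion V q) : ∃ c ∈ wynerSet q, c ≤ r.1 := by
  obtain ⟨-, -, a, b, P, ⟨hP, hlaw, pU, pUs, K, hU, hUs, hK, hPK⟩, hI⟩ := hr
  have hempty : ∀ i, IsEmpty (V i) := fun i => by
    rw [hV i]
    infer_instance
  set K' : ∀ i, Fin a → X i → ℝ := fun i u => K i u fun j => (hempty i).elim j with hK'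
  set w : Fin a → (∀ i, X i) → ℝ := fun u x => ∏ i, K' i u (x i) with hwdef
  have hw : ∀ u, w u ∈ stdSimplex ℝ (∀ i, X i) :=
    fun u => chan_mem_stdSimplex (K := K') (fun i u => hK i u _) u
  have hPeq : P = auxPmf pU pUs fun u _ => w u := by
    funext ω
    have : ∀ i, (V i).restrict ω.2.1 = fun j => (hempty i).elim j := fun i =>
      funext fun j => (hempty i).elim j
    refine (hPK ω.1 ω.2.1 ω.2.2).trans ?_
    simp only [this]
    rfl
  subst hPeq
  have hlaw' : law (fun ω : Fin a × (∀ i, X i) => pU ω.1 * w ω.1 ω.2) (fun ω => ω.2) = q := by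
    funext x
    rw [law_mixture, ← hlaw, law_auxPmf_output]
    simp only [prodExp_const hUs]
  refine ⟨_, ⟨a, fun ω => pU ω.1 * w ω.1 ω.2, pU, K', mixture_mem_stdSimplex hU hw, hlaw', hU,
    fun i u => hK i u _, fun u x => rfl, rfl⟩, ?_⟩
  have h1 := hI ∅
  rw [mutualInfo_auxPmf_of_indep hUs hw hlaw, Finset.sum_empty, add_zero] at h1
  rwa [mutualInfo_mixture hw (fun _ _ => rfl) hlaw']

theorem rateRegion_of_forall_eq_empty (hq : q ∈ stdSimplex ℝ (∀ i, X i)) (hV : ∀ i, V i = ∅) :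
    rateRegion V q = {r : ℝ × (Fin h → ℝ) | wynerCommonInfo q ≤ r.1 ∧ ∀ j, 0 ≤ r.2 j} := by
  have hbdd : BddBelow (wynerSet q) := ⟨0, fun c hc => wynerSet_nonneg hc⟩
  apply Set.Subset.antisymm
  · intro r hr
    have hr' := rateRegion_subset_singleLetterRegion hq hr
    obtain ⟨c, hc, hcr⟩ := exists_mem_wynerSet_le hV hr'
    exact ⟨(csInf_le hbdd hc).trans hcr, hr'.2.1⟩
  -- Attainment of the infimum is never shown: tuples with slightly larger `R` have a witness, and
  -- the closed rate region contains their limit.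
  · rintro r ⟨hr1, hr2⟩
    have h1 : Tendsto (fun n : ℕ => (r.1 + 1 / ((n : ℝ) + 1), r.2)) atTop (𝓝 r) := by
      have := (tendsto_one_div_add_atTop_nhds_zero_nat (𝕜 := ℝ)).const_add r.1
      rw [add_zero] at this
      exact this.prodMk_nhds tendsto_const_nhds
    refine isClosed_closure.mem_of_tendsto h1 (Eventually.of_forall fun n => ?_)
    have h2 : wynerCommonInfo q < r.1 + 1 / ((n : ℝ) + 1) :=
      hr1.trans_lt (lt_add_of_pos_right _ (by positivity))
    obtain ⟨c, hc, hcr⟩ := exists_lt_of_csInf_lt (wynerSet_nonempty hq) h2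
    exact singleLetterRegion_subset_rateRegion q
      (mem_singleLetterRegion_of_mem_wynerSet hc hcr.le hr2)

end Wyner

end ObliviousCoordinator

end

theorem mainTheorem3 {t h : ℕ} (V : Fin t → Finset (Fin h)) {X : Fin t → Type*}
    [∀ i, Fintype (X i)] [∀ i, DecidableEq (X i)]
    (q : (∀ i, X i) → ℝ) (hq : q ∈ stdSimplex ℝ (∀ i, X i)) :
    ObliviousCoordinator.rateRegion V q = ObliviousCoordinator.singleLetterRegion V q ∧
    ((∀ i, V i = ∅) →
      ObliviousCoordinator.rateRegion V q =
        {r : ℝ × (Fin h → ℝ) |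
          ObliviousCoordinator.wynerCommonInfo q ≤ r.1 ∧ ∀ j, 0 ≤ r.2 j}) := by
  exact ⟨Set.Subset.antisymm (ObliviousCoordinator.rateRegion_subset_singleLetterRegion hq)
    (ObliviousCoordinator.singleLetterRegion_subset_rateRegion q),
    ObliviousCoordinator.rateRegion_of_forall_eq_empty hq⟩
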